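/- Write $\mathbb{R}_+=(0,\infty)$; "increasing" and $\le$ in the plane are coordinatewise. **Geometry.** A continuous strictly increasing (decreasing) curve is a set $\{(t,f(t)) : t\in I\}$ with $I\subset\mathbb{R}$ an interval and $f$ continuous and strictly increasing (decreasing). Let $\Gamma\subset[0,1]^2$ be a continuous strictly decreasing curve with endpoints $(1,0),(0,1)$ (both on $\Gamma$), and let $\Omega$ be the bounded component of $[0,\infty)^2\setminus\Gamma$. Let $\{\Gamma_i\}_{i\in\mathbb{Z}}$ be a locally finite family of pairwise disjoint, continuous, strictly increasing curves in $[0,\infty)^2$, each containing its lower endpoint, which lies on $\partial([0,\infty)^2\setminus\Omega)$, and each unbounded. Let $\{\Omega_i\}_{i\in\mathbb{Z}}$ be the (distinct) connected components of $([0,\infty)^2\setminus\Omega)\setminus\bigcup_i\Gamma_i$, labelled so that $\Gamma_i$ lies on the boundary of exactly the two components $\Omega_i$ and $\Omega_{i-1}$. **Hypotheses.** Let $\mu,\sigma:[0,\infty)^2\to[0,\infty)$ and $\mu_s:\partial\mathbb{R}^2_+\to[0,\infty)$. - (F1) Each $g\in\{\mu,\sigma^2\}$ is bounded and upper semicontinuous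 on $[0,\infty)^2$, $g=0$ on $\Omega$, there is a constant $C$ such that $g|_{\Omega_i}$ is Lipschitz with constant $C$ for every $i$, and for all $i$ and $y\in\Gamma_i$ the value $g(y)$ is the larger of the two limits $\lim_{\Omega_{i-1}\ni z\to y}g(z)$ and $\lim_{\Omega_i\ni z\to y}g(z)$. - (F2) $\mu_s$ is bounded and upper semicontinuous on $\partial\mathbb{R}^2_+$ with a locally finite set of discontinuities. We set $\mu_s=0$ on $\mathbb{R}^2_+$. - (F3) For every $i$ and $x\in\Gamma_i$ there are $\varepsilon>0$ and $\zeta\in\{-1,1\}$ such that, for all $y\in B_\varepsilon(x)\cap\Gamma_i$ and both $g=\mu$ and $g=\sigma^2$ (with the same $\zeta$), $\zeta\big(\lim_{\Omega_{i-1}\ni z\to y}g(z)-\lim_{\Omega_i\ni z\to y}g(z)\big)\ge 0$. - (Zero set) For $x\in\mathbb{R}^2_+$, $\sigma(x)=0$ implies $\mu(x)=0$. **Problem (P).** Put $\phi(x)=(x_1+x_2)\int_0^1\big(\mu(tx)+\mu_s(tx)\big)\,dt$ and consider $$(U_{x_1}-\mu)_+(U_{x_2}-\mu)_+=\sigma^2\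 \text{ on }\mathbb{R}^2_+,\qquad U=\phi\ \text{ on }\partial\mathbb{R}^2_+ .\tag{P}$$ With $H(x,p)=(p_1-\mu(x))_+(p_2-\mu(x))_+-\sigma(x)^2$, a monotone viscosity solution of (P) is a continuous function $U:[0,\infty)^2\to\mathbb{R}$, non-decreasing in each variable, with $U=\phi$ on $\partial\mathbb{R}^2_+$, such that for all $x\in\mathbb{R}^2_+$: $\liminf_{y\to x}H(y,p)\le0$ for every $p$ in the superdifferential $D^+U(x)$, and $\limsup_{y\to x}H(y,p)\ge0$ for every $p$ in the subdifferential $D^-U(x)$ (the limits include $y=x$, i.e. they are the semicontinuous envelopes of $H$ in $x$). **Scheme (S).** For $h>0$ and $i,j\in\mathbb{N}_0$ let $\mu_{i,j}=\mu(hi,hj)+\mu_s(hi,hj)$, $\sigma_{i,j}=\sigma(hi,hj)$, and $$U^h_{i,j}=\tfrac12\big(U^h_{i-1,j}+U^h_{i,j-1}\big)+h\mu_{i,j}+\tfrac12\sqrt{\big(U^h_{i-1,j}-U^h_{i,j-1}\big)^2+4h^2\sigma_{i,j}^2},\tag{S}$$ where $U^h_{i,j}=0$ for $(i,j)\notin\mathbb{N}_0^2$.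 Let $U^h(x)=U^h_{\lfloor x_1/h\rfloor,\lfloor x_2/h\rfloor}$ for $x\in[0,\infty)^2$. **Corollary.** Under these hypotheses (P) has exactly one monotone viscosity solution $U$, and $U^h\to U$ locally uniformly on $[0,\infty)^2$ as $h\to0^+$. -/

import Mathlib

open Set Filter Topology

noncomputable section

namespace DLPP

/-! Points of the plane are elements of `ℝ × ℝ`, with the coordinatewise order. All metric notions
below (Lipschitz continuity, small balls, `o(|x - y|)`, boundedness) are insensitive to replacing the
Euclidean norm by the equivalent maximum norm of `ℝ × ℝ`. Functions on `[0,∞)²` (or on its boundary)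
are represented by functions on `ℝ × ℝ`, whose values elsewhere are never used. -/

/-- The closed quadrant `[0,∞)²`. -/
def quadrant : Set (ℝ × ℝ) := {x | 0 ≤ x.1 ∧ 0 ≤ x.2}

/-- The open quadrant `ℝ²₊ = (0,∞)²`. -/
def openQuadrant : Set (ℝ × ℝ) := {x | 0 < x.1 ∧ 0 < x.2}

/-- The boundary `∂ℝ²₊`: the two nonnegative coordinate half-axes. -/
def axes : Set (ℝ × ℝ) := {x | x ∈ quadrant ∧ (x.1 = 0 ∨ x.2 = 0)}

/-- `S` is a continuous strictly increasing curve `{(t, f t) : t ∈ I}`, with `I` an interval. -/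
def IsIncreasingCurve (S : Set (ℝ × ℝ)) : Prop :=
  ∃ (I : Set ℝ) (f : ℝ → ℝ), I.OrdConnected ∧ ContinuousOn f I ∧ StrictMonoOn f I ∧
    S = (fun t => (t, f t)) '' I

/-- `S` is a continuous strictly decreasing curve `{(t, f t) : t ∈ I}`, with `I` an interval. -/
def IsDecreasingCurve (S : Set (ℝ × ℝ)) : Prop :=
  ∃ (I : Set ℝ) (f : ℝ → ℝ), I.OrdConnected ∧ ContinuousOn f I ∧ StrictAntiOn f I ∧
    S = (fun t => (t, f t)) '' I

/-- `Ω`: the bounded connected component of the complement of `Γ` in `[0,∞)²`. -/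
def boundedPart (Γ : Set (ℝ × ℝ)) : Set (ℝ × ℝ) :=
  {x | x ∈ quadrant \ Γ ∧ Bornology.IsBounded (connectedComponentIn (quadrant \ Γ) x)}

/-- The curves `Γ`, `Γ_i` and the regions `Ω_i` in `[0,∞)²`. -/
structure Configuration where
  /-- The decreasing curve `Γ`. -/
  Γ : Set (ℝ × ℝ)
  /-- The increasing curves `Γ_i`. -/
  curve : ℤ → Set (ℝ × ℝ)
  /-- The regions `Ω_i`. -/
  region : ℤ → Set (ℝ × ℝ)
  decreasing : IsDecreasingCurve Γ
  subset_square : Γ ⊆ Icc (0, 0) (1, 1)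
  endpoint_right : ((1, 0) : ℝ × ℝ) ∈ Γ
  endpoint_top : ((0, 1) : ℝ × ℝ) ∈ Γ
  increasing : ∀ i, IsIncreasingCurve (curve i)
  curve_subset : ∀ i, curve i ⊆ quadrant
  /-- One endpoint of `Γ_i` is on `∂([0,∞)² \ Ω)`; by monotonicity it is the least point. -/
  start : ∀ i, ∃ p ∈ curve i, (∀ q ∈ curve i, p ≤ q) ∧ p ∈ frontier (quadrant \ boundedPart Γ)
  /-- The other endpoint of `Γ_i` is at infinity. -/
  unbounded : ∀ i, ¬ Bornology.IsBounded (curve i)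
  locallyFinite : LocallyFinite curve
  disjoint : Pairwise fun i j => Disjoint (curve i) (curve j)
  /-- Every `Ω_i` is a connected component of the complement of `⋃ Γ_i` in `[0,∞)² \ Ω`. -/
  region_component : ∀ i, ∃ x ∈ (quadrant \ boundedPart Γ) \ ⋃ j, curve j,
    region i = connectedComponentIn ((quadrant \ boundedPart Γ) \ ⋃ j, curve j) x
  /-- Every such component is one of the `Ω_i`. -/
  region_cover : (quadrant \ boundedPart Γ) \ ⋃ j, curve j ⊆ ⋃ i, region i
  /-- Different labels belong to different components. -/
  region_injective : Function.Injective region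
  /-- The components having `Γ_i` on their boundary are exactly `Ω_i` and `Ω_{i-1}`. -/
  curve_boundary : ∀ i j, curve i ⊆ frontier (region j) ↔ j = i ∨ j = i - 1

/-- (F1): `g : [0,∞)² → [0,∞)` is bounded and upper semicontinuous, it vanishes on `Ω`, and it is
Lipschitz on all `Ω_i` with a common constant. -/
structure Configuration.F1 (G : Configuration) (g : ℝ × ℝ → ℝ) : Prop where
  nonneg : ∀ x ∈ quadrant, 0 ≤ g x
  bounded : BddAbove (g '' quadrant)
  usc : UpperSemicontinuousOn g quadrant
  zero : ∀ x ∈ boundedPart G.Γ, g x = 0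
  lipschitz : ∃ C : NNReal, ∀ i, LipschitzOnWith C g (G.region i)

/-- On each `Γ_i`, the value of `g` is the larger one of its two one-sided limits. -/
def Configuration.MaxOnCurves (G : Configuration) (g : ℝ × ℝ → ℝ) : Prop :=
  ∀ i, ∀ y ∈ G.curve i, ∃ a b : ℝ,
    Tendsto g (𝓝[G.region (i - 1)] y) (𝓝 a) ∧ Tendsto g (𝓝[G.region i] y) (𝓝 b) ∧ g y = max a b

/-- `ζ (lim_{Ω_{i-1} ∋ z → y} g z - lim_{Ω_i ∋ z → y} g z) ≥ 0`, where both limits exist. -/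
def Configuration.SignedJump (G : Configuration) (g : ℝ × ℝ → ℝ) (i : ℤ) (ζ : ℝ) (y : ℝ × ℝ) :
    Prop :=
  ∃ a b : ℝ,
    Tendsto g (𝓝[G.region (i - 1)] y) (𝓝 a) ∧ Tendsto g (𝓝[G.region i] y) (𝓝 b) ∧
      0 ≤ ζ * (a - b)

/-- `g₁` and `g₂` simultaneously satisfy (F3), that is, with the same sign `ζ`. -/
def Configuration.SimultaneousF3 (G : Configuration) (g₁ g₂ : ℝ × ℝ → ℝ) : Prop :=
  ∀ i, ∀ x ∈ G.curve i, ∃ ε > 0, ∃ ζ : ℝ, (ζ = -1 ∨ ζ = 1) ∧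
    ∀ y ∈ Metric.ball x ε ∩ G.curve i, G.SignedJump g₁ i ζ y ∧ G.SignedJump g₂ i ζ y

/-- (F2): `μs : ∂ℝ²₊ → [0,∞)` is bounded and upper semicontinuous, with a locally finite set of
discontinuities. -/
structure F2 (μs : ℝ × ℝ → ℝ) : Prop where
  nonneg : ∀ x ∈ axes, 0 ≤ μs x
  bounded : BddAbove (μs '' axes)
  usc : UpperSemicontinuousOn μs axes
  discontinuities : ∀ x, ∃ V ∈ 𝓝 x, ({y ∈ axes | ¬ ContinuousWithinAt μs axes y} ∩ V).Finite

/-- The superdifferential `D⁺u(x)` relative to `O`. -/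
def superdifferential (O : Set (ℝ × ℝ)) (u : ℝ × ℝ → ℝ) (x : ℝ × ℝ) : Set (ℝ × ℝ) :=
  {p | ∀ ε > 0, ∀ᶠ y in 𝓝[O] x,
    u y ≤ u x + (p.1 * (y.1 - x.1) + p.2 * (y.2 - x.2)) + ε * ‖y - x‖}

/-- The subdifferential `D⁻u(x)` relative to `O`. -/
def subdifferential (O : Set (ℝ × ℝ)) (u : ℝ × ℝ → ℝ) (x : ℝ × ℝ) : Set (ℝ × ℝ) :=
  {p | ∀ ε > 0, ∀ᶠ y in 𝓝[O] x,
    u x + (p.1 * (y.1 - x.1) + p.2 * (y.2 - x.2)) - ε * ‖y - x‖ ≤ u y}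

/-- Viscosity subsolutions of `H(x, Du) = 0` on the open set `O`, for `H` locally bounded in `x`. The
lower limit includes the point `y = x`, hence is the lower semicontinuous envelope of `H` in `x`. -/
def IsViscositySubsolution (H : ℝ × ℝ → ℝ × ℝ → ℝ) (O : Set (ℝ × ℝ)) (u : ℝ × ℝ → ℝ) : Prop :=
  UpperSemicontinuousOn u O ∧
    ∀ x ∈ O, ∀ p ∈ superdifferential O u x, liminf (fun y => H y p) (𝓝[O] x) ≤ 0

/-- Viscosity supersolutions of `H(x, Du) = 0` on the open set `O`, for `H` locally bounded in `x`. -/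
def IsViscositySupersolution (H : ℝ × ℝ → ℝ × ℝ → ℝ) (O : Set (ℝ × ℝ)) (u : ℝ × ℝ → ℝ) : Prop :=
  LowerSemicontinuousOn u O ∧
    ∀ x ∈ O, ∀ p ∈ subdifferential O u x, 0 ≤ limsup (fun y => H y p) (𝓝[O] x)

/-- The Hamiltonian `(p₁ - μ(x))₊ (p₂ - μ(x))₊ - σ(x)²`. -/
def hamiltonian (μ σ : ℝ × ℝ → ℝ) (x p : ℝ × ℝ) : ℝ :=
  max (p.1 - μ x) 0 * max (p.2 - μ x) 0 - σ x ^ 2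

/-- The boundary data `φ(x) = (x₁ + x₂) ∫₀¹ μ(tx) + μs(tx) dt`, for `x ∈ ∂ℝ²₊`. -/
def boundaryData (μ μs : ℝ × ℝ → ℝ) (x : ℝ × ℝ) : ℝ :=
  (x.1 + x.2) * ∫ t in (0 : ℝ)..1, (μ (t • x) + μs (t • x))

/-- `U` is a monotone viscosity solution of the boundary value problem
`(U_{x₁} - μ)₊ (U_{x₂} - μ)₊ = σ²` on `ℝ²₊`, `U = φ` on `∂ℝ²₊`. -/
structure IsMonotoneSolution (μ σ μs U : ℝ × ℝ → ℝ) : Prop where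
  continuousOn : ContinuousOn U quadrant
  monotoneOn : MonotoneOn U quadrant
  subsolution : IsViscositySubsolution (hamiltonian μ σ) openQuadrant U
  supersolution : IsViscositySupersolution (hamiltonian μ σ) openQuadrant U
  boundary : ∀ x ∈ axes, U x = boundaryData μ μs x

/-- The update of the scheme, where `a`, `b` are the values at the left and the lower neighbour and
`m`, `s` are the values of `μ` and `σ` at the grid point. -/
def update (h m s a b : ℝ) : ℝ :=
  (a + b) / 2 + h * m + √((a - b) ^ 2 + 4 * h ^ 2 * s ^ 2) / 2

/-- The scheme for `i, j ∈ ℕ₀`, with the value `0` at all neighbours outside `ℕ₀²`. -/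
def gridSolution (h : ℝ) (m s : ℕ → ℕ → ℝ) : ℕ → ℕ → ℝ
  | 0, 0 => update h (m 0 0) (s 0 0) 0 0
  | 0, j + 1 => update h (m 0 (j + 1)) (s 0 (j + 1)) 0 (gridSolution h m s 0 j)
  | i + 1, 0 => update h (m (i + 1) 0) (s (i + 1) 0) (gridSolution h m s i 0) 0
  | i + 1, j + 1 => update h (m (i + 1) (j + 1)) (s (i + 1) (j + 1))
      (gridSolution h m s i (j + 1)) (gridSolution h m s (i + 1) j)
termination_by i j => i + j

/-- `μ_{i,j} = μ(hi, hj) + μs(hi, hj)`, where `μs` is extended by `0` to `ℝ²₊`. -/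
def gridMean (μ μs : ℝ × ℝ → ℝ) (h : ℝ) (i j : ℕ) : ℝ :=
  μ (h * i, h * j) + axes.indicator μs (h * i, h * j)

/-- `U^h(x) = U^h_{⌊x₁/h⌋, ⌊x₂/h⌋}`: the piecewise constant extension of the numerical solution. -/
def numericalSolution (μ σ μs : ℝ × ℝ → ℝ) (h : ℝ) (x : ℝ × ℝ) : ℝ :=
  gridSolution h (gridMean μ μs h) (fun i j => σ (h * i, h * j)) ⌊x.1 / h⌋₊ ⌊x.2 / h⌋₊

/-- The scheme in one formula: with the convention that the values outside `ℕ₀²` are `0`, every grid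
value is obtained from its left and its lower neighbour by the same update. -/
theorem gridSolution_eq (h : ℝ) (m s : ℕ → ℕ → ℝ) (i j : ℕ) :
    gridSolution h m s i j = update h (m i j) (s i j)
      (if i = 0 then 0 else gridSolution h m s (i - 1) j)
      (if j = 0 then 0 else gridSolution h m s i (j - 1)) := by
  rcases i with _ | i <;> rcases j with _ | j <;> rw [gridSolution] <;> simp

end DLPP

end

/-!
Uniqueness rests on a comparison principle for continuous sub- and supersolutions, and existence and
convergence follow from it by the method of half-relaxed limits. The weights `μ` and `σ` are
discontinuous, so neither part is standard. Only a few properties of the weights enter, collected in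
`Admissible`; `Configuration.admissible` derives them from the geometry of the curves.

*Subgradients.* In the doubling of variables the positive parts in the Hamiltonian are harmless only
if the subgradients `p` of a supersolution satisfy `p₁, p₂ ≥ m` wherever `μ ≥ m` nearby. Where the
weights are continuous this follows from the supersolution inequality if `σ ≠ 0`, and from the
monotonicity of the supersolution and the hypothesis on the zero set if `σ = 0`. At a discontinuity
it follows by integrating along a horizontal or vertical segment, which meets the discontinuities in
isolated points only (`Admissible.le_fst_of_supersolution`).

*Comparison.* The variables are doubled with the penalization `|(y - x) / δ - e|²`, where the
subsolution is evaluated at `x` and the supersolution at `y`. At the maximum point `y - x ≈ δ e`, and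
the argument closes if `μ` and `σ²` do not decrease from `x` to `y`, up to a small error
(`Admissible.not_isLocalMax`). Such a favorable direction `e` is `(1, 1)` at points of `Γ`, pointing
out of `Ω` where the weights vanish. On an increasing curve it is `(1, -1)` or `(-1, 1)`, pointing to
the side on which the weights are larger, which is the same side for both by `SimultaneousF3`. Only
the points on both `Γ` and an increasing curve are left. They are isolated, and since the equation is
causal (the comparison at `z` only involves points near the rectangle `[0, z]`), they are covered by
an induction and continuity from below (`Admissible.comparison`).

*The scheme.* The update is the larger root of a quadratic equation which is the discrete form of the
equation. An explicit barrier bounds the increase of `U^h` across a thin vertical strip by the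
vertical variation of `μ` in the strip, which is small because a vertical line meets the
discontinuities in finitely many points (`gridSolution_add_le`, `numericalSolution_fst_le_add`).
Hence the family `U^h` is asymptotically equicontinuous, and its upper and lower limits as `h → 0`
are continuous and nondecreasing. They are sub- and supersolutions, respectively, by evaluating the
scheme at grid points where `U^h` minus a cone is extremal (`frequently_backward_difference`), and on
the axes both are equal to the boundary data, by convergence of Riemann sums. By comparison they
agree (`Admissible.exists_unique_solution`).
-/

namespace DLPP

/-! ### Test functions and semicontinuous envelopes -/

theorem isOpen_openQuadrant : IsOpen openQuadrant :=
  (isOpen_lt continuous_const continuous_fst).inter (isOpen_lt continuous_const continuous_snd)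

theorem isClosed_quadrant : IsClosed quadrant :=
  (isClosed_le continuous_const continuous_fst).inter (isClosed_le continuous_const continuous_snd)

theorem openQuadrant_subset_quadrant : openQuadrant ⊆ quadrant := fun _ hx => ⟨hx.1.le, hx.2.le⟩

theorem quadrant_mem_nhds {x : ℝ × ℝ} (hx : x ∈ openQuadrant) : quadrant ∈ 𝓝 x :=
  mem_of_superset (isOpen_openQuadrant.mem_nhds hx) openQuadrant_subset_quadrant

theorem mem_axes_of_not_openQuadrant {x : ℝ × ℝ} (hx : x ∈ quadrant) (h : x ∉ openQuadrant) :
    x ∈ axes := by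
  refine ⟨hx, ?_⟩
  by_contra! hne
  exact h ⟨lt_of_le_of_ne hx.1 (Ne.symm hne.1), lt_of_le_of_ne hx.2 (Ne.symm hne.2)⟩

/-- Touching from below by a separable test function `A y₁ + B y₂`. -/
theorem mem_subdifferential_of_separable {O : Set (ℝ × ℝ)} {v : ℝ × ℝ → ℝ} {A B : ℝ → ℝ}
    {x p : ℝ × ℝ} (hA : HasDerivAt A p.1 x.1) (hB : HasDerivAt B p.2 x.2)
    (hmin : ∀ᶠ y in 𝓝[O] x, v x - (A x.1 + B x.2) ≤ v y - (A y.1 + B y.2)) :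
    p ∈ subdifferential O v x := by
  intro ε hε
  have hF : HasFDerivAt (fun y : ℝ × ℝ => A y.1 + B y.2)
      (p.1 • ContinuousLinearMap.fst ℝ ℝ ℝ + p.2 • ContinuousLinearMap.snd ℝ ℝ ℝ) x :=
    (hA.comp_hasFDerivAt x hasFDerivAt_fst).add (hB.comp_hasFDerivAt x hasFDerivAt_snd)
  have h2 := (hF.isLittleO.def hε).filter_mono (nhdsWithin_le_nhds (s := O))
  filter_upwards [hmin, h2] with y h3 h4
  have h5 := (abs_le.1 (Real.norm_eq_abs _ ▸ h4)).1
  simp only [add_apply, smul_apply, ContinuousLinearMap.coe_fst',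
    ContinuousLinearMap.coe_snd', smul_eq_mul, Prod.fst_sub, Prod.snd_sub] at h5
  linarith

theorem mem_superdifferential_iff_neg {O : Set (ℝ × ℝ)} {u : ℝ × ℝ → ℝ} {x p : ℝ × ℝ} :
    p ∈ superdifferential O u x ↔ -p ∈ subdifferential O (fun y => -u y) x := by
  refine forall₂_congr fun ε _ => ?_
  refine eventually_congr (Eventually.of_forall fun y => ?_)
  simp only [Prod.fst_neg, Prod.snd_neg]
  constructor <;> intro h <;> linarith

/-- Touching from above by a separable test function `A y₁ + B y₂`. -/
theorem mem_superdifferential_of_separable {O : Set (ℝ × ℝ)} {u : ℝ × ℝ → ℝ} {A B : ℝ → ℝ}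
    {x p : ℝ × ℝ} (hA : HasDerivAt A p.1 x.1) (hB : HasDerivAt B p.2 x.2)
    (hmax : ∀ᶠ y in 𝓝[O] x, u y - (A y.1 + B y.2) ≤ u x - (A x.1 + B x.2)) :
    p ∈ superdifferential O u x := by
  rw [mem_superdifferential_iff_neg]
  refine mem_subdifferential_of_separable (A := fun t => -A t) (B := fun t => -B t)
    hA.neg hB.neg ?_
  filter_upwards [hmax] with y hy
  linarith

theorem hasDerivAt_sq_posPart (a t : ℝ) :
    HasDerivAt (fun s => (max (s - a) 0) ^ 2) (2 * max (t - a) 0) t := by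
  rw [hasDerivAt_iff_isLittleO]
  have h1 : (fun s => (max (s - a) 0) ^ 2 - (max (t - a) 0) ^ 2 - (s - t) • (2 * max (t - a) 0))
      =O[𝓝 t] fun s => (s - t) ^ 2 := by
    refine Asymptotics.IsBigO.of_bound 1 (Eventually.of_forall fun s => ?_)
    rw [Real.norm_eq_abs, Real.norm_eq_abs, abs_of_nonneg (sq_nonneg (s - t)), smul_eq_mul, abs_le]
    rcases le_total (s - a) 0 with hs | hs <;> rcases le_total (t - a) 0 with ht | ht <;>
      simp only [max_eq_left, max_eq_right, hs, ht] <;> constructor <;> nlinarith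
  refine h1.trans_isLittleO ?_
  have h2 : (fun s : ℝ => s - t) =o[𝓝 t] fun _ => (1 : ℝ) := by
    rw [Asymptotics.isLittleO_one_iff]
    have : Tendsto (fun s : ℝ => s - t) (𝓝 t) (𝓝 (t - t)) :=
      (continuous_id.sub continuous_const).tendsto t
    simpa using this
  have h3 := h2.mul_isBigO (Asymptotics.isBigO_refl (fun s : ℝ => s - t) (𝓝 t))
  simpa [sq] using h3

/-- There is a direction `e` in which `μ` and `σ²` do not jump downwards at `x₀`: up to an arbitrarily
small error, they do not decrease from `x` to `y ≈ x + δ e`, for `x` close to `x₀` and `δ` small. The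
error in `y` may be a fixed multiple of `δ`, that is, all directions close to `e` are covered; at
points of continuity `e = 0` is possible. -/
def HasFavorableDirection (μ σ : ℝ × ℝ → ℝ) (x₀ : ℝ × ℝ) : Prop :=
  ∃ e : ℝ × ℝ, ∃ c > 0, ∀ η > 0, ∃ r > 0, ∀ x ∈ Metric.ball x₀ r, ∀ δ, 0 < δ → δ < r →
    ∀ y, ‖y - x - δ • e‖ < c * δ → μ x ≤ μ y + η ∧ σ x ^ 2 ≤ σ y ^ 2 + η

/-- The structural hypotheses on `μ` and `σ` which the comparison principle and the convergence of
the scheme rely on. The set `E` of `exists_discontinuities` contains all discontinuities and is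
crossed by horizontal and vertical segments in finitely many points only; the set `S` of
`exists_favorable` contains the points without a favorable direction. -/
structure Admissible (μ σ : ℝ × ℝ → ℝ) : Prop where
  nonneg : ∀ x ∈ quadrant, 0 ≤ μ x ∧ 0 ≤ σ x
  bounded : ∃ M, ∀ x ∈ quadrant, μ x ≤ M ∧ σ x ≤ M
  usc : UpperSemicontinuousOn μ quadrant ∧ UpperSemicontinuousOn (fun x => σ x ^ 2) quadrant
  zero : ∀ x ∈ openQuadrant, σ x = 0 → μ x = 0
  exists_discontinuities : ∃ E : Set (ℝ × ℝ), IsClosed E ∧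
    (∀ x ∈ quadrant, x ∉ E → ContinuousWithinAt μ quadrant x ∧
      ContinuousWithinAt (fun x => σ x ^ 2) quadrant x) ∧
    (∀ c R : ℝ, {t ∈ Icc 0 R | (c, t) ∈ E ∧ 0 ≤ c}.Finite) ∧
    (∀ c R : ℝ, {t ∈ Icc 0 R | (t, c) ∈ E ∧ 0 ≤ c}.Finite)
  exists_favorable : ∃ S : Set (ℝ × ℝ), (∀ z, (S ∩ Icc (0, 0) z).Finite) ∧
    ∀ x ∈ openQuadrant, x ∉ S → HasFavorableDirection μ σ x

theorem neg_le_hamiltonian {μ σ : ℝ × ℝ → ℝ} {M : ℝ}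
    (hM : ∀ x ∈ quadrant, σ x ^ 2 ≤ M) {x : ℝ × ℝ} (hx : x ∈ quadrant) (p : ℝ × ℝ) :
    -M ≤ hamiltonian μ σ x p := by
  have h1 : 0 ≤ max (p.1 - μ x) 0 * max (p.2 - μ x) 0 :=
    mul_nonneg (le_max_right _ _) (le_max_right _ _)
  have h2 := hM x hx
  unfold hamiltonian
  linarith

theorem hamiltonian_le_mul {μ σ : ℝ × ℝ → ℝ} {m s : ℝ} {x p : ℝ × ℝ}
    (hm : m ≤ μ x) (hs : s ≤ σ x ^ 2) :
    hamiltonian μ σ x p ≤ max (p.1 - m) 0 * max (p.2 - m) 0 - s := by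
  unfold hamiltonian
  have : max (p.1 - μ x) 0 * max (p.2 - μ x) 0 ≤ max (p.1 - m) 0 * max (p.2 - m) 0 := by
    gcongr
  linarith

theorem mul_le_hamiltonian {μ σ : ℝ × ℝ → ℝ} {m s : ℝ} {x p : ℝ × ℝ}
    (hm : μ x ≤ m) (hs : σ x ^ 2 ≤ s) :
    max (p.1 - m) 0 * max (p.2 - m) 0 - s ≤ hamiltonian μ σ x p := by
  unfold hamiltonian
  have : max (p.1 - m) 0 * max (p.2 - m) 0 ≤ max (p.1 - μ x) 0 * max (p.2 - μ x) 0 := by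
    gcongr
  linarith

theorem Admissible.exists_sq_bound {μ σ : ℝ × ℝ → ℝ} (h : Admissible μ σ) :
    ∃ M, ∀ x ∈ quadrant, σ x ^ 2 ≤ M := by
  obtain ⟨M, hM⟩ := h.bounded
  exact ⟨M ^ 2, fun x hx => pow_le_pow_left₀ (h.nonneg x hx).2 (hM x hx).2 2⟩

theorem tendsto_posPart_mul (p : ℝ × ℝ) (m s : ℝ) :
    Tendsto (fun η : ℝ => max (p.1 - (m + η)) 0 * max (p.2 - (m + η)) 0 - (s + η)) (𝓝[>] 0)
      (𝓝 (max (p.1 - m) 0 * max (p.2 - m) 0 - s)) := by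
  have : Continuous fun η : ℝ =>
      max (p.1 - (m + η)) 0 * max (p.2 - (m + η)) 0 - (s + η) := by fun_prop
  simpa using (this.tendsto 0).mono_left nhdsWithin_le_nhds

/-- As `μ` and `σ²` are upper semicontinuous, the Hamiltonian is its own lower envelope, so the
subsolution inequality holds pointwise. -/
theorem Admissible.hamiltonian_le_zero {μ σ u : ℝ × ℝ → ℝ} (h : Admissible μ σ)
    (hu : IsViscositySubsolution (hamiltonian μ σ) openQuadrant u) {x p : ℝ × ℝ}
    (hx : x ∈ openQuadrant) (hp : p ∈ superdifferential openQuadrant u x) :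
    hamiltonian μ σ x p ≤ 0 := by
  by_contra! hpos
  have h1 := ((tendsto_posPart_mul p (μ x) (σ x ^ 2)).eventually
    (lt_mem_nhds (half_lt_self hpos : hamiltonian μ σ x p / 2 < hamiltonian μ σ x p))).and
      self_mem_nhdsWithin
  obtain ⟨η, hη1, hη⟩ := h1.exists
  have hq := openQuadrant_subset_quadrant hx
  have e1 := (h.usc.1 x hq (μ x + η) (by simpa using hη)).filter_mono
    (nhdsWithin_mono x openQuadrant_subset_quadrant)
  have e2 := (h.usc.2 x hq (σ x ^ 2 + η) (by simpa using hη)).filter_mono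
    (nhdsWithin_mono x openQuadrant_subset_quadrant)
  have : (𝓝[openQuadrant] x).NeBot := mem_closure_iff_nhdsWithin_neBot.1 (subset_closure hx)
  have hcob : IsCoboundedUnder (fun a b => a ≥ b) (𝓝[openQuadrant] x)
      (fun y => hamiltonian μ σ y p) := by
    refine IsBoundedUnder.isCoboundedUnder_ge ?_
    refine isBoundedUnder_of_eventually_le (a := max p.1 0 * max p.2 0) ?_
    filter_upwards [self_mem_nhdsWithin] with y hy
    have := hamiltonian_le_mul (p := p) (h.nonneg y (openQuadrant_subset_quadrant hy)).1
      (sq_nonneg (σ y))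
    simpa using this
  have h3 : hamiltonian μ σ x p / 2 ≤ liminf (fun y => hamiltonian μ σ y p) (𝓝[openQuadrant] x) := by
    refine le_liminf_of_le hcob ?_
    filter_upwards [e1, e2] with y h4 h5
    exact hη1.le.trans (mul_le_hamiltonian h4.le h5.le)
  have := hu.2 x hx p hp
  linarith

/-- The upper envelope of the Hamiltonian is attained only along sequences, so the supersolution
inequality yields nearby points at which the Hamiltonian is almost nonnegative. -/
theorem Admissible.frequently_hamiltonian {μ σ v : ℝ × ℝ → ℝ} (h : Admissible μ σ)
    (hv : IsViscositySupersolution (hamiltonian μ σ) openQuadrant v) {x p : ℝ × ℝ}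
    (hx : x ∈ openQuadrant) (hp : p ∈ subdifferential openQuadrant v x) {κ : ℝ} (hκ : 0 < κ) :
    ∃ᶠ y in 𝓝[openQuadrant] x, -κ < hamiltonian μ σ y p := by
  obtain ⟨M, hM⟩ := h.exists_sq_bound
  have : (𝓝[openQuadrant] x).NeBot := mem_closure_iff_nhdsWithin_neBot.1 (subset_closure hx)
  refine frequently_lt_of_lt_limsup (IsBoundedUnder.isCoboundedUnder_le ?_)
    (lt_of_lt_of_le (neg_lt_zero.2 hκ) (hv.2 x hx p hp))
  refine isBoundedUnder_of_eventually_ge (a := -M) ?_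
  filter_upwards [self_mem_nhdsWithin] with y hy
  exact neg_le_hamiltonian hM (openQuadrant_subset_quadrant hy) p

/-- If `μ ≥ m` and `σ² ≥ s` near `x`, then the supersolution inequality holds with `m` and `s`. -/
theorem Admissible.le_mul_of_supersolution {μ σ v : ℝ × ℝ → ℝ} (h : Admissible μ σ)
    (hv : IsViscositySupersolution (hamiltonian μ σ) openQuadrant v) {x p : ℝ × ℝ}
    (hx : x ∈ openQuadrant) (hp : p ∈ subdifferential openQuadrant v x) {m s : ℝ}
    (hm : ∀ᶠ y in 𝓝[openQuadrant] x, m ≤ μ y) (hs : ∀ᶠ y in 𝓝[openQuadrant] x, s ≤ σ y ^ 2) :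
    s ≤ max (p.1 - m) 0 * max (p.2 - m) 0 := by
  refine le_of_forall_pos_lt_add fun κ hκ => ?_
  obtain ⟨y, hy, h1, h2⟩ := ((h.frequently_hamiltonian hv hx hp hκ).and_eventually
    (hm.and hs)).exists
  have := hamiltonian_le_mul (p := p) h1 h2
  linarith

/-! ### Supersolutions grow at least like `μ` -/

theorem fst_nonneg_of_monotone {v : ℝ × ℝ → ℝ} (hv : MonotoneOn v quadrant) {x p : ℝ × ℝ}
    (hx : x ∈ openQuadrant) (hp : p ∈ subdifferential openQuadrant v x) : 0 ≤ p.1 := by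
  refine le_of_forall_pos_le_add fun ε hε => ?_
  have h1 := hp ε hε
  have ht : Tendsto (fun s : ℝ => (x.1 - s, x.2)) (𝓝[>] 0) (𝓝[openQuadrant] x) := by
    have hc : Continuous fun s : ℝ => (x.1 - s, x.2) := by fun_prop
    have h2 : Tendsto (fun s : ℝ => (x.1 - s, x.2)) (𝓝[>] 0) (𝓝 x) := by
      simpa using (hc.tendsto 0).mono_left nhdsWithin_le_nhds
    exact tendsto_nhdsWithin_iff.2 ⟨h2, h2.eventually (isOpen_openQuadrant.mem_nhds hx)⟩
  obtain ⟨s, ⟨h3, h4⟩, hs⟩ := (((ht.eventually h1).and (ht.eventually self_mem_nhdsWithin)).and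
    self_mem_nhdsWithin).exists
  have hs : 0 < s := hs
  have h5 : v (x.1 - s, x.2) ≤ v x := hv (openQuadrant_subset_quadrant h4)
    (openQuadrant_subset_quadrant hx) ⟨by simpa using hs.le, le_rfl⟩
  have h6 : ‖((x.1 - s, x.2) : ℝ × ℝ) - x‖ = s := by
    simp [Prod.norm_def, abs_of_pos hs, hs.le]
  rw [h6] at h3
  simp only [sub_sub_cancel_left, sub_self, mul_zero, add_zero] at h3
  by_contra! hlt
  nlinarith

/-- If `p₁ ≥ m` for all subgradients of `v` near a horizontal segment, then `v` grows along the
segment at least at the rate `m`. -/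
theorem mul_le_sub_of_subdifferential {v : ℝ × ℝ → ℝ} {O : Set (ℝ × ℝ)} (hO : IsOpen O)
    (hv : ContinuousOn v O) {m a b c : ℝ} (hab : a ≤ b) (hseg : ∀ t ∈ Icc a b, (t, c) ∈ O)
    (hsub : ∀ z ∈ O, ∀ p ∈ subdifferential openQuadrant v z, m ≤ p.1) :
    m * (b - a) ≤ v (b, c) - v (a, c) := by
  rcases hab.eq_or_lt with rfl | hab
  · simp
  by_contra! hlt
  obtain ⟨m', hm', hlt'⟩ : ∃ m' < m, v (b, c) - v (a, c) < m' * (b - a) := by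
    refine ⟨(m + (v (b, c) - v (a, c)) / (b - a)) / 2, ?_, ?_⟩
    · have := (div_lt_iff₀ (sub_pos.2 hab)).2 hlt
      linarith
    · have h1 := (div_lt_iff₀ (sub_pos.2 hab)).2 hlt
      have h2 : (v (b, c) - v (a, c)) / (b - a) * (b - a) = v (b, c) - v (a, c) :=
        div_mul_cancel₀ _ (sub_pos.2 hab).ne'
      nlinarith [sub_pos.2 hab]
  -- a rectangle around the segment, slightly longer to the right, such that `v - m' x₁` is larger
  -- on its left side than at `(b, c)`
  have hK : IsCompact ((fun t : ℝ => (t, c)) '' Icc a b) :=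
    isCompact_Icc.image (by fun_prop)
  obtain ⟨ρ₁, hρ₁, hthick⟩ := hK.exists_cthickening_subset_open hO (by
    rintro _ ⟨t, ht, rfl⟩; exact hseg t ht)
  have hva : ∀ᶠ t in 𝓝 c, v (b, c) - m' * b < v (a, t) - m' * a := by
    have h1 : ContinuousAt (fun t => v (a, t) - m' * a) c := by
      have h2 : ContinuousAt v (a, c) := hv.continuousAt (hO.mem_nhds (hseg a ⟨le_rfl, hab.le⟩))
      have h3 : ContinuousAt (fun t : ℝ => (a, t)) c := by fun_prop
      exact (ContinuousAt.comp (g := v) h2 h3).sub continuousAt_const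
    exact h1.eventually (lt_mem_nhds (by linarith))
  obtain ⟨ρ₂, hρ₂, hva⟩ := Metric.eventually_nhds_iff.1 hva
  set ρ := min ρ₁ (ρ₂ / 2) with hρ
  have hρ0 : 0 < ρ := lt_min hρ₁ (by positivity)
  set Q : Set (ℝ × ℝ) := Icc a (b + ρ) ×ˢ Icc (c - ρ) (c + ρ) with hQ
  have hQO : Q ⊆ O := by
    rintro ⟨s, t⟩ ⟨hs, ht⟩
    refine hthick (Metric.mem_cthickening_of_dist_le _ (min s b, c) _ _
      ⟨min s b, ⟨le_min hs.1 hab.le, min_le_right _ _⟩, rfl⟩ ?_)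
    refine le_trans ?_ (min_le_left ρ₁ (ρ₂ / 2))
    rw [Prod.dist_eq, Real.dist_eq, Real.dist_eq, max_le_iff, abs_le, abs_le]
    simp only at hs ht ⊢
    rcases min_cases s b with ⟨h, _⟩ | ⟨h, _⟩ <;> rw [h] <;>
      exact ⟨⟨by linarith [hs.1, hs.2, ht.1, ht.2], by linarith [hs.1, hs.2, ht.1, ht.2]⟩,
        by linarith [ht.1], by linarith [ht.2]⟩
  have hQc : IsCompact Q := isCompact_Icc.prod isCompact_Icc
  have hbQ : (b, c) ∈ Q := ⟨⟨hab.le, by simp; linarith⟩, by simp; linarith, by simp; linarith⟩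
  obtain ⟨N, hN⟩ := hQc.exists_bound_of_continuousOn
    (f := fun x => v x - m' * x.1) ((hv.mono hQO).sub (by fun_prop))
  set K := (2 * N + 1) / ρ ^ 2 with hKdef
  have hNnn : 0 ≤ N := (norm_nonneg _).trans (hN _ hbQ)
  have hK0 : 0 < K := by positivity
  have hKρ : K * ρ ^ 2 = 2 * N + 1 := div_mul_cancel₀ _ (by positivity)
  obtain ⟨z, hzQ, hz⟩ := hQc.exists_isMinOn ⟨_, hbQ⟩
    (f := fun x => v x - ((m' * x.1 - K * (max (x.1 - b) 0) ^ 2) + -(K * (x.2 - c) ^ 2)))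
    ((hv.mono hQO).sub (by fun_prop))
  have hzb := hz hbQ
  simp only [mem_ofPred_eq, sub_self, max_self] at hzb
  have hNz := abs_le.1 (hN z hzQ)
  have hNb := abs_le.1 (hN _ hbQ)
  simp only at hNb
  have hmx : 0 ≤ max (z.1 - b) 0 := le_max_right _ _
  have hz1 : a < z.1 := by
    refine lt_of_le_of_ne hzQ.1.1 fun heq => ?_
    have h1 := hva (y := z.2) (by
      rw [Real.dist_eq]
      have : |z.2 - c| ≤ ρ := abs_le.2 ⟨by linarith [hzQ.2.1], by linarith [hzQ.2.2]⟩
      linarith [min_le_right ρ₁ (ρ₂ / 2)])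
    have h2 : v z = v (a, z.2) := congrArg v (Prod.ext heq.symm rfl)
    rw [h2, ← heq] at hzb
    nlinarith [mul_nonneg hK0.le (sq_nonneg (z.2 - c)),
      mul_nonneg hK0.le (sq_nonneg (max (a - b) 0))]
  have hz2 : z.1 < b + ρ := by
    refine lt_of_le_of_ne hzQ.1.2 fun heq => ?_
    have h1 : max (z.1 - b) 0 = ρ := by rw [heq, add_sub_cancel_left, max_eq_left hρ0.le]
    rw [h1] at hzb
    nlinarith [mul_nonneg hK0.le (sq_nonneg (z.2 - c))]
  have hz3 : |z.2 - c| < ρ := by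
    refine lt_of_le_of_ne (abs_le.2 ⟨by linarith [hzQ.2.1], by linarith [hzQ.2.2]⟩) fun heq => ?_
    have h1 : (z.2 - c) ^ 2 = ρ ^ 2 := by rw [← heq, sq_abs]
    rw [h1] at hzb
    nlinarith [mul_nonneg hK0.le (sq_nonneg (max (z.1 - b) 0))]
  have hz3 := abs_lt.1 hz3
  have hQz : Q ∈ 𝓝 z := prod_mem_nhds (Icc_mem_nhds hz1 hz2)
    (Icc_mem_nhds (by linarith) (by linarith))
  have hp : ((m' - K * (2 * max (z.1 - b) 0), -(K * (2 * (z.2 - c)))) : ℝ × ℝ) ∈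
      subdifferential openQuadrant v z := by
    refine mem_subdifferential_of_separable (A := fun s => m' * s - K * (max (s - b) 0) ^ 2)
      (B := fun s => -(K * (s - c) ^ 2)) ?_ ?_ ?_
    · exact (((hasDerivAt_id z.1).const_mul m').sub
        ((hasDerivAt_sq_posPart b z.1).const_mul K)).congr_deriv (by simp)
    · exact ((((hasDerivAt_id z.2).sub_const c).pow 2).const_mul K).neg.congr_deriv (by simp)
    · filter_upwards [mem_nhdsWithin_of_mem_nhds hQz] with y hy
      exact hz hy
  have := hsub z (hQO hzQ) _ hp
  simp only at this
  nlinarith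

/-- Near a point of continuity the supersolution inequality and the hypothesis on the zero set of
`σ` bound the subgradients from below by `μ`. -/
theorem Admissible.mu_le_fst_of_continuousWithinAt {μ σ v : ℝ × ℝ → ℝ} (h : Admissible μ σ)
    (hmono : MonotoneOn v quadrant)
    (hv : IsViscositySupersolution (hamiltonian μ σ) openQuadrant v) {z p : ℝ × ℝ}
    (hz : z ∈ openQuadrant) (hp : p ∈ subdifferential openQuadrant v z)
    (hcμ : ContinuousWithinAt μ quadrant z)
    (hcσ : ContinuousWithinAt (fun x => σ x ^ 2) quadrant z) : μ z ≤ p.1 := by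
  rcases eq_or_ne (σ z) 0 with h0 | h0
  · rw [h.zero z hz h0]
    exact fst_nonneg_of_monotone hmono hz hp
  have hpos : 0 < σ z ^ 2 := by positivity
  refine le_of_forall_pos_le_add fun ε hε => ?_
  have hle := nhdsWithin_mono z openQuadrant_subset_quadrant
  have h1 := h.le_mul_of_supersolution hv hz hp (m := μ z - ε) (s := σ z ^ 2 / 2)
    ((hcμ.eventually (lt_mem_nhds (sub_lt_self _ hε))).filter_mono hle |>.mono fun _ h => h.le)
    ((hcσ.eventually (lt_mem_nhds (half_lt_self hpos))).filter_mono hle |>.mono fun _ h => h.le)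
  by_contra! hlt
  rw [max_eq_right (by linarith : p.1 - (μ z - ε) ≤ 0), zero_mul] at h1
  linarith

/-- Even where `μ` jumps and the supersolution inequality is void (because the lower envelope of
`σ` vanishes), subgradients are bounded from below by the lower envelope of `μ`: a short horizontal
segment to the left of `y` avoids the discontinuities. -/
theorem Admissible.le_fst_of_supersolution {μ σ v : ℝ × ℝ → ℝ} (h : Admissible μ σ)
    (hc : ContinuousOn v quadrant) (hmono : MonotoneOn v quadrant)
    (hv : IsViscositySupersolution (hamiltonian μ σ) openQuadrant v) {y p : ℝ × ℝ}
    (hy : y ∈ openQuadrant) (hp : p ∈ subdifferential openQuadrant v y) {m : ℝ}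
    (hm : ∀ᶠ z in 𝓝 y, m ≤ μ z) : m ≤ p.1 := by
  obtain ⟨E, hEc, hE, -, hEfin⟩ := h.exists_discontinuities
  obtain ⟨r, hr, hball⟩ := Metric.eventually_nhds_iff_ball.1
    (hm.and (isOpen_openQuadrant.mem_nhds hy))
  have hT := ((hEfin y.2 y.1).subset (sdiff_subset (t := {y.1}))).isClosed
  obtain ⟨ρ', hρ', hfree⟩ := Metric.mem_nhds_iff.1 (hT.isOpen_compl.mem_nhds
    (x := y.1) (by simp))
  set ρ := min r ρ' with hρ
  have hρ0 : 0 < ρ := lt_min hr hρ'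
  have hdist : ∀ t, y.1 - ρ < t → t < y.1 → dist ((t, y.2) : ℝ × ℝ) y < ρ := by
    intro t h1 h2
    rw [Prod.dist_eq, Real.dist_eq, dist_self, max_lt_iff, abs_lt]
    exact ⟨⟨by simp only; linarith, by simp only; linarith⟩, hρ0⟩
  have hnotE : ∀ t, y.1 - ρ < t → t < y.1 → (t, y.2) ∉ E := by
    intro t h1 h2 hmem
    have h3 : (t, y.2) ∈ openQuadrant :=
      (hball _ ((hdist t h1 h2).trans_le (min_le_left _ _))).2
    have h4 : t ∈ Metric.ball y.1 ρ' := by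
      rw [Metric.mem_ball, Real.dist_eq, abs_lt]
      have := min_le_right r ρ'
      constructor <;> linarith
    exact hfree h4 ⟨⟨⟨h3.1.le, h2.le⟩, hmem, hy.2.le⟩, h2.ne⟩
  have hOopen : IsOpen (Metric.ball y ρ ∩ Eᶜ) := Metric.isOpen_ball.inter hEc.isOpen_compl
  have hOq : Metric.ball y ρ ∩ Eᶜ ⊆ openQuadrant := fun z hz =>
    (hball z (Metric.ball_subset_ball (min_le_left _ _) hz.1)).2
  have hgrow : ∀ a b, y.1 - ρ < a → a ≤ b → b < y.1 →
      m * (b - a) ≤ v (b, y.2) - v (a, y.2) := by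
    intro a b ha hab hb
    refine mul_le_sub_of_subdifferential hOopen
      (hc.mono (hOq.trans openQuadrant_subset_quadrant)) hab ?_ ?_
    · exact fun t ht => ⟨hdist t (by linarith [ht.1]) (by linarith [ht.2]),
        hnotE t (by linarith [ht.1]) (by linarith [ht.2])⟩
    · intro z hz q hq
      have hzE := hE z (openQuadrant_subset_quadrant (hOq hz)) hz.2
      exact (hball z (Metric.ball_subset_ball (min_le_left _ _) hz.1)).1.trans
        (h.mu_le_fst_of_continuousWithinAt hmono hv (hOq hz) hq hzE.1 hzE.2)
  have hgrow' : ∀ a, y.1 - ρ < a → a < y.1 → m * (y.1 - a) ≤ v y - v (a, y.2) := by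
    intro a ha hay
    have h1 : Tendsto (fun b : ℝ => v (b, y.2) - v (a, y.2)) (𝓝[<] y.1) (𝓝 (v y - v (a, y.2))) := by
      have h2 : ContinuousAt v (y.1, y.2) := hc.continuousAt (quadrant_mem_nhds hy)
      have h3 : ContinuousAt (fun t : ℝ => (t, y.2)) y.1 := by fun_prop
      exact ((ContinuousAt.comp (f := fun t : ℝ => (t, y.2)) h2 h3).sub
        continuousAt_const).tendsto.mono_left
        nhdsWithin_le_nhds
    have h4 : Tendsto (fun b : ℝ => m * (b - a)) (𝓝[<] y.1) (𝓝 (m * (y.1 - a))) :=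
      ((by fun_prop : Continuous fun b : ℝ => m * (b - a)).tendsto y.1).mono_left nhdsWithin_le_nhds
    refine le_of_tendsto_of_tendsto h4 h1 ?_
    filter_upwards [Ioo_mem_nhdsLT hay] with b hb
    exact hgrow a b ha hb.1.le hb.2
  refine le_of_forall_pos_le_add fun ε hε => ?_
  have ht : Tendsto (fun t : ℝ => (t, y.2)) (𝓝[<] y.1) (𝓝[openQuadrant] y) := by
    have hcont : Continuous fun t : ℝ => (t, y.2) := by fun_prop
    have h2 : Tendsto (fun t : ℝ => (t, y.2)) (𝓝[<] y.1) (𝓝 y) :=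
      (hcont.tendsto y.1).mono_left nhdsWithin_le_nhds
    exact tendsto_nhdsWithin_iff.2 ⟨h2, h2.eventually (isOpen_openQuadrant.mem_nhds hy)⟩
  obtain ⟨t, h1, h2⟩ := ((ht.eventually (hp ε hε)).and
    (Ioo_mem_nhdsLT (sub_lt_self y.1 hρ0))).exists
  have h3 := hgrow' t h2.1 h2.2
  have h6 : ‖((t, y.2) : ℝ × ℝ) - y‖ = y.1 - t := by
    simp [Prod.norm_def, abs_of_neg (sub_neg.2 h2.2), h2.2.le]
  rw [h6] at h1
  simp only [sub_self, mul_zero, add_zero] at h1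
  by_contra! hlt
  nlinarith [h2.2]

/-! ### Exchanging the coordinates -/

theorem swap_mem_quadrant {x : ℝ × ℝ} : x.swap ∈ quadrant ↔ x ∈ quadrant := and_comm

theorem swap_mem_openQuadrant {x : ℝ × ℝ} : x.swap ∈ openQuadrant ↔ x ∈ openQuadrant := and_comm

theorem norm_swap (x : ℝ × ℝ) : ‖x.swap‖ = ‖x‖ := by
  rw [Prod.norm_def, Prod.norm_def, Prod.fst_swap, Prod.snd_swap, max_comm]

theorem tendsto_swap_quadrant (x : ℝ × ℝ) :
    Tendsto Prod.swap (𝓝[quadrant] x) (𝓝[quadrant] x.swap) :=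
  (continuous_swap.continuousWithinAt).tendsto_nhdsWithin fun _ h => swap_mem_quadrant.2 h

theorem tendsto_swap_openQuadrant (x : ℝ × ℝ) :
    Tendsto Prod.swap (𝓝[openQuadrant] x) (𝓝[openQuadrant] x.swap) :=
  (continuous_swap.continuousWithinAt).tendsto_nhdsWithin fun _ h => swap_mem_openQuadrant.2 h

theorem swap_mem_subdifferential {v : ℝ × ℝ → ℝ} {x p : ℝ × ℝ}
    (hp : p ∈ subdifferential openQuadrant v x) :
    p.swap ∈ subdifferential openQuadrant (fun y => v y.swap) x.swap := by
  intro ε hε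
  have := (tendsto_swap_openQuadrant x.swap).eventually (by simpa using hp ε hε)
  filter_upwards [this] with y hy
  have e : ‖y.swap - x‖ = ‖y - x.swap‖ := by rw [← norm_swap]; simp
  rw [e] at hy
  simp only [Prod.swap_swap, Prod.fst_swap, Prod.snd_swap] at hy ⊢
  linarith

theorem hamiltonian_swap (μ σ : ℝ × ℝ → ℝ) (x p : ℝ × ℝ) :
    hamiltonian (fun y => μ y.swap) (fun y => σ y.swap) x p = hamiltonian μ σ x.swap p.swap := by
  simp [hamiltonian, mul_comm]

theorem HasFavorableDirection.swap {μ σ : ℝ × ℝ → ℝ} {x : ℝ × ℝ}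
    (h : HasFavorableDirection μ σ x.swap) :
    HasFavorableDirection (fun y => μ y.swap) (fun y => σ y.swap) x := by
  obtain ⟨e, c, hc, h⟩ := h
  refine ⟨e.swap, c, hc, fun η hη => ?_⟩
  obtain ⟨r, hr, h⟩ := h η hη
  refine ⟨r, hr, fun z hz δ hδ hδr y hy => h z.swap ?_ δ hδ hδr y.swap ?_⟩
  · rw [mem_ball_iff_norm] at hz ⊢
    rwa [← norm_swap] at hz
  · rwa [← norm_swap] at hy

theorem Admissible.swap {μ σ : ℝ × ℝ → ℝ} (h : Admissible μ σ) :
    Admissible (fun y => μ y.swap) (fun y => σ y.swap) where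
  nonneg x hx := h.nonneg _ (swap_mem_quadrant.2 hx)
  bounded := by
    obtain ⟨M, hM⟩ := h.bounded
    exact ⟨M, fun x hx => hM _ (swap_mem_quadrant.2 hx)⟩
  usc := by
    constructor
    · intro x hx a ha
      exact (tendsto_swap_quadrant x).eventually (h.usc.1 _ (swap_mem_quadrant.2 hx) a ha)
    · intro x hx a ha
      exact (tendsto_swap_quadrant x).eventually (h.usc.2 _ (swap_mem_quadrant.2 hx) a ha)
  zero x hx := h.zero _ (swap_mem_openQuadrant.2 hx)
  exists_discontinuities := by
    obtain ⟨E, hE, h1, h2, h3⟩ := h.exists_discontinuities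
    refine ⟨Prod.swap ⁻¹' E, hE.preimage continuous_swap, fun x hx hxE => ?_, h3, h2⟩
    obtain ⟨h4, h5⟩ := h1 _ (swap_mem_quadrant.2 hx) hxE
    exact ⟨Tendsto.comp h4 (tendsto_swap_quadrant x), Tendsto.comp h5 (tendsto_swap_quadrant x)⟩
  exists_favorable := by
    obtain ⟨S, h1, h2⟩ := h.exists_favorable
    refine ⟨Prod.swap ⁻¹' S, fun z => ?_, fun x hx hxS =>
      (h2 _ (swap_mem_openQuadrant.2 hx) hxS).swap⟩
    refine ((h1 z.swap).preimage Prod.swap_injective.injOn).subset ?_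
    rintro x ⟨hx, h3, h4⟩
    exact ⟨hx, ⟨h3.2, h3.1⟩, ⟨h4.2, h4.1⟩⟩

theorem IsViscositySupersolution.swap {μ σ v : ℝ × ℝ → ℝ} (hc : ContinuousOn v quadrant)
    (hv : IsViscositySupersolution (hamiltonian μ σ) openQuadrant v) :
    IsViscositySupersolution (hamiltonian (fun y => μ y.swap) (fun y => σ y.swap)) openQuadrant
      (fun y => v y.swap) := by
  have hcont : ContinuousOn (fun y : ℝ × ℝ => v y.swap) openQuadrant :=
    (hc.mono openQuadrant_subset_quadrant).comp continuous_swap.continuousOn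
      fun _ h => swap_mem_openQuadrant.2 h
  refine ⟨hcont.lowerSemicontinuousOn, fun x hx p hp => ?_⟩
  have h1 := swap_mem_subdifferential hp
  have h2 := hv.2 _ (swap_mem_openQuadrant.2 hx) p.swap (by simpa using h1)
  have h3 : map Prod.swap (𝓝[openQuadrant] x) = 𝓝[openQuadrant] x.swap := by
    refine le_antisymm (tendsto_swap_openQuadrant x) ?_
    have := Filter.map_mono (m := Prod.swap) (tendsto_swap_openQuadrant x.swap)
    simpa [Filter.map_map] using this
  rw [← h3, limsup, map_map] at h2
  simp only [hamiltonian_swap]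
  exact h2

theorem monotoneOn_swap {v : ℝ × ℝ → ℝ} (hv : MonotoneOn v quadrant) :
    MonotoneOn (fun y => v y.swap) quadrant := fun _ hx _ hy hxy =>
  hv (swap_mem_quadrant.2 hx) (swap_mem_quadrant.2 hy) ⟨hxy.2, hxy.1⟩

theorem Admissible.le_snd_of_supersolution {μ σ v : ℝ × ℝ → ℝ} (h : Admissible μ σ)
    (hc : ContinuousOn v quadrant) (hmono : MonotoneOn v quadrant)
    (hv : IsViscositySupersolution (hamiltonian μ σ) openQuadrant v) {y p : ℝ × ℝ}
    (hy : y ∈ openQuadrant) (hp : p ∈ subdifferential openQuadrant v y) {m : ℝ}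
    (hm : ∀ᶠ z in 𝓝 y, m ≤ μ z) : m ≤ p.2 := by
  refine h.swap.le_fst_of_supersolution (y := y.swap) (p := p.swap)
    (hc.comp continuous_swap.continuousOn fun _ h => swap_mem_quadrant.2 h) (monotoneOn_swap hmono)
    (hv.swap hc) (swap_mem_openQuadrant.2 hy) (swap_mem_subdifferential hp) ?_
  exact (continuous_swap.tendsto y.swap).eventually (by simpa using hm)

/-! ### Comparison principle -/

theorem norm_lt_iff_fst_snd {x : ℝ × ℝ} {r : ℝ} : ‖x‖ < r ↔ |x.1| < r ∧ |x.2| < r := by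
  rw [Prod.norm_def, max_lt_iff, Real.norm_eq_abs, Real.norm_eq_abs]

theorem abs_le_add_one_of_sq_le {t N : ℝ} (h : t ^ 2 ≤ N) : |t| ≤ N + 1 := by
  rw [← sq_abs] at h
  nlinarith [sq_nonneg (|t| - 1)]

theorem mul_add_sq_le_mul_add {a b k : ℝ} (ha : 0 ≤ a) (hb : 0 ≤ b) (hk : 0 ≤ k) :
    a * b + k ^ 2 ≤ (a + k) * (b + k) := by
  nlinarith [mul_nonneg ha hk, mul_nonneg hb hk]

set_option maxHeartbeats 400000 in
/-- A subsolution `u` cannot touch `v + ψ` from above, for `v` a supersolution and `ψ` separable with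
slopes at least `l > 0`, at a point with a favorable direction. The proof doubles the variables with
the penalization `|(y - x) / δ - e|²`, which forces `y - x ≈ δ e`, so that `μ(x) ≲ μ(y)` and
`σ(x)² ≲ σ(y)²`. -/
theorem Admissible.not_isLocalMax {μ σ u v : ℝ × ℝ → ℝ} (h : Admissible μ σ)
    (hu : ContinuousOn u quadrant) (hv : ContinuousOn v quadrant) (hmono : MonotoneOn v quadrant)
    (hsub : IsViscositySubsolution (hamiltonian μ σ) openQuadrant u)
    (hsup : IsViscositySupersolution (hamiltonian μ σ) openQuadrant v)
    {A B A' B' : ℝ → ℝ} {l : ℝ} (hl : 0 < l) (hA : ∀ t, HasDerivAt A (A' t) t)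
    (hB : ∀ t, HasDerivAt B (B' t) t) (hA' : ∀ t, l ≤ A' t) (hB' : ∀ t, l ≤ B' t)
    {z : ℝ × ℝ} (hz : z ∈ openQuadrant) (hfav : HasFavorableDirection μ σ z) :
    ¬ IsLocalMax (fun x => u x - v x - (A x.1 + B x.2)) z := by
  intro hmax
  obtain ⟨e, c, hc, hfav⟩ := hfav
  obtain ⟨η, hη0, hη1, hη2⟩ : ∃ η > 0, η ≤ l / 4 ∧ η < l ^ 2 / 16 :=
    ⟨min (l / 4) (l ^ 2 / 32), by positivity, min_le_left _ _,
      (min_le_right _ _).trans_lt (by nlinarith [sq_pos_of_pos hl])⟩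
  obtain ⟨r₁, hr₁, hfav⟩ := hfav η hη0
  obtain ⟨r₂, hr₂, hball⟩ := Metric.nhds_basis_closedBall.eventually_iff.1
    (hmax.and (isOpen_openQuadrant.mem_nhds hz))
  set r := min (min r₁ r₂) 1 with hr
  have hr0 : 0 < r := by positivity
  have hrr₁ : r ≤ r₁ := (min_le_left _ _).trans (min_le_left _ _)
  have hrr₂ : r ≤ r₂ := (min_le_left _ _).trans (min_le_right _ _)
  have hr1 : r ≤ 1 := min_le_right _ _
  set K := Metric.closedBall z r with hK
  have hKc : IsCompact K := isCompact_closedBall z r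
  have hKball : ∀ x ∈ K, u x - v x - (A x.1 + B x.2) ≤ u z - v z - (A z.1 + B z.2) ∧
      x ∈ openQuadrant := fun x hx => hball (Metric.closedBall_subset_closedBall hrr₂ hx)
  have hKq : K ⊆ quadrant := fun x hx => openQuadrant_subset_quadrant (hKball x hx).2
  have hzK : z ∈ K := Metric.mem_closedBall_self hr0.le
  have hAc : Continuous A := continuous_iff_continuousAt.2 fun t => (hA t).continuousAt
  have hBc : Continuous B := continuous_iff_continuousAt.2 fun t => (hB t).continuousAt
  set w : ℝ × ℝ → ℝ := fun x => u x - (A x.1 + B x.2) with hw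
  have hwc : ContinuousOn w K := (hu.mono hKq).sub (by fun_prop)
  have hvc : ContinuousOn v K := hv.mono hKq
  obtain ⟨N₁, hN₁⟩ := hKc.exists_bound_of_continuousOn hwc
  obtain ⟨N₂, hN₂⟩ := hKc.exists_bound_of_continuousOn hvc
  have hN₁0 : 0 ≤ N₁ := (norm_nonneg _).trans (hN₁ z hzK)
  have hN₂0 : 0 ≤ N₂ := (norm_nonneg _).trans (hN₂ z hzK)
  -- `‖y - x‖ ≤ δ * L` at the maximum point of the doubled function
  set L := 2 * N₁ + 2 * N₂ + 1 + ‖e‖ with hL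
  have hL0 : 0 < L := by positivity
  obtain ⟨τ, hτ0, hτ1, hτ2⟩ : ∃ τ > 0, 2 * τ < l / 4 * (r / 2) ^ 2 ∧ 2 * τ < c ^ 2 := by
    have h1 : 0 < l / 4 * (r / 2) ^ 2 := by positivity
    have h2 : 0 < c ^ 2 := by positivity
    refine ⟨min (l / 4 * (r / 2) ^ 2) (c ^ 2) / 4, by positivity, ?_, ?_⟩
    · linarith [min_le_left (l / 4 * (r / 2) ^ 2) (c ^ 2)]
    · linarith [min_le_right (l / 4 * (r / 2) ^ 2) (c ^ 2)]
  obtain ⟨ρ, hρ0, hρ⟩ := Metric.uniformContinuousOn_iff.1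
    (hKc.uniformContinuousOn_of_continuous hvc) τ hτ0
  obtain ⟨δ, hδ0, hδr, hδL⟩ : ∃ δ > 0, δ < r ∧ δ * L < min ρ (r / 2) := by
    refine ⟨min (r / 2) (min ρ (r / 2) / (2 * L)), by positivity, ?_, ?_⟩
    · linarith [min_le_left (r / 2) (min ρ (r / 2) / (2 * L))]
    · have h1 : 0 < min ρ (r / 2) := by positivity
      calc min (r / 2) (min ρ (r / 2) / (2 * L)) * L ≤ min ρ (r / 2) / (2 * L) * L := by
            gcongr; exact min_le_right _ _
        _ = min ρ (r / 2) / 2 := by field_simp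
        _ < min ρ (r / 2) := half_lt_self h1
  have hδρ : δ * L < ρ := hδL.trans_le (min_le_left _ _)
  have hδr2 : δ * L < r / 2 := hδL.trans_le (min_le_right _ _)
  -- the doubled function and its maximum point
  set q : ℝ × ℝ → ℝ × ℝ → ℝ × ℝ := fun x y => ((y.1 - x.1) / δ - e.1, (y.2 - x.2) / δ - e.2) with hq
  obtain ⟨⟨x, y⟩, hxyK, hxy⟩ := (hKc.prod hKc).exists_isMaxOn ⟨(z, z), hzK, hzK⟩
    (f := fun a : (ℝ × ℝ) × (ℝ × ℝ) => w a.1 - v a.2 -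
      (l / 4 * ((a.1.1 - z.1) ^ 2 + (a.1.2 - z.2) ^ 2) +
        ((q a.1 a.2).1 ^ 2 + (q a.1 a.2).2 ^ 2)))
    (((hwc.comp continuousOn_fst fun a ha => ha.1).sub
      (hvc.comp continuousOn_snd fun a ha => ha.2)).sub
        (by simp only [hq]; fun_prop))
  obtain ⟨hxK, hyK⟩ : x ∈ K ∧ y ∈ K := hxyK
  set z' := z + δ • e with hz'
  have hδe : ‖δ • e‖ ≤ δ * L := by
    rw [norm_smul, Real.norm_eq_abs, abs_of_pos hδ0]
    gcongr
    rw [hL]; linarith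
  have hdz' : dist z z' ≤ δ * L := by rw [hz', dist_self_add_right]; exact hδe
  have hz'K : z' ∈ K := by rw [hK, Metric.mem_closedBall, dist_comm]; linarith
  have hqz : q z z' = 0 := by
    simp only [hq, hz', Prod.fst_add, Prod.snd_add, Prod.smul_fst, Prod.smul_snd, smul_eq_mul,
      add_sub_cancel_left, mul_div_cancel_left₀ _ hδ0.ne', sub_self]
    rfl
  have hvz : |v z - v z'| < τ := hρ z hzK z' hz'K (hdz'.trans_lt hδρ)
  have hkey : l / 4 * ((x.1 - z.1) ^ 2 + (x.2 - z.2) ^ 2) + ((q x y).1 ^ 2 + (q x y).2 ^ 2) ≤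
      w x - v y - (w z - v z') := by
    have := hxy (show (z, z') ∈ K ×ˢ K from ⟨hzK, hz'K⟩)
    simp only [mem_ofPred_eq, hqz, sub_self, Prod.fst_zero, Prod.snd_zero] at this
    linarith
  have hl4 : 0 ≤ l / 4 * ((x.1 - z.1) ^ 2 + (x.2 - z.2) ^ 2) := by positivity
  have hcrude : (q x y).1 ^ 2 + (q x y).2 ^ 2 ≤ 2 * N₁ + 2 * N₂ := by
    have h1 := abs_le.1 (hN₁ x hxK)
    have h2 := abs_le.1 (hN₁ z hzK)
    have h3 := abs_le.1 (hN₂ y hyK)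
    have h4 := abs_le.1 (hN₂ z' hz'K)
    linarith [h1.1, h1.2, h2.1, h2.2, h3.1, h3.2, h4.1, h4.2]
  have hcomp : ∀ a b : ℝ, (a / δ - b) ^ 2 ≤ 2 * N₁ + 2 * N₂ → |b| ≤ ‖e‖ → |a| ≤ δ * L := by
    intro a b h1 h2
    have h3 : |a / δ - b| ≤ 2 * N₁ + 2 * N₂ + 1 := abs_le_add_one_of_sq_le h1
    have h4 : |a / δ| ≤ L := by
      calc |a / δ| = |(a / δ - b) + b| := by rw [sub_add_cancel]
        _ ≤ |a / δ - b| + |b| := abs_add_le _ _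
        _ ≤ L := by rw [hL]; linarith
    rw [abs_div, abs_of_pos hδ0, div_le_iff₀ hδ0] at h4
    linarith
  have hdxy : dist x y ≤ δ * L := by
    rw [dist_comm, Prod.dist_eq, max_le_iff, Real.dist_eq, Real.dist_eq]
    have h1 : (q x y).1 ^ 2 ≤ 2 * N₁ + 2 * N₂ := by linarith [sq_nonneg (q x y).2]
    have h2 : (q x y).2 ^ 2 ≤ 2 * N₁ + 2 * N₂ := by linarith [sq_nonneg (q x y).1]
    exact ⟨hcomp (y.1 - x.1) e.1 h1 (norm_fst_le e), hcomp (y.2 - x.2) e.2 h2 (norm_snd_le e)⟩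
  have hvxy : |v x - v y| < τ := hρ x hxK y hyK (hdxy.trans_lt hδρ)
  have hfine : l / 4 * ((x.1 - z.1) ^ 2 + (x.2 - z.2) ^ 2) + ((q x y).1 ^ 2 + (q x y).2 ^ 2) ≤
      2 * τ := by
    have h1 := (hKball x hxK).1
    have h2 := abs_lt.1 hvxy
    have h3 := abs_lt.1 hvz
    simp only [hw] at hkey
    linarith [h2.1, h2.2, h3.1, h3.2]
  have hxz : ‖x - z‖ < r / 2 := by
    have h1 : l / 4 * ((x.1 - z.1) ^ 2 + (x.2 - z.2) ^ 2) < l / 4 * (r / 2) ^ 2 := by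
      linarith [sq_nonneg (q x y).1, sq_nonneg (q x y).2]
    have h2 := lt_of_mul_lt_mul_left h1 (by positivity)
    rw [norm_lt_iff_fst_snd]
    exact ⟨abs_lt_of_sq_lt_sq (by simp only [Prod.fst_sub]; linarith [sq_nonneg (x.2 - z.2)])
      (by positivity), abs_lt_of_sq_lt_sq (by
        simp only [Prod.snd_sub]; linarith [sq_nonneg (x.1 - z.1)]) (by positivity)⟩
  have hyz : dist y z < r := by
    calc dist y z ≤ dist y x + dist x z := dist_triangle _ _ _
      _ < r := by rw [dist_comm y x, dist_eq_norm x z]; linarith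
  have hyx : ‖y - x - δ • e‖ < c * δ := by
    have h1 : y - x - δ • e = δ • q x y := by
      ext <;> simp [hq] <;> field_simp
    have h2 : ‖q x y‖ < c := by
      rw [norm_lt_iff_fst_snd]
      exact ⟨abs_lt_of_sq_lt_sq (by linarith [sq_nonneg (q x y).2]) hc.le,
        abs_lt_of_sq_lt_sq (by linarith [sq_nonneg (q x y).1]) hc.le⟩
    rw [h1, norm_smul, Real.norm_eq_abs, abs_of_pos hδ0, mul_comm]
    gcongr
  have hnear : ∀ᶠ y' in 𝓝 y, μ x ≤ μ y' + η ∧ σ x ^ 2 ≤ σ y' ^ 2 + η := by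
    have h1 : ∀ᶠ y' in 𝓝 y, ‖y' - x - δ • e‖ < c * δ :=
      (by fun_prop : Continuous fun y' : ℝ × ℝ => ‖y' - x - δ • e‖).tendsto y |>.eventually
        (gt_mem_nhds hyx)
    filter_upwards [h1] with y' hy'
    refine hfav x ?_ δ hδ0 (hδr.trans_le hrr₁) y' hy'
    rw [mem_ball_iff_norm]
    linarith
  -- the subgradient at `y` and the supergradient at `x`
  have hyO := (hKball y hyK).2
  have hxO := (hKball x hxK).2
  set p : ℝ × ℝ := (-(2 * (q x y).1 / δ), -(2 * (q x y).2 / δ)) with hp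
  have hpv : p ∈ subdifferential openQuadrant v y := by
    have hd : ∀ a b t : ℝ, HasDerivAt (fun s => -((s - a) / δ - b) ^ 2)
        (-(2 * ((t - a) / δ - b) / δ)) t := by
      intro a b t
      refine ((((((hasDerivAt_id t).sub_const a).div_const δ).sub_const b).pow 2).neg).congr_deriv ?_
      simp; ring
    refine mem_subdifferential_of_separable (A := fun s => -((s - x.1) / δ - e.1) ^ 2)
      (B := fun s => -((s - x.2) / δ - e.2) ^ 2) (hd _ _ _) (hd _ _ _) ?_
    filter_upwards [mem_nhdsWithin_of_mem_nhds (Metric.ball_mem_nhds y (sub_pos.2 hyz))] with y' hy'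
    have hy'K : y' ∈ K := by
      rw [hK, Metric.mem_closedBall]
      linarith [dist_triangle y' y z, Metric.mem_ball.1 hy']
    have := hxy (show (x, y') ∈ K ×ˢ K from ⟨hxK, hy'K⟩)
    simp only [mem_ofPred_eq, hq] at this
    linarith
  have hpu : ((A' x.1 + l / 2 * (x.1 - z.1) + p.1, B' x.2 + l / 2 * (x.2 - z.2) + p.2) : ℝ × ℝ) ∈
      superdifferential openQuadrant u x := by
    have hd : ∀ (F F' : ℝ → ℝ), (∀ t, HasDerivAt F (F' t) t) → ∀ a b d t : ℝ,
        HasDerivAt (fun s => F s + l / 4 * (s - d) ^ 2 + ((a - s) / δ - b) ^ 2)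
        (F' t + l / 2 * (t - d) + -(2 * ((a - t) / δ - b) / δ)) t := by
      intro F F' hF a b d t
      refine (((hF t).add ((((hasDerivAt_id t).sub_const d).pow 2).const_mul (l / 4))).add
        (((((hasDerivAt_id t).const_sub a).div_const δ).sub_const b).pow 2)).congr_deriv ?_
      simp; ring
    refine mem_superdifferential_of_separable
      (A := fun s => A s + l / 4 * (s - z.1) ^ 2 + ((y.1 - s) / δ - e.1) ^ 2)
      (B := fun s => B s + l / 4 * (s - z.2) ^ 2 + ((y.2 - s) / δ - e.2) ^ 2)
      (hd A A' hA _ _ _ _) (hd B B' hB _ _ _ _) ?_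
    have hxr : dist x z < r := by rw [dist_eq_norm]; linarith
    filter_upwards [mem_nhdsWithin_of_mem_nhds (Metric.ball_mem_nhds x (sub_pos.2 hxr))] with x' hx'
    have hx'K : x' ∈ K := by
      rw [hK, Metric.mem_closedBall]
      linarith [dist_triangle x' x z, Metric.mem_ball.1 hx']
    have := hxy (show (x', y) ∈ K ×ˢ K from ⟨hx'K, hyK⟩)
    simp only [mem_ofPred_eq, hq, hw] at this
    linarith
  have hp1 := h.le_fst_of_supersolution hv hmono hsup hyO hpv (m := μ x - η)
    (hnear.mono fun y' hy' => by linarith [hy'.1])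
  have hp2 := h.le_snd_of_supersolution hv hmono hsup hyO hpv (m := μ x - η)
    (hnear.mono fun y' hy' => by linarith [hy'.1])
  have hsupy := h.le_mul_of_supersolution hsup hyO hpv (m := μ x - η) (s := σ x ^ 2 - η)
    ((hnear.mono fun y' hy' => by linarith [hy'.1]).filter_mono nhdsWithin_le_nhds)
    ((hnear.mono fun y' hy' => by linarith [hy'.2]).filter_mono nhdsWithin_le_nhds)
  have hsubx := h.hamiltonian_le_zero hsub hxO hpu
  rw [max_eq_left (by linarith), max_eq_left (by linarith)] at hsupy
  have hslope : ∀ F' d a p : ℝ, l ≤ F' → |a - d| < r / 2 →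
      p - (μ x - η) + l / 4 ≤ max (F' + l / 2 * (a - d) + p - μ x) 0 := by
    intro F' d a p h1 h2
    refine le_max_of_le_left ?_
    have h3 : l / 2 * (-(1 / 2)) ≤ l / 2 * (a - d) :=
      mul_le_mul_of_nonneg_left (by linarith [(abs_lt.1 h2).1]) (by positivity)
    linarith
  have hxz' := norm_lt_iff_fst_snd.1 hxz
  have hs1 := hslope _ z.1 x.1 p.1 (hA' x.1) hxz'.1
  have hs2 := hslope _ z.2 x.2 p.2 (hB' x.2) hxz'.2
  unfold hamiltonian at hsubx
  have hprod := mul_le_mul hs1 hs2 (by linarith) (le_max_right _ _)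
  simp only at hsubx
  have := mul_add_sq_le_mul_add (sub_nonneg.2 hp1) (sub_nonneg.2 hp2) (by positivity : 0 ≤ l / 4)
  linarith [show (l / 4) ^ 2 = l ^ 2 / 16 by ring]

/-- Causality: the comparison at `z` only involves points which are at most slightly larger than `z`,
and the exceptional points among these are below `z`. -/
theorem Admissible.le_of_forall_exceptional {μ σ u v : ℝ × ℝ → ℝ} (h : Admissible μ σ)
    (hu : ContinuousOn u quadrant) (hv : ContinuousOn v quadrant) (hmono : MonotoneOn v quadrant)
    (hsub : IsViscositySubsolution (hamiltonian μ σ) openQuadrant u)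
    (hsup : IsViscositySupersolution (hamiltonian μ σ) openQuadrant v)
    (hb : ∀ x ∈ axes, u x ≤ v x) {S : Set (ℝ × ℝ)} (hS : ∀ z, (S ∩ Icc (0, 0) z).Finite)
    (hfav : ∀ x ∈ openQuadrant, x ∉ S → HasFavorableDirection μ σ x)
    {z : ℝ × ℝ} (hz : z ∈ openQuadrant) (hzS : ∀ s ∈ S, s ∈ quadrant → s ≤ z → u s ≤ v s) :
    u z ≤ v z := by
  by_contra! hlt
  obtain ⟨ρ, hρ0, hρ⟩ : ∃ ρ > 0, ∀ s ∈ S, s ∈ quadrant → s ≤ z + (ρ, ρ) → s ≤ z := by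
    have hev : ∀ᶠ ρ : ℝ in 𝓝[>] 0, ∀ s ∈ S ∩ Icc (0, 0) (z + (1, 1)),
        s ≤ z + (ρ, ρ) → s ≤ z := by
      rw [(hS (z + (1, 1))).eventually_all]
      intro s _
      by_cases hs : s ≤ z
      · exact Eventually.of_forall fun _ _ => hs
      have : z.1 < s.1 ∨ z.2 < s.2 := by
        by_contra! hc
        exact hs hc
      rcases this with h1 | h1
      · filter_upwards [Ioo_mem_nhdsGT (sub_pos.2 h1)] with ρ hρ hs'
        have := hs'.1
        simp only [Prod.fst_add] at this
        linarith [hρ.2]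
      · filter_upwards [Ioo_mem_nhdsGT (sub_pos.2 h1)] with ρ hρ hs'
        have := hs'.2
        simp only [Prod.snd_add] at this
        linarith [hρ.2]
    obtain ⟨ρ, h1, h2⟩ := (hev.and (Ioo_mem_nhdsGT one_pos)).exists
    refine ⟨ρ, h2.1, fun s hs hsq hle => h1 s ⟨hs, hsq, hle.trans ?_⟩ hle⟩
    exact ⟨by simpa using h2.2.le, by simpa using h2.2.le⟩
  set Q : Set (ℝ × ℝ) := Icc (0, 0) (z + (ρ, ρ)) with hQ
  have hQq : Q ⊆ quadrant := fun x hx => hx.1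
  have hQc : IsCompact Q := isCompact_Icc
  have hzQ : z ∈ Q := ⟨⟨hz.1.le, hz.2.le⟩, by simpa using hρ0.le, by simpa using hρ0.le⟩
  obtain ⟨N, hN⟩ := hQc.exists_bound_of_continuousOn ((hu.sub hv).mono hQq)
  have hN0 : 0 ≤ N := (norm_nonneg _).trans (hN z hzQ)
  set l := (u z - v z) / (2 * (z.1 + z.2 + 1)) with hl
  have hzsum : 0 < z.1 + z.2 + 1 := by linarith [hz.1, hz.2]
  have hl0 : 0 < l := div_pos (sub_pos.2 hlt) (by linarith)
  have hlz : l * (z.1 + z.2 + 1) = (u z - v z) / 2 := by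
    rw [hl]; field_simp
  -- the penalization exceeds the bound `N` for `u - v` on the upper and the right side of `Q`
  set K := (N + 1) / ρ ^ 2 with hK
  have hK0 : 0 < K := by positivity
  have hKρ : K * ρ ^ 2 = N + 1 := div_mul_cancel₀ _ (by positivity)
  set A : ℝ → ℝ → ℝ := fun a t => l * t + K * (max (t - a) 0) ^ 2 with hA
  have hA0 : ∀ a t, 0 ≤ t → 0 ≤ A a t := fun a t ht => by simp only [hA]; positivity
  have hAρ : ∀ a, 0 ≤ a → N < A a (a + ρ) := by
    intro a ha
    simp only [hA, add_sub_cancel_left, max_eq_left hρ0.le, hKρ]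
    have : 0 ≤ l * (a + ρ) := by positivity
    linarith
  have hAc : ∀ a, Continuous (A a) := fun a => by simp only [hA]; fun_prop
  have hAd : ∀ a t, HasDerivAt (A a) (l + K * (2 * max (t - a) 0)) t := by
    intro a t
    exact (((hasDerivAt_id t).const_mul l).add
      ((hasDerivAt_sq_posPart a t).const_mul K)).congr_deriv (by simp)
  have hAl : ∀ a t, l ≤ l + K * (2 * max (t - a) 0) := fun a t => by
    have : 0 ≤ K * (2 * max (t - a) 0) := by positivity
    linarith
  obtain ⟨x, hxQ, hx⟩ := hQc.exists_isMaxOn ⟨z, hzQ⟩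
    (f := fun x => u x - v x - (A z.1 x.1 + A z.2 x.2))
    (((hu.sub hv).mono hQq).sub
      (((hAc z.1).comp continuous_fst).add ((hAc z.2).comp continuous_snd)).continuousOn)
  have hxz : u z - v z - (A z.1 z.1 + A z.2 z.2) ≤ u x - v x - (A z.1 x.1 + A z.2 x.2) := hx hzQ
  have hAz : A z.1 z.1 + A z.2 z.2 < u z - v z := by
    simp only [hA, sub_self, max_self]
    nlinarith
  have hx1 := hA0 z.1 x.1 hxQ.1.1
  have hx2 := hA0 z.2 x.2 hxQ.1.2
  have hux : v x < u x := by linarith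
  have hxO : x ∈ openQuadrant := by
    by_contra hxO
    exact absurd (hb x (mem_axes_of_not_openQuadrant hxQ.1 hxO)) (not_le.2 hux)
  have hNx := (abs_le.1 (hN x hxQ)).2
  simp only [Pi.sub_apply] at hNx
  have hxr : x.1 < z.1 + ρ := by
    refine lt_of_le_of_ne hxQ.2.1 fun heq => ?_
    have := hAρ z.1 hz.1.le
    rw [heq] at hx1 hxz
    linarith
  have hxt : x.2 < z.2 + ρ := by
    refine lt_of_le_of_ne hxQ.2.2 fun heq => ?_
    have := hAρ z.2 hz.2.le
    rw [heq] at hx2 hxz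
    linarith
  have hQx : Q ∈ 𝓝 x := by
    refine mem_of_superset (prod_mem_nhds (Icc_mem_nhds hxO.1 hxr) (Icc_mem_nhds hxO.2 hxt)) ?_
    exact fun y hy => ⟨⟨hy.1.1, hy.2.1⟩, hy.1.2, hy.2.2⟩
  have hxS : x ∉ S := fun hxS =>
    absurd (hzS x hxS hxQ.1 (hρ x hxS hxQ.1 hxQ.2)) (not_le.2 hux)
  exact h.not_isLocalMax hu hv hmono hsub hsup hl0 (hAd z.1) (hAd z.2) (hAl z.1) (hAl z.2) hxO
    (hfav x hxO hxS) (mem_of_superset hQx fun y hy => hx hy)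

/-- The comparison principle. Exceptional points, where no direction is favorable, are isolated, and
are treated by continuity from below, by induction on their number below a given point. -/
theorem Admissible.comparison {μ σ u v : ℝ × ℝ → ℝ} (h : Admissible μ σ)
    (hu : ContinuousOn u quadrant) (hv : ContinuousOn v quadrant) (hmono : MonotoneOn v quadrant)
    (hsub : IsViscositySubsolution (hamiltonian μ σ) openQuadrant u)
    (hsup : IsViscositySupersolution (hamiltonian μ σ) openQuadrant v)
    (hb : ∀ x ∈ axes, u x ≤ v x) : ∀ x ∈ quadrant, u x ≤ v x := by
  obtain ⟨S, hS, hfav⟩ := h.exists_favorable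
  have key : ∀ n : ℕ, ∀ s ∈ S, s ∈ quadrant → (S ∩ Icc (0, 0) s).ncard = n → u s ≤ v s := by
    intro n
    induction n using Nat.strong_induction_on with
    | _ n ih =>
    intro s hs hsq hn
    by_cases hsO : s ∈ openQuadrant
    swap
    · exact hb s (mem_axes_of_not_openQuadrant hsq hsO)
    have hbelow : ∀ t ∈ S, t ∈ quadrant → t ≤ s → t ≠ s → u t ≤ v t := by
      intro t ht htq hts hne
      refine ih _ ?_ t ht htq rfl
      rw [← hn]
      refine Set.ncard_lt_ncard ⟨?_, fun hsub' => ?_⟩ (hS s)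
      · exact fun x hx => ⟨hx.1, hx.2.1, hx.2.2.trans hts⟩
      · exact hne (le_antisymm hts (hsub' ⟨hs, hsq, le_rfl⟩).2.2)
    have hcont : Continuous fun r : ℝ => (s.1 - r, s.2 - r) := by fun_prop
    have ht : Tendsto (fun r : ℝ => (s.1 - r, s.2 - r)) (𝓝[>] 0) (𝓝 s) := by
      simpa using (hcont.tendsto 0).mono_left nhdsWithin_le_nhds
    refine le_of_tendsto_of_tendsto ((hu.continuousAt (quadrant_mem_nhds hsO)).tendsto.comp ht)
      ((hv.continuousAt (quadrant_mem_nhds hsO)).tendsto.comp ht) ?_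
    filter_upwards [ht.eventually (isOpen_openQuadrant.mem_nhds hsO), self_mem_nhdsWithin]
      with r hr hr0
    have hr0 : 0 < r := hr0
    refine h.le_of_forall_exceptional hu hv hmono hsub hsup hb hS hfav hr fun t ht htq hle => ?_
    refine hbelow t ht htq (hle.trans ⟨by simpa using hr0.le, by simpa using hr0.le⟩) ?_
    rintro rfl
    have := hle.1
    simp only at this
    linarith
  intro x hx
  by_cases hxO : x ∈ openQuadrant
  · exact h.le_of_forall_exceptional hu hv hmono hsub hsup hb hS hfav hxO
      fun s hs hsq _ => key _ s hs hsq rfl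
  · exact hb x (mem_axes_of_not_openQuadrant hx hxO)

/-! ### The scheme on the grid -/

section Update

variable {h m s a b Z : ℝ}

/-- The update is the larger root of `(W - a - h m) (W - b - h m) = h² s²`. -/
theorem update_mul : (update h m s a b - a - h * m) * (update h m s a b - b - h * m) =
    h ^ 2 * s ^ 2 := by
  have h1 : √((a - b) ^ 2 + 4 * h ^ 2 * s ^ 2) ^ 2 = (a - b) ^ 2 + 4 * h ^ 2 * s ^ 2 :=
    Real.sq_sqrt (by positivity)
  unfold update
  linear_combination h1 / 4

theorem abs_sub_le_sqrt_update : |a - b| ≤ √((a - b) ^ 2 + 4 * h ^ 2 * s ^ 2) :=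
  Real.abs_le_sqrt (by nlinarith [mul_nonneg (sq_nonneg h) (sq_nonneg s)])

theorem left_le_update : a + h * m ≤ update h m s a b := by
  unfold update
  linarith [le_abs_self (a - b),
    abs_sub_le_sqrt_update (h := h) (s := s) (a := a) (b := b)]

theorem update_comm : update h m s a b = update h m s b a := by
  unfold update
  rw [add_comm a b, ← neg_sub b a, neg_sq]

theorem right_le_update : b + h * m ≤ update h m s a b := by
  rw [update_comm]
  exact left_le_update

/-- Supersolutions of the quadratic equation for the update, with slopes `x` and `y`, are upper
bounds for the update. -/
theorem update_le {x y : ℝ} (hx : 0 ≤ x) (hy : 0 ≤ y) (hxy : h ^ 2 * s ^ 2 ≤ x * y)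
    (ha : a + h * m + x ≤ Z) (hb : b + h * m + y ≤ Z) : update h m s a b ≤ Z := by
  have h1 : √((a - b) ^ 2 + 4 * h ^ 2 * s ^ 2) ≤ 2 * Z - a - b - 2 * (h * m) := by
    rw [Real.sqrt_le_left (by linarith)]
    have : x * y ≤ (Z - a - h * m) * (Z - b - h * m) :=
      mul_le_mul (by linarith) (by linarith) hy (by linarith)
    nlinarith
  unfold update
  linarith

/-- The updated value satisfies the subsolution inequality of the discrete Hamiltonian. -/
theorem posPart_mul_le_of_le_update {q₁ q₂ : ℝ} (hh : 0 < h)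
    (h1 : h * q₁ ≤ update h m s a b - a) (h2 : h * q₂ ≤ update h m s a b - b) :
    max (q₁ - m) 0 * max (q₂ - m) 0 ≤ s ^ 2 := by
  rcases le_total (q₁ - m) 0 with h3 | h3
  · rw [max_eq_right h3, zero_mul]; positivity
  rcases le_total (q₂ - m) 0 with h4 | h4
  · rw [max_eq_right h4, mul_zero]; positivity
  rw [max_eq_left h3, max_eq_left h4]
  have h5 : h * (q₁ - m) * (h * (q₂ - m)) ≤ h ^ 2 * s ^ 2 := by
    rw [← update_mul (m := m) (a := a) (b := b)]
    exact mul_le_mul (by linarith) (by linarith) (by positivity)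
      (by linarith [left_le_update (h := h) (m := m) (s := s) (a := a) (b := b)])
  have : h ^ 2 * ((q₁ - m) * (q₂ - m)) ≤ h ^ 2 * s ^ 2 := by linarith
  exact le_of_mul_le_mul_left this (by positivity)

/-- The updated value satisfies the supersolution inequality of the discrete Hamiltonian. -/
theorem le_posPart_mul_of_update_le {q₁ q₂ : ℝ} (hh : 0 < h)
    (h1 : update h m s a b - a ≤ h * q₁) (h2 : update h m s a b - b ≤ h * q₂) :
    s ^ 2 ≤ max (q₁ - m) 0 * max (q₂ - m) 0 := by
  have ha := left_le_update (h := h) (m := m) (s := s) (a := a) (b := b)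
  have hb := right_le_update (h := h) (m := m) (s := s) (a := a) (b := b)
  have h3 : 0 ≤ h * (q₁ - m) := by linarith
  have h4 : 0 ≤ h * (q₂ - m) := by linarith
  rw [max_eq_left (nonneg_of_mul_nonneg_right h3 hh),
    max_eq_left (nonneg_of_mul_nonneg_right h4 hh)]
  have h5 : h ^ 2 * s ^ 2 ≤ h * (q₁ - m) * (h * (q₂ - m)) := by
    rw [← update_mul (m := m) (a := a) (b := b)]
    exact mul_le_mul (by linarith) (by linarith) (by linarith) h3
  have : h ^ 2 * s ^ 2 ≤ h ^ 2 * ((q₁ - m) * (q₂ - m)) := by linarith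
  exact le_of_mul_le_mul_left this (by positivity)

end Update

section Grid

variable {h : ℝ} {m s : ℕ → ℕ → ℝ}

theorem gridSolution_swap (h : ℝ) (m s : ℕ → ℕ → ℝ) (i j : ℕ) :
    gridSolution h (fun i j => m j i) (fun i j => s j i) i j = gridSolution h m s j i := by
  induction hn : i + j using Nat.strong_induction_on generalizing i j with
  | _ n ih =>
    rw [gridSolution_eq, gridSolution_eq h m s, update_comm]
    congr 1
    · rcases j with _ | j
      · simp
      · simpa using ih (i + j) (by omega) i j rfl
    · rcases i with _ | i
      · simp
      · simpa using ih (i + j) (by omega) i j rfl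

theorem gridSolution_succ_left (h : ℝ) (m s : ℕ → ℕ → ℝ) (i j : ℕ) :
    gridSolution h m s i j + h * m (i + 1) j ≤ gridSolution h m s (i + 1) j := by
  rw [gridSolution_eq h m s (i + 1) j]
  simpa using left_le_update

theorem gridSolution_succ_right (h : ℝ) (m s : ℕ → ℕ → ℝ) (i j : ℕ) :
    gridSolution h m s i j + h * m i (j + 1) ≤ gridSolution h m s i (j + 1) := by
  rw [gridSolution_eq h m s i (j + 1)]
  simpa using right_le_update

theorem gridSolution_mono_left (hh : 0 ≤ h) (hm : ∀ i j, 0 ≤ m i j) (j : ℕ) :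
    Monotone fun i => gridSolution h m s i j :=
  monotone_nat_of_le_succ fun i => by
    linarith [gridSolution_succ_left h m s i j, mul_nonneg hh (hm (i + 1) j)]

theorem gridSolution_mono_right (hh : 0 ≤ h) (hm : ∀ i j, 0 ≤ m i j) (i : ℕ) :
    Monotone fun j => gridSolution h m s i j :=
  monotone_nat_of_le_succ fun j => by
    linarith [gridSolution_succ_right h m s i j, mul_nonneg hh (hm i (j + 1))]

theorem gridSolution_nonneg (hh : 0 ≤ h) (hm : ∀ i j, 0 ≤ m i j) (i j : ℕ) :
    0 ≤ gridSolution h m s i j := by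
  have h0 : 0 ≤ gridSolution h m s 0 0 := by
    rw [gridSolution_eq]
    have := left_le_update (h := h) (m := m 0 0) (s := s 0 0) (a := 0) (b := 0)
    simp only [if_true]
    linarith [mul_nonneg hh (hm 0 0)]
  exact h0.trans ((gridSolution_mono_left hh hm 0 (Nat.zero_le i)).trans
    (gridSolution_mono_right hh hm i (Nat.zero_le j)))

/-- An upper bound for the growth in the first variable, which only involves the vertical variation
of the weights `m` through `b`: the term `α h (j + 1)` with `α` small makes room for the large
horizontal slope `M + M² / α`. -/
theorem gridSolution_add_le (hh : 0 < h) {M : ℝ} (hm : ∀ i j, 0 ≤ m i j) (hmM : ∀ i j, m i j ≤ M)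
    (hs : ∀ i j, s i j ^ 2 ≤ M ^ 2) {k n J : ℕ} {b : ℕ → ℝ} (hb0 : 0 ≤ b 0)
    (hb : ∀ d ≤ n, ∀ j < J, h * (m (k + d) (j + 1) - m k (j + 1)) ≤ b (j + 1) - b j)
    {α : ℝ} (hα : 0 < α) {d : ℕ} (hd : d ≤ n) {j : ℕ} (hj : j ≤ J) :
    gridSolution h m s (k + d) j ≤
      gridSolution h m s k j + b j + α * h * (j + 1) + (M + M ^ 2 / α) * h * d := by
  have hM : 0 ≤ M := (hm 0 0).trans (hmM 0 0)
  have hbj : ∀ j ≤ J, 0 ≤ b j := by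
    intro j
    induction j with
    | zero => exact fun _ => hb0
    | succ j ih =>
      intro hj
      have h1 := hb 0 (Nat.zero_le n) j hj
      have h2 := ih (by omega)
      simp only [add_zero, sub_self, mul_zero] at h1
      linarith
  have hslope : 0 ≤ M ^ 2 / α := by positivity
  have hxy : ∀ i j, h ^ 2 * s i j ^ 2 ≤ h * (M ^ 2 / α) * (h * α) := by
    intro i j
    have : h * (M ^ 2 / α) * (h * α) = h ^ 2 * M ^ 2 := by field_simp
    rw [this]
    exact mul_le_mul_of_nonneg_left (hs i j) (by positivity)
  induction d generalizing j with
  | zero =>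
    have h1 := hbj j hj
    have : 0 ≤ α * h * (j + 1) := by positivity
    simp only [add_zero, Nat.cast_zero, mul_zero]
    linarith
  | succ d ih =>
    have ihd := fun {j} => ih (by omega : d ≤ n) (j := j)
    clear ih
    have hMh := fun i j => mul_le_mul_of_nonneg_left (hmM i j) hh.le
    have hMd : 0 ≤ (M + M ^ 2 / α) * h * d := by positivity
    have hMh0 : 0 ≤ M ^ 2 / α * h := by positivity
    induction j with
    | zero =>
      rw [gridSolution_eq]
      simp only [Nat.add_eq_zero_iff, one_ne_zero, and_false, if_false, if_true]
      have h1 := ihd hj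
      have h2 := hMh (k + (d + 1)) 0
      have h3 := gridSolution_nonneg (s := s) hh.le hm k 0
      simp only [Nat.cast_zero, zero_add, mul_one, Nat.cast_add, Nat.cast_one] at h1 ⊢
      refine update_le (x := h * (M ^ 2 / α)) (y := h * α) (by positivity) (by positivity)
        (hxy _ _) ?_ ?_
      · simp only [← add_assoc, Nat.add_sub_cancel] at h2 ⊢
        linarith
      · linarith
    | succ j ihj =>
      rw [gridSolution_eq]
      simp only [Nat.add_eq_zero_iff, one_ne_zero, and_false, if_false]
      have h1 := ihd hj
      have h2 := hMh (k + (d + 1)) (j + 1)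
      have h3 := ihj (by omega)
      have h4 := gridSolution_succ_right h m s k j
      have h5 := hb (d + 1) hd j (by omega)
      simp only [Nat.cast_add, Nat.cast_one] at h1 h3 ⊢
      refine update_le (x := h * (M ^ 2 / α)) (y := h * α) (by positivity) (by positivity)
        (hxy _ _) ?_ ?_
      · simp only [← add_assoc, Nat.add_sub_cancel] at h2 ⊢
        linarith
      · simp only [Nat.add_sub_cancel]
        linarith

theorem sum_le_gridSolution_zero (i : ℕ) :
    ∑ k ∈ Finset.range (i + 1), h * m k 0 ≤ gridSolution h m s i 0 := by
  induction i with
  | zero =>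
    rw [gridSolution_eq]
    simpa using left_le_update (h := h) (m := m 0 0) (s := s 0 0) (a := 0) (b := 0)
  | succ i ih =>
    rw [Finset.sum_range_succ]
    linarith [gridSolution_succ_left h m s i 0]

/-- On the axis the neighbours outside the grid perturb the sum of the weights by an error which
tends to `0` with `h` (take `c` small). -/
theorem gridSolution_zero_le (hh : 0 < h) {M : ℝ} (hm : ∀ i j, 0 ≤ m i j)
    (hs : ∀ i j, s i j ^ 2 ≤ M ^ 2) {c : ℝ} (hc : 0 < c) (hc' : (h * M) ^ 2 ≤ c ^ 2)
    (i : ℕ) : gridSolution h m s i 0 ≤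
      ∑ k ∈ Finset.range (i + 1), h * m k 0 + c + h * (M ^ 2 / c) * (h * i) := by
  have hsM : ∀ i j, h ^ 2 * s i j ^ 2 ≤ h ^ 2 * M ^ 2 := fun i j =>
    mul_le_mul_of_nonneg_left (hs i j) (by positivity)
  have hsum : ∀ i, 0 ≤ ∑ k ∈ Finset.range i, h * m k 0 := fun i =>
    Finset.sum_nonneg fun k _ => mul_nonneg hh.le (hm k 0)
  induction i with
  | zero =>
    rw [gridSolution_eq]
    simp only [if_true, zero_add, Finset.sum_range_one, Nat.cast_zero, mul_zero, add_zero]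
    refine update_le (x := c) (y := c) hc.le hc.le ?_ (by linarith) (by linarith)
    linarith [hsM 0 0, mul_pow h M 2]
  | succ i ih =>
    rw [gridSolution_eq, Finset.sum_range_succ]
    simp only [Nat.add_eq_zero_iff, one_ne_zero, and_false, if_false, if_true, Nat.add_sub_cancel]
    have h1 : h * (M ^ 2 / c) * h * c = h ^ 2 * M ^ 2 := by field_simp
    have h2 : 0 ≤ h * (M ^ 2 / c) * (h * i) := by positivity
    have h3 : 0 ≤ h * (M ^ 2 / c) * h := by positivity
    push_cast
    refine update_le (x := h * (M ^ 2 / c) * h) (y := c) h3 hc.le ?_ ?_ ?_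
    · rw [h1]; exact hsM _ _
    · linarith
    · linarith [hsum (i + 1)]

end Grid

/-! ### Asymptotically equicontinuous families -/

/-- The functions `F i` have small oscillation near `x` relative to `Q`, eventually along `l`. -/
def AsympEquicontAt {ι : Type*} (l : Filter ι) (F : ι → ℝ × ℝ → ℝ) (Q : Set (ℝ × ℝ))
    (x : ℝ × ℝ) : Prop :=
  ∀ ε > 0, ∃ r > 0, ∀ᶠ i in l, ∀ z ∈ Q ∩ Metric.ball x r, ∀ w ∈ Q ∩ Metric.ball x r,
    F i z ≤ F i w + ε

section Family

variable {ι : Type*} {l : Filter ι} {F : ι → ℝ × ℝ → ℝ} {Q : Set (ℝ × ℝ)} {x : ℝ × ℝ}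

theorem eventually_lt_limsup_add
    (hb : ∀ z ∈ Q, ∃ C, ∀ᶠ i in l, 0 ≤ F i z ∧ F i z ≤ C) (hx : x ∈ Q) {ε : ℝ} (hε : 0 < ε) :
    ∀ᶠ i in l, F i x < limsup (fun i => F i x) l + ε := by
  obtain ⟨C, hC⟩ := hb x hx
  exact eventually_lt_of_limsup_lt (lt_add_of_pos_right _ hε)
    (isBoundedUnder_of_eventually_le (hC.mono fun _ h => h.2))

theorem eventually_liminf_sub_lt
    (hb : ∀ z ∈ Q, ∃ C, ∀ᶠ i in l, 0 ≤ F i z ∧ F i z ≤ C) (hx : x ∈ Q) {ε : ℝ} (hε : 0 < ε) :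
    ∀ᶠ i in l, liminf (fun i => F i x) l - ε < F i x := by
  obtain ⟨C, hC⟩ := hb x hx
  exact eventually_lt_of_lt_liminf (sub_lt_self _ hε)
    (isBoundedUnder_of_eventually_ge (hC.mono fun _ h => h.1))

variable [l.NeBot]

theorem frequently_limsup_sub_lt
    (hb : ∀ z ∈ Q, ∃ C, ∀ᶠ i in l, 0 ≤ F i z ∧ F i z ≤ C) (hx : x ∈ Q) {ε : ℝ} (hε : 0 < ε) :
    ∃ᶠ i in l, limsup (fun i => F i x) l - ε < F i x := by
  obtain ⟨C, hC⟩ := hb x hx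
  exact frequently_lt_of_lt_limsup (IsBoundedUnder.isCoboundedUnder_le
    (isBoundedUnder_of_eventually_ge (hC.mono fun _ h => h.1))) (sub_lt_self _ hε)

theorem frequently_lt_liminf_add
    (hb : ∀ z ∈ Q, ∃ C, ∀ᶠ i in l, 0 ≤ F i z ∧ F i z ≤ C) (hx : x ∈ Q) {ε : ℝ} (hε : 0 < ε) :
    ∃ᶠ i in l, F i x < liminf (fun i => F i x) l + ε := by
  obtain ⟨C, hC⟩ := hb x hx
  exact frequently_lt_of_liminf_lt (IsBoundedUnder.isCoboundedUnder_ge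
    (isBoundedUnder_of_eventually_le (hC.mono fun _ h => h.2))) (lt_add_of_pos_right _ hε)

theorem limsup_le_limsup_add (hb : ∀ z ∈ Q, ∃ C, ∀ᶠ i in l, 0 ≤ F i z ∧ F i z ≤ C)
    {z w : ℝ × ℝ} (hz : z ∈ Q) (hw : w ∈ Q) {ε : ℝ} (h : ∀ᶠ i in l, F i z ≤ F i w + ε) :
    limsup (fun i => F i z) l ≤ limsup (fun i => F i w) l + ε := by
  refine le_of_forall_pos_le_add fun η hη => ?_
  obtain ⟨i, ⟨h1, h2⟩, h3⟩ := ((frequently_limsup_sub_lt hb hz (half_pos hη)).and_eventually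
    h).and_eventually (eventually_lt_limsup_add hb hw (half_pos hη)) |>.exists
  linarith

theorem liminf_le_liminf_add (hb : ∀ z ∈ Q, ∃ C, ∀ᶠ i in l, 0 ≤ F i z ∧ F i z ≤ C)
    {z w : ℝ × ℝ} (hz : z ∈ Q) (hw : w ∈ Q) {ε : ℝ} (h : ∀ᶠ i in l, F i z ≤ F i w + ε) :
    liminf (fun i => F i z) l ≤ liminf (fun i => F i w) l + ε := by
  refine le_of_forall_pos_le_add fun η hη => ?_
  obtain ⟨i, ⟨h1, h2⟩, h3⟩ := ((frequently_lt_liminf_add hb hw (half_pos hη)).and_eventually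
    h).and_eventually (eventually_liminf_sub_lt hb hz (half_pos hη)) |>.exists
  linarith

theorem continuousWithinAt_of_le_add {f : ℝ × ℝ → ℝ} (hx : x ∈ Q)
    (h : ∀ ε > 0, ∃ r > 0, ∀ z ∈ Q ∩ Metric.ball x r, ∀ w ∈ Q ∩ Metric.ball x r,
      f z ≤ f w + ε) : ContinuousWithinAt f Q x := by
  rw [Metric.continuousWithinAt_iff]
  intro ε hε
  obtain ⟨r, hr, h⟩ := h (ε / 2) (half_pos hε)
  refine ⟨r, hr, fun y hy hyr => ?_⟩
  have hxr : x ∈ Q ∩ Metric.ball x r := ⟨hx, Metric.mem_ball_self hr⟩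
  have h1 := h y ⟨hy, hyr⟩ x hxr
  have h2 := h x hxr y ⟨hy, hyr⟩
  rw [Real.dist_eq, abs_lt]
  constructor <;> linarith

theorem AsympEquicontAt.limsup (hb : ∀ z ∈ Q, ∃ C, ∀ᶠ i in l, 0 ≤ F i z ∧ F i z ≤ C)
    (h : AsympEquicontAt l F Q x) {ε : ℝ} (hε : 0 < ε) :
    ∃ r > 0, ∀ z ∈ Q ∩ Metric.ball x r, ∀ w ∈ Q ∩ Metric.ball x r,
      limsup (fun i => F i z) l ≤ limsup (fun i => F i w) l + ε := by
  obtain ⟨r, hr, h⟩ := h ε hε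
  exact ⟨r, hr, fun z hz w hw => limsup_le_limsup_add hb hz.1 hw.1
    (h.mono fun i hi => hi z hz w hw)⟩

theorem AsympEquicontAt.liminf (hb : ∀ z ∈ Q, ∃ C, ∀ᶠ i in l, 0 ≤ F i z ∧ F i z ≤ C)
    (h : AsympEquicontAt l F Q x) {ε : ℝ} (hε : 0 < ε) :
    ∃ r > 0, ∀ z ∈ Q ∩ Metric.ball x r, ∀ w ∈ Q ∩ Metric.ball x r,
      liminf (fun i => F i z) l ≤ liminf (fun i => F i w) l + ε := by
  obtain ⟨r, hr, h⟩ := h ε hε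
  exact ⟨r, hr, fun z hz w hw => liminf_le_liminf_add hb hz.1 hw.1
    (h.mono fun i hi => hi z hz w hw)⟩

theorem AsympEquicontAt.eventually_le_limsup_add
    (hb : ∀ z ∈ Q, ∃ C, ∀ᶠ i in l, 0 ≤ F i z ∧ F i z ≤ C) (hx : x ∈ Q)
    (h : AsympEquicontAt l F Q x) {ε : ℝ} (hε : 0 < ε) :
    ∃ r > 0, ∀ᶠ i in l, ∀ z ∈ Q ∩ Metric.ball x r,
      F i z ≤ Filter.limsup (fun i => F i z) l + ε := by
  obtain ⟨r₁, hr₁, h₁⟩ := h (ε / 3) (by positivity)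
  obtain ⟨r₂, hr₂, h₂⟩ := h.limsup hb (ε := ε / 3) (by positivity)
  refine ⟨min r₁ r₂, lt_min hr₁ hr₂, ?_⟩
  filter_upwards [h₁, eventually_lt_limsup_add hb hx (ε := ε / 3) (by positivity)] with i h3 h4
  intro z hz
  have h5 := h3 z ⟨hz.1, Metric.ball_subset_ball (min_le_left _ _) hz.2⟩ x
    ⟨hx, Metric.mem_ball_self hr₁⟩
  have h6 := h₂ x ⟨hx, Metric.mem_ball_self hr₂⟩ z
    ⟨hz.1, Metric.ball_subset_ball (min_le_right _ _) hz.2⟩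
  linarith

theorem AsympEquicontAt.eventually_liminf_le_add
    (hb : ∀ z ∈ Q, ∃ C, ∀ᶠ i in l, 0 ≤ F i z ∧ F i z ≤ C) (hx : x ∈ Q)
    (h : AsympEquicontAt l F Q x) {ε : ℝ} (hε : 0 < ε) :
    ∃ r > 0, ∀ᶠ i in l, ∀ z ∈ Q ∩ Metric.ball x r,
      Filter.liminf (fun i => F i z) l ≤ F i z + ε := by
  obtain ⟨r₁, hr₁, h₁⟩ := h (ε / 3) (by positivity)
  obtain ⟨r₂, hr₂, h₂⟩ := h.liminf hb (ε := ε / 3) (by positivity)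
  refine ⟨min r₁ r₂, lt_min hr₁ hr₂, ?_⟩
  filter_upwards [h₁, eventually_liminf_sub_lt hb hx (ε := ε / 3) (by positivity)] with i h3 h4
  intro z hz
  have h5 := h3 x ⟨hx, Metric.mem_ball_self hr₁⟩ z
    ⟨hz.1, Metric.ball_subset_ball (min_le_left _ _) hz.2⟩
  have h6 := h₂ z ⟨hz.1, Metric.ball_subset_ball (min_le_right _ _) hz.2⟩ x
    ⟨hx, Metric.mem_ball_self hr₂⟩
  linarith

end Family

/-! ### Bounds and asymptotic equicontinuity of the numerical solutions -/

variable {μ σ μs : ℝ × ℝ → ℝ}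

theorem F2.swap (hs : F2 μs) : F2 (fun x => μs x.swap) where
  nonneg x hx := hs.nonneg _ ⟨swap_mem_quadrant.2 hx.1, hx.2.symm⟩
  bounded := by
    obtain ⟨C, hC⟩ := hs.bounded
    refine ⟨C, ?_⟩
    rintro _ ⟨x, hx, rfl⟩
    exact hC ⟨_, ⟨swap_mem_quadrant.2 hx.1, hx.2.symm⟩, rfl⟩
  usc x hx a ha := by
    have : Tendsto Prod.swap (𝓝[axes] x) (𝓝[axes] x.swap) :=
      (continuous_swap.continuousWithinAt).tendsto_nhdsWithin
        fun y hy => ⟨swap_mem_quadrant.2 hy.1, hy.2.symm⟩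
    exact this.eventually (hs.usc _ ⟨swap_mem_quadrant.2 hx.1, hx.2.symm⟩ a ha)
  discontinuities x := by
    obtain ⟨V, hV, hfin⟩ := hs.discontinuities x.swap
    refine ⟨Prod.swap ⁻¹' V, (continuous_swap.tendsto x) hV,
      (hfin.preimage Prod.swap_injective.injOn).subset ?_⟩
    rintro y ⟨⟨hy, hc⟩, hyV⟩
    refine ⟨⟨⟨swap_mem_quadrant.2 hy.1, hy.2.symm⟩, fun hc' => hc ?_⟩, hyV⟩
    exact hc'.comp continuous_swap.continuousWithinAt
      fun z hz => ⟨swap_mem_quadrant.2 hz.1, hz.2.symm⟩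

theorem gridMean_swap (μ μs : ℝ × ℝ → ℝ) (h : ℝ) (i j : ℕ) :
    gridMean (fun x => μ x.swap) (fun x => μs x.swap) h i j = gridMean μ μs h j i := by
  unfold gridMean
  congr 1
  by_cases hx : ((h * i, h * j) : ℝ × ℝ) ∈ axes
  · rw [indicator_of_mem hx, indicator_of_mem (show ((h * j, h * i) : ℝ × ℝ) ∈ axes from
      ⟨swap_mem_quadrant.2 hx.1, hx.2.symm⟩)]
    rfl
  · rw [indicator_of_notMem hx, indicator_of_notMem fun hx' : ((h * j, h * i) : ℝ × ℝ) ∈ axes =>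
      hx ⟨swap_mem_quadrant.2 hx'.1, hx'.2.symm⟩]

theorem numericalSolution_swap (μ σ μs : ℝ × ℝ → ℝ) (h : ℝ) (x : ℝ × ℝ) :
    numericalSolution (fun x => μ x.swap) (fun x => σ x.swap) (fun x => μs x.swap) h x =
      numericalSolution μ σ μs h x.swap := by
  unfold numericalSolution
  rw [Prod.fst_swap, Prod.snd_swap, ← gridSolution_swap]
  congr 1
  ext i j
  exact gridMean_swap μ μs h j i

theorem grid_mem_quadrant {h : ℝ} (hh : 0 < h) (i j : ℕ) : ((h * i, h * j) : ℝ × ℝ) ∈ quadrant :=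
  ⟨by positivity, by positivity⟩

theorem Admissible.exists_grid_bound (hA : Admissible μ σ) (hs : F2 μs) : ∃ M > 0,
    (∀ x ∈ quadrant, μ x ≤ M) ∧ ∀ h > 0, ∀ i j, 0 ≤ gridMean μ μs h i j ∧
      gridMean μ μs h i j ≤ M ∧ σ (h * i, h * j) ^ 2 ≤ M ^ 2 := by
  obtain ⟨M, hM⟩ := hA.bounded
  obtain ⟨C, hC⟩ := hs.bounded
  have hind : ∀ x, 0 ≤ axes.indicator μs x ∧ axes.indicator μs x ≤ max C 0 := by
    intro x
    by_cases hx : x ∈ axes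
    · rw [indicator_of_mem hx]
      exact ⟨hs.nonneg x hx, le_max_of_le_left (hC ⟨x, hx, rfl⟩)⟩
    · rw [indicator_of_notMem hx]
      exact ⟨le_rfl, le_max_right _ _⟩
  have h1 := le_max_left M 0
  have h2 := le_max_right M 0
  have h3 := le_max_right C 0
  refine ⟨max M 0 + max C 0 + 1, by linarith, fun x hx => by linarith [(hM x hx).1],
    fun h hh i j => ?_⟩
  have hq := grid_mem_quadrant hh i j
  have h4 := hind (h * i, h * j)
  have h5 := hM _ hq
  have h6 := hA.nonneg _ hq
  exact ⟨add_nonneg h6.1 h4.1, by unfold gridMean; linarith,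
    pow_le_pow_left₀ h6.2 (by linarith) 2⟩

theorem numericalSolution_monotone (hA : Admissible μ σ) (hs : F2 μs) {h : ℝ} (hh : 0 < h) :
    Monotone (numericalSolution μ σ μs h) := by
  obtain ⟨M, -, -, hM⟩ := hA.exists_grid_bound hs
  intro x y hxy
  have h1 : ⌊x.1 / h⌋₊ ≤ ⌊y.1 / h⌋₊ := Nat.floor_mono (div_le_div_of_nonneg_right hxy.1 hh.le)
  have h2 : ⌊x.2 / h⌋₊ ≤ ⌊y.2 / h⌋₊ := Nat.floor_mono (div_le_div_of_nonneg_right hxy.2 hh.le)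
  exact (gridSolution_mono_left hh.le (fun i j => (hM h hh i j).1) _ h1).trans
    (gridSolution_mono_right hh.le (fun i j => (hM h hh i j).1) _ h2)

theorem mul_floor_le {h t : ℝ} (hh : 0 < h) (ht : 0 ≤ t) : h * ⌊t / h⌋₊ ≤ t := by
  have := Nat.floor_le (div_nonneg ht hh.le)
  rwa [le_div_iff₀ hh, mul_comm] at this

theorem lt_mul_floor_add {h t : ℝ} (hh : 0 < h) : t < h * ⌊t / h⌋₊ + h := by
  have := Nat.lt_floor_add_one (t / h)
  rw [div_lt_iff₀ hh] at this
  linarith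

theorem numericalSolution_bounded (hA : Admissible μ σ) (hs : F2 μs) {x : ℝ × ℝ}
    (hx : x ∈ quadrant) :
    ∃ C, ∀ᶠ h in 𝓝[>] 0, 0 ≤ numericalSolution μ σ μs h x ∧ numericalSolution μ σ μs h x ≤ C := by
  obtain ⟨M, hM0, -, hM⟩ := hA.exists_grid_bound hs
  refine ⟨3 * M * (x.2 + 1) + x.2 + 1 + (M + M ^ 2) * x.1, ?_⟩
  filter_upwards [Ioo_mem_nhdsGT one_pos] with h hh
  refine ⟨gridSolution_nonneg hh.1.le (fun i j => (hM h hh.1 i j).1) _ _, ?_⟩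
  unfold numericalSolution
  -- growth along the vertical axis, followed by growth in the horizontal direction
  set i := ⌊x.1 / h⌋₊
  set j := ⌊x.2 / h⌋₊
  have hi : h * i ≤ x.1 := mul_floor_le hh.1 hx.1
  have hj : h * j ≤ x.2 := mul_floor_le hh.1 hx.2
  have h1 := gridSolution_add_le hh.1 (fun i j => (hM h hh.1 i j).1) (fun i j => (hM h hh.1 i j).2.1)
    (fun i j => (hM h hh.1 i j).2.2) (k := 0) (n := i) (J := j) (b := fun j => M * (h * j))
    (by simp) (fun d _ j _ => by
      have h2 := (hM h hh.1 (0 + d) (j + 1)).2.1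
      have h3 := (hM h hh.1 0 (j + 1)).1
      have := mul_le_mul_of_nonneg_left (sub_le_sub h2 h3) hh.1.le
      push_cast
      linarith) one_pos le_rfl le_rfl
  have h2 := gridSolution_zero_le (h := h) (M := M) (m := fun i j => gridMean μ μs h j i)
    (s := fun i j => σ (h * j, h * i)) hh.1
    (fun i j => (hM h hh.1 j i).1) (fun i j => (hM h hh.1 j i).2.2) (c := h * M)
    (mul_pos hh.1 hM0) le_rfl j
  rw [gridSolution_swap h (gridMean μ μs h) (fun i j => σ (h * i, h * j))] at h2
  have h3 : ∑ k ∈ Finset.range (j + 1), h * gridMean μ μs h 0 k ≤ (j + 1) * (h * M) := by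
    calc _ ≤ ∑ k ∈ Finset.range (j + 1), h * M := Finset.sum_le_sum fun k _ =>
          mul_le_mul_of_nonneg_left (hM h hh.1 0 k).2.1 hh.1.le
      _ = _ := by simp
  have h4 : h * (M ^ 2 / (h * M)) = M := by field_simp [hh.1.ne']
  rw [h4] at h2
  simp only [zero_add, div_one, one_mul] at h1
  have h5 : M * (h * j) ≤ M * x.2 := mul_le_mul_of_nonneg_left hj hM0.le
  have h6 : (M + M ^ 2) * (h * i) ≤ (M + M ^ 2) * x.1 := mul_le_mul_of_nonneg_left hi (by positivity)
  have h7 : h * M ≤ 1 * M := mul_le_mul_of_nonneg_right hh.2.le hM0.le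
  linarith [hh.2]

/-- Off finitely many short intervals of heights, `μ` varies little across a thin vertical strip. -/
theorem Admissible.exists_vertical_strip (hA : Admissible μ σ) {a₀ : ℝ} (ha₀ : 0 ≤ a₀) (R : ℝ) :
    ∃ F : Finset ℝ, ∀ τ > 0, ∀ η > 0, ∃ r > 0, ∀ a b y, 0 ≤ a → 0 ≤ b → |a - a₀| < r →
      |b - a₀| < r → 0 ≤ y → y ≤ R → (∀ f ∈ F, τ ≤ |y - f|) → μ (b, y) - μ (a, y) ≤ η := by
  obtain ⟨E, -, hE, hfin, -⟩ := hA.exists_discontinuities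
  refine ⟨(hfin a₀ R).toFinset, fun τ hτ η hη => ?_⟩
  set K : Set ℝ := {y ∈ Icc 0 R | ∀ f ∈ (hfin a₀ R).toFinset, τ ≤ |y - f|} with hK
  have hKc : IsCompact K := by
    refine isCompact_Icc.inter_right (t := {y | ∀ f ∈ (hfin a₀ R).toFinset, τ ≤ |y - f|}) ?_
    simp only [ofPred_forall]
    exact isClosed_biInter fun f _ => isClosed_le continuous_const (by fun_prop)
  have hloc : ∀ y ∈ K, ∀ᶠ z : (ℝ × ℝ) × ℝ in 𝓝 ((a₀, a₀) : ℝ × ℝ) ×ˢ 𝓝 y,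
      0 ≤ z.1.1 → 0 ≤ z.1.2 → 0 ≤ z.2 → μ (z.1.2, z.2) - μ (z.1.1, z.2) ≤ η := by
    intro y hy
    have hyE : (a₀, y) ∉ E := by
      intro hmem
      have := hy.2 y (by simpa using ⟨hy.1, hmem, ha₀⟩)
      rw [sub_self, abs_zero] at this
      linarith
    have hc := (hE (a₀, y) ⟨ha₀, hy.1.1⟩ hyE).1
    obtain ⟨ρ, hρ, hc⟩ := Metric.continuousWithinAt_iff.1 hc (η / 2) (half_pos hη)
    rw [← nhds_prod_eq]
    filter_upwards [Metric.ball_mem_nhds _ hρ] with z hz h1 h2 h3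
    rw [Metric.mem_ball, Prod.dist_eq, Prod.dist_eq, max_lt_iff, max_lt_iff] at hz
    have h4 := @hc (z.1.1, z.2) ⟨h1, h3⟩ (by rw [Prod.dist_eq, max_lt_iff]; exact ⟨hz.1.1, hz.2⟩)
    have h5 := @hc (z.1.2, z.2) ⟨h2, h3⟩ (by rw [Prod.dist_eq, max_lt_iff]; exact ⟨hz.1.2, hz.2⟩)
    rw [Real.dist_eq, abs_lt] at h4 h5
    linarith [h4.1, h5.2]
  have := hKc.eventually_forall_of_forall_eventually (x₀ := ((a₀, a₀) : ℝ × ℝ))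
    (P := fun z y => 0 ≤ z.1 → 0 ≤ z.2 → 0 ≤ y → μ (z.2, y) - μ (z.1, y) ≤ η)
    (fun y hy => by rw [nhds_prod_eq]; exact hloc y hy)
  obtain ⟨r, hr, hball⟩ := Metric.eventually_nhds_iff_ball.1 this
  refine ⟨r, hr, fun a b y ha hb h1 h2 h3 h4 h5 => ?_⟩
  refine hball (a, b) ?_ y ⟨⟨h3, h4⟩, h5⟩ ha hb h3
  rw [Metric.mem_ball, Prod.dist_eq, max_lt_iff, Real.dist_eq, Real.dist_eq]
  exact ⟨h1, h2⟩

/-- The piecewise linear function rising from `0` to `3 τ` with slope one on `[f - 2 τ, f + τ]`. -/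
def ramp (τ f y : ℝ) : ℝ := max 0 (min (y - (f - 2 * τ)) (3 * τ))

theorem ramp_mono (τ f : ℝ) : Monotone (ramp τ f) := fun y z hyz => by
  unfold ramp
  gcongr

theorem ramp_nonneg (τ f y : ℝ) : 0 ≤ ramp τ f y := le_max_left _ _

theorem ramp_le {τ : ℝ} (hτ : 0 ≤ τ) (f y : ℝ) : ramp τ f y ≤ 3 * τ :=
  max_le (by linarith) (min_le_right _ _)

theorem ramp_sub {τ f y h : ℝ} (hh : 0 ≤ h) (hhτ : h ≤ τ) (hy : |y - f| ≤ τ) :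
    ramp τ f y - ramp τ f (y - h) = h := by
  have := abs_le.1 hy
  unfold ramp
  rw [min_eq_left (by linarith), min_eq_left (by linarith), max_eq_right (by linarith),
    max_eq_right (by linarith)]
  ring

/-- The numerical solutions increase little across a thin vertical strip. The vertical growth which is
caused by the variation of `μ` across the strip is small, since `μ` varies much only on few short
intervals of heights; there the ramps with slope `M` dominate it. -/
theorem numericalSolution_fst_le_add (hA : Admissible μ σ) (hs : F2 μs) {a₀ : ℝ} (ha₀ : 0 ≤ a₀)
    {R : ℝ} (hR : 0 ≤ R) {ε : ℝ} (hε : 0 < ε) : ∃ r > 0, ∀ᶠ h in 𝓝[>] 0, ∀ a b y, 0 ≤ a → a ≤ b →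
      |a - a₀| < r → |b - a₀| < r → 0 ≤ y → y ≤ R →
      numericalSolution μ σ μs h (b, y) ≤ numericalSolution μ σ μs h (a, y) + ε := by
  obtain ⟨M, hM0, hMμ, hM⟩ := hA.exists_grid_bound hs
  obtain ⟨F, hF⟩ := hA.exists_vertical_strip ha₀ R
  set η := ε / (4 * (R + 1)) with hη
  have hη0 : 0 < η := by positivity
  have hηR : η * (R + 1) = ε / 4 := by rw [hη]; field_simp
  set τ := ε / (12 * M * (F.card + 1)) with hτ
  have hτ0 : 0 < τ := by positivity
  have hτF : M * ((F.card + 1) * (3 * τ)) = ε / 4 := by rw [hτ]; field_simp; norm_num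
  obtain ⟨r₀, hr₀, hstrip⟩ := hF τ hτ0 η hη0
  set P := M + M ^ 2 / η with hP
  have hP0 : 0 < P := by positivity
  set r := min (r₀ / 2) (ε / (12 * P)) with hr
  have hr0 : 0 < r := by positivity
  have hrr₀ : r ≤ r₀ / 2 := min_le_left _ _
  have hrP : P * (3 * r) ≤ ε / 4 := by
    calc P * (3 * r) ≤ P * (3 * (ε / (12 * P))) := by gcongr; exact min_le_right _ _
      _ = ε / 4 := by field_simp; norm_num
  refine ⟨r, hr0, ?_⟩
  filter_upwards [Ioo_mem_nhdsGT (show 0 < min (min τ r) 1 by positivity)] with h ⟨hh, hh'⟩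
  have hhτ : h < τ := hh'.trans_le ((min_le_left _ _).trans (min_le_left _ _))
  have hhr : h < r := hh'.trans_le ((min_le_left _ _).trans (min_le_right _ _))
  have hh1 : h < 1 := hh'.trans_le (min_le_right _ _)
  intro a b y ha hab har hbr hy hyR
  have har := abs_lt.1 har
  have hbr := abs_lt.1 hbr
  unfold numericalSolution
  simp only
  set k := ⌊a / h⌋₊ with hk
  set j := ⌊y / h⌋₊ with hj
  have hka : h * k ≤ a := mul_floor_le hh ha
  have hka' : a < h * k + h := lt_mul_floor_add hh
  have hjy : h * j ≤ y := mul_floor_le hh hy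
  obtain ⟨n, hn⟩ : ∃ n, ⌊b / h⌋₊ = k + n :=
    Nat.exists_eq_add_of_le (Nat.floor_mono (div_le_div_of_nonneg_right hab hh.le))
  have hnb : h * (k + n) ≤ b := by
    have := mul_floor_le hh (ha.trans hab)
    rw [hn] at this
    exact_mod_cast this
  rw [hn]
  set B : ℝ → ℝ := fun y => η * y + M * ∑ f ∈ F, ramp τ f y with hB
  have hBnn : 0 ≤ B 0 := by
    simp only [hB, mul_zero, zero_add]
    exact mul_nonneg hM0.le (Finset.sum_nonneg fun f _ => ramp_nonneg τ f 0)
  have hBle : B (h * j) ≤ ε / 4 + ε / 4 := by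
    have h1 : ∑ f ∈ F, ramp τ f (h * j) ≤ (F.card + 1) * (3 * τ) := by
      calc _ ≤ ∑ f ∈ F, 3 * τ := Finset.sum_le_sum fun f _ => ramp_le hτ0.le f _
        _ = F.card * (3 * τ) := by simp
        _ ≤ (F.card + 1) * (3 * τ) := by nlinarith
    have h2 := mul_le_mul_of_nonneg_left h1 hM0.le
    have h3 : η * (h * j) ≤ η * (R + 1) := mul_le_mul_of_nonneg_left (by linarith) hη0.le
    simp only [hB]
    linarith
  have hBstep : ∀ d ≤ n, ∀ i < j, h * (gridMean μ μs h (k + d) (i + 1) - gridMean μ μs h k (i + 1)) ≤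
      B (h * ((i + 1 : ℕ) : ℝ)) - B (h * i) := by
    intro d hd i hi
    have hyi : h * ((i + 1 : ℕ) : ℝ) ≤ y := by
      have : ((i + 1 : ℕ) : ℝ) ≤ j := by exact_mod_cast hi
      exact (mul_le_mul_of_nonneg_left this hh.le).trans hjy
    have hyi' : h * (i : ℝ) = h * ((i + 1 : ℕ) : ℝ) - h := by push_cast; ring
    have hyi0 : 0 ≤ h * ((i + 1 : ℕ) : ℝ) := by positivity
    rw [hyi']
    set t := h * ((i + 1 : ℕ) : ℝ) with ht
    have hramp : ∀ f ∈ F, 0 ≤ ramp τ f t - ramp τ f (t - h) := fun f _ =>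
      sub_nonneg.2 (ramp_mono τ f (by linarith))
    have hBeq : B t - B (t - h) = h * η + M * ∑ f ∈ F, (ramp τ f t - ramp τ f (t - h)) := by
      simp only [hB, Finset.sum_sub_distrib]; ring
    have hsum0 := Finset.sum_nonneg hramp
    rw [hBeq]
    rcases Nat.eq_zero_or_pos d with rfl | hd0
    · simp only [add_zero, sub_self, mul_zero]
      positivity
    -- `μs` only contributes to the weights on the axes
    have hdiff : gridMean μ μs h (k + d) (i + 1) - gridMean μ μs h k (i + 1) ≤
        μ (h * ((k + d : ℕ) : ℝ), t) - μ (h * k, t) := by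
      have h1 : axes.indicator μs (h * ((k + d : ℕ) : ℝ), h * ((i + 1 : ℕ) : ℝ)) = 0 := by
        refine indicator_of_notMem (fun hax => ?_) _
        have h2 : (0 : ℝ) < h * ((k + d : ℕ) : ℝ) := by positivity
        have h3 : (0 : ℝ) < h * ((i + 1 : ℕ) : ℝ) := by positivity
        rcases hax.2 with h4 | h4 <;> simp only at h4 <;> linarith
      have h2 : 0 ≤ axes.indicator μs (h * (k : ℝ), h * ((i + 1 : ℕ) : ℝ)) :=
        indicator_nonneg (fun x hx => hs.nonneg x hx) _
      unfold gridMean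
      rw [h1]
      linarith
    by_cases hfar : ∀ f ∈ F, τ ≤ |t - f|
    · have h1 : h * ((k + d : ℕ) : ℝ) ≤ b := by
        refine le_trans (mul_le_mul_of_nonneg_left ?_ hh.le) hnb
        exact_mod_cast Nat.add_le_add_left hd k
      have h2 : h * (k : ℝ) ≤ h * ((k + d : ℕ) : ℝ) := by
        refine mul_le_mul_of_nonneg_left ?_ hh.le
        exact_mod_cast Nat.le_add_right k d
      have h3 := hstrip (h * k) (h * ((k + d : ℕ) : ℝ)) t (by positivity) (by positivity)
        (abs_lt.2 ⟨by linarith, by linarith⟩) (abs_lt.2 ⟨by linarith, by linarith⟩) hyi0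
        (hyi.trans hyR) hfar
      have h4 := mul_le_mul_of_nonneg_left (hdiff.trans h3) hh.le
      have h5 := mul_nonneg hM0.le hsum0
      linarith
    · push Not at hfar
      obtain ⟨f, hf, hft⟩ := hfar
      have h1 : h ≤ ∑ f ∈ F, (ramp τ f t - ramp τ f (t - h)) := by
        exact (ramp_sub hh.le hhτ.le hft.le).ge.trans
          (Finset.single_le_sum (f := fun f => ramp τ f t - ramp τ f (t - h)) hramp hf)
      have h2 : gridMean μ μs h (k + d) (i + 1) - gridMean μ μs h k (i + 1) ≤ M := by
        linarith [(hM h hh (k + d) (i + 1)).2.1, (hM h hh k (i + 1)).1]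
      have h3 := mul_le_mul_of_nonneg_left h2 hh.le
      have h4 := mul_le_mul_of_nonneg_left h1 hM0.le
      have h5 : 0 ≤ h * η := by positivity
      linarith
  have key := gridSolution_add_le hh (fun i j => (hM h hh i j).1) (fun i j => (hM h hh i j).2.1)
    (fun i j => (hM h hh i j).2.2) (k := k) (n := n) (J := j) (b := fun i => B (h * i))
    (by simpa using hBnn) hBstep hη0 le_rfl le_rfl
  have h1 : η * h * (j + 1) ≤ ε / 4 := by
    rw [← hηR, mul_assoc]
    exact mul_le_mul_of_nonneg_left (by linarith) hη0.le
  have h2 : (M + M ^ 2 / η) * h * n ≤ ε / 4 := by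
    refine le_trans ?_ hrP
    rw [mul_assoc]
    exact mul_le_mul_of_nonneg_left (by linarith) hP0.le
  linarith

theorem numericalSolution_asympEquicontAt (hA : Admissible μ σ) (hs : F2 μs) {x : ℝ × ℝ}
    (hx : x ∈ quadrant) :
    AsympEquicontAt (𝓝[>] (0 : ℝ)) (fun h => numericalSolution μ σ μs h) quadrant x := by
  intro ε hε
  obtain ⟨r₁, hr₁, h₁⟩ := numericalSolution_fst_le_add hA hs hx.1 (R := x.2 + 1)
    (by linarith [hx.2]) (half_pos hε)
  obtain ⟨r₂, hr₂, h₂⟩ := numericalSolution_fst_le_add hA.swap hs.swap hx.2 (R := x.1 + 1)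
    (by linarith [hx.1]) (half_pos hε)
  refine ⟨min (min r₁ r₂) 1, by positivity, ?_⟩
  filter_upwards [h₁, h₂, self_mem_nhdsWithin] with h h1 h2 hh z hz w hw
  have hzr := hz.2
  have hwr := hw.2
  rw [Metric.mem_ball, Prod.dist_eq, max_lt_iff, lt_min_iff, lt_min_iff, lt_min_iff, lt_min_iff,
    Real.dist_eq, Real.dist_eq] at hzr hwr
  obtain ⟨⟨⟨hz1, hz2⟩, hz3⟩, ⟨hz4, hz5⟩, hz6⟩ := hzr
  obtain ⟨⟨⟨hw1, hw2⟩, hw3⟩, ⟨hw4, hw5⟩, hw6⟩ := hwr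
  have hw3 := abs_lt.1 hw3
  have hz6 := abs_lt.1 hz6
  have hw6 := abs_lt.1 hw6
  have hmono := numericalSolution_monotone (σ := σ) hA hs hh
  -- from `w` first to the right and then upwards
  have e1 : numericalSolution μ σ μs h (max w.1 z.1, w.2) ≤
      numericalSolution μ σ μs h (w.1, w.2) + ε / 2 :=
    h1 w.1 (max w.1 z.1) w.2 hw.1.1 (le_max_left _ _) hw1
      (by rcases max_choice w.1 z.1 with e | e <;> rw [e] <;> assumption) hw.1.2 (by linarith)
  rcases le_total z.2 w.2 with hle | hle
  · have e3 := hmono (show z ≤ (max w.1 z.1, w.2) from ⟨le_max_right _ _, hle⟩)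
    linarith
  · rcases le_total z.1 w.1 with hle' | hle'
    · have e2 := h2 w.2 z.2 w.1 hw.1.2 hle hw5 hz5 hw.1.1 (by linarith)
      rw [numericalSolution_swap, numericalSolution_swap] at e2
      have e3 := hmono (show z ≤ (w.1, z.2) from ⟨hle', le_rfl⟩)
      simp only [Prod.swap_prod_mk, Prod.mk.eta] at e2
      linarith
    · have hz3 := abs_lt.1 hz3
      have e2 := h2 w.2 z.2 z.1 hw.1.2 hle hw5 hz5 hz.1.1 (by linarith)
      rw [numericalSolution_swap, numericalSolution_swap] at e2
      simp only [Prod.swap_prod_mk, Prod.mk.eta] at e1 e2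
      rw [max_eq_right hle'] at e1
      linarith

/-! ### Convergence on the axes -/

theorem tendsto_mul_floor {t : ℝ} (ht : 0 ≤ t) :
    Tendsto (fun h : ℝ => h * (⌊t / h⌋₊ : ℝ)) (𝓝[>] 0) (𝓝[Ici 0] t) := by
  rw [tendsto_nhdsWithin_iff]
  constructor
  · have h1 : Tendsto (fun h : ℝ => t - h) (𝓝[>] 0) (𝓝 t) := by
      simpa using ((by fun_prop : Continuous fun h : ℝ => t - h).tendsto 0).mono_left
        nhdsWithin_le_nhds
    refine tendsto_of_tendsto_of_tendsto_of_le_of_le' h1 tendsto_const_nhds ?_ ?_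
    · filter_upwards [self_mem_nhdsWithin] with h hh
      linarith [lt_mul_floor_add (t := t) (show 0 < h from hh)]
    · filter_upwards [self_mem_nhdsWithin] with h hh
      exact mul_floor_le hh ht
  · filter_upwards [self_mem_nhdsWithin] with h hh
    exact mul_nonneg (show 0 < h from hh).le (Nat.cast_nonneg _)

/-- Left Riemann sums converge for bounded functions with finitely many discontinuities. -/
theorem tendsto_sum_mul_integral {g : ℝ → ℝ} {M X : ℝ} (hX : 0 ≤ X) (hg : ∀ t, 0 ≤ t → |g t| ≤ M)
    (hfin : {t ∈ Icc 0 X | ¬ ContinuousWithinAt g (Ici 0) t}.Finite) :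
    Tendsto (fun h : ℝ => ∑ k ∈ Finset.range (⌊X / h⌋₊ + 1), h * g (h * k)) (𝓝[>] 0)
      (𝓝 (∫ t in (0 : ℝ)..X, g t)) := by
  set G : ℝ → ℝ → ℝ := fun h t => g (h * (⌊t / h⌋₊ : ℝ)) with hG
  have hmeas : ∀ h, Measurable (G h) := fun h =>
    (measurable_from_nat (f := fun n : ℕ => g (h * n))).comp
      (Nat.measurable_floor.comp (measurable_id.div_const h))
  have hGM : ∀ h > 0, ∀ t, ‖G h t‖ ≤ M := fun h hh t => hg _ (by positivity)
  have hint : ∀ h > 0, ∀ a b, IntervalIntegrable (G h) MeasureTheory.volume a b := by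
    intro h hh a b
    refine (intervalIntegrable_const (c := M)).mono_fun' (hmeas h).aestronglyMeasurable ?_
    exact Eventually.of_forall fun t => hGM h hh t
  have hmain : Tendsto (fun h => ∫ t in (0 : ℝ)..X, G h t) (𝓝[>] 0)
      (𝓝 (∫ t in (0 : ℝ)..X, g t)) := by
    refine intervalIntegral.tendsto_integral_filter_of_dominated_convergence (fun _ => M)
      (Eventually.of_forall fun h => (hmeas h).aestronglyMeasurable) ?_
      intervalIntegrable_const ?_
    · filter_upwards [self_mem_nhdsWithin] with h hh
      exact Eventually.of_forall fun t _ => hGM h hh t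
    · have hnull := hfin.measure_zero MeasureTheory.volume
      filter_upwards [MeasureTheory.compl_mem_ae_iff.2 hnull] with t ht htX
      rw [uIoc_of_le hX] at htX
      have hc : ContinuousWithinAt g (Ici 0) t := by
        by_contra hc
        exact ht ⟨⟨htX.1.le, htX.2⟩, hc⟩
      exact Tendsto.comp hc (tendsto_mul_floor htX.1.le)
  have hsum : ∀ h > 0, ∑ k ∈ Finset.range (⌊X / h⌋₊ + 1), h * g (h * k) =
      (∫ t in (0 : ℝ)..X, G h t) + ∫ t in X..(h * (⌊X / h⌋₊ + 1 : ℕ)), G h t := by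
    intro h hh
    rw [intervalIntegral.integral_add_adjacent_intervals (hint h hh _ _) (hint h hh _ _)]
    have h1 := intervalIntegral.sum_integral_adjacent_intervals (f := G h)
      (μ := MeasureTheory.volume) (a := fun k : ℕ => h * (k : ℝ)) (n := ⌊X / h⌋₊ + 1)
      (fun k _ => hint h hh _ _)
    simp only [Nat.cast_zero, mul_zero] at h1
    rw [← h1]
    refine Finset.sum_congr rfl fun k _ => ?_
    have h2 : EqOn (G h) (fun _ => g (h * k)) (Ioo (h * (k : ℝ)) (h * ((k + 1 : ℕ) : ℝ))) := by
      intro t ht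
      have h3 : ⌊t / h⌋₊ = k := by
        rw [Nat.floor_eq_iff (div_nonneg ((by positivity : 0 ≤ h * (k : ℝ)).trans ht.1.le) hh.le),
          le_div_iff₀ hh, div_lt_iff₀ hh]
        have h4 := ht.2
        push_cast at h4
        constructor <;> linarith [ht.1]
      simp only [hG, h3]
    rw [intervalIntegral.integral_congr_Ioo_of_le (by gcongr; omega) h2,
      intervalIntegral.integral_const, smul_eq_mul]
    push_cast
    ring
  have hrest : Tendsto (fun h => ∫ t in X..(h * (⌊X / h⌋₊ + 1 : ℕ)), G h t) (𝓝[>] (0 : ℝ))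
      (𝓝 0) := by
    have h1 : Tendsto (fun h : ℝ => M * h) (𝓝[>] 0) (𝓝 0) := by
      simpa using ((by fun_prop : Continuous fun h : ℝ => M * h).tendsto 0).mono_left
        nhdsWithin_le_nhds
    refine squeeze_zero_norm' ?_ h1
    filter_upwards [self_mem_nhdsWithin] with h hh
    have hh : 0 < h := hh
    refine (intervalIntegral.norm_integral_le_of_norm_le_const fun t _ => hGM h hh t).trans ?_
    have hM : 0 ≤ M := (abs_nonneg _).trans (hg 0 le_rfl)
    refine mul_le_mul_of_nonneg_left (abs_le.2 ?_) hM
    push_cast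
    constructor <;> linarith [mul_floor_le hh hX, lt_mul_floor_add (t := X) hh]
  have := hmain.add hrest
  rw [add_zero] at this
  refine this.congr' ?_
  filter_upwards [self_mem_nhdsWithin] with h hh
  exact (hsum h hh).symm

theorem mem_axes_fst {t : ℝ} (ht : 0 ≤ t) : ((t, 0) : ℝ × ℝ) ∈ axes := ⟨⟨ht, le_rfl⟩, Or.inr rfl⟩

theorem boundaryData_fst {X : ℝ} (hX : 0 ≤ X) :
    boundaryData μ μs (X, 0) = ∫ t in (0 : ℝ)..X, (μ (t, 0) + axes.indicator μs (t, 0)) := by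
  have h1 := intervalIntegral.mul_integral_comp_mul_right (a := 0) (b := 1)
    (f := fun t => μ (t, 0) + axes.indicator μs (t, 0)) (c := X)
  rw [zero_mul, one_mul] at h1
  rw [← h1]
  unfold boundaryData
  simp only [add_zero]
  congr 1
  refine intervalIntegral.integral_congr fun t ht => ?_
  rw [uIcc_of_le zero_le_one] at ht
  have h2 : t • ((X, 0) : ℝ × ℝ) = (t * X, 0) := by simp
  simp only [h2]
  rw [indicator_of_mem (mem_axes_fst (mul_nonneg ht.1 hX))]

theorem F2.finite_discontinuities (hs : F2 μs) {K : Set (ℝ × ℝ)} (hK : IsCompact K) :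
    ({y ∈ axes | ¬ ContinuousWithinAt μs axes y} ∩ K).Finite := by
  refine hK.induction_on (p := fun K => ({y ∈ axes | ¬ ContinuousWithinAt μs axes y} ∩ K).Finite)
    (by simp) (fun s t hst ht => ht.subset (inter_subset_inter_right _ hst))
    (fun s t h1 h2 => by rw [inter_union_distrib_left]; exact h1.union h2) fun x _ => ?_
  obtain ⟨V, hV, hfin⟩ := hs.discontinuities x
  exact ⟨V, mem_nhdsWithin_of_mem_nhds hV, hfin⟩

/-- On the axis the scheme is, up to a small error, a Riemann sum of the boundary data; `σ` does not
matter there, because the neighbours outside the grid have the value `0`. -/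
theorem numericalSolution_tendsto_fst (hA : Admissible μ σ) (hs : F2 μs) {X : ℝ} (hX : 0 ≤ X) :
    Tendsto (fun h => numericalSolution μ σ μs h (X, 0)) (𝓝[>] 0)
      (𝓝 (boundaryData μ μs (X, 0))) := by
  obtain ⟨M, hM0, -, hM⟩ := hA.exists_grid_bound hs
  set g : ℝ → ℝ := fun t => μ (t, 0) + axes.indicator μs (t, 0) with hg
  have hgM : ∀ t, 0 ≤ t → |g t| ≤ M := by
    intro t ht
    rcases ht.eq_or_lt with rfl | ht
    · have := hM 1 one_pos 0 0
      simp only [gridMean, Nat.cast_zero, mul_zero] at this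
      exact abs_le.2 ⟨by linarith [this.1], this.2.1⟩
    · have := hM t ht 1 0
      simp only [gridMean, Nat.cast_zero, mul_zero, Nat.cast_one, mul_one] at this
      exact abs_le.2 ⟨by linarith [this.1], this.2.1⟩
  have hfin : {t ∈ Icc 0 X | ¬ ContinuousWithinAt g (Ici 0) t}.Finite := by
    obtain ⟨E, -, hE, -, hEfin⟩ := hA.exists_discontinuities
    have hcomp : IsCompact ((fun t : ℝ => ((t, 0) : ℝ × ℝ)) '' Icc 0 X) :=
      isCompact_Icc.image (by fun_prop)
    have h1 := (hs.finite_discontinuities hcomp).image Prod.fst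
    refine ((hEfin 0 X).union h1).subset ?_
    rintro t ⟨ht, hc⟩
    by_contra hcon
    simp only [mem_union, not_or] at hcon
    have hemb : Tendsto (fun t : ℝ => ((t, 0) : ℝ × ℝ)) (𝓝[Ici 0] t) (𝓝[axes] (t, 0)) :=
      ((by fun_prop : Continuous fun t : ℝ => ((t, 0) : ℝ × ℝ)).continuousWithinAt).tendsto_nhdsWithin
        fun s hs => mem_axes_fst hs
    have h2 : (t, (0 : ℝ)) ∉ E := fun h => hcon.1 ⟨ht, h, le_rfl⟩
    have h3 : ContinuousWithinAt μs axes (t, 0) := by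
      by_contra h
      exact hcon.2 ⟨(t, 0), ⟨⟨mem_axes_fst ht.1, h⟩, t, ht, rfl⟩, rfl⟩
    have h4 := (hE (t, 0) ⟨ht.1, le_rfl⟩ h2).1.mono (fun x hx => hx.1 : axes ⊆ quadrant)
    have h5 : ContinuousWithinAt (fun x => μ x + axes.indicator μs x) axes (t, 0) :=
      h4.add (h3.congr (fun x hx => indicator_of_mem hx _) (indicator_of_mem (mem_axes_fst ht.1) _))
    exact hc (Tendsto.comp h5 hemb)
  have hsum := tendsto_sum_mul_integral hX hgM hfin
  rw [boundaryData_fst hX]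
  rw [Metric.tendsto_nhds] at hsum ⊢
  intro ε hε
  have hc : 0 < ε / 3 := by positivity
  have hP : 0 ≤ M ^ 2 / (ε / 3) * X := by positivity
  have hsmall : ∀ᶠ h : ℝ in 𝓝[>] 0, h * M < ε / 3 ∧ h * (M ^ 2 / (ε / 3) * X) < ε / 3 := by
    have h1 : ∀ c : ℝ, ∀ᶠ h : ℝ in 𝓝[>] 0, h * c < ε / 3 := by
      intro c
      have : Tendsto (fun h : ℝ => h * c) (𝓝[>] 0) (𝓝 0) := by
        simpa using ((by fun_prop : Continuous fun h : ℝ => h * c).tendsto 0).mono_left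
          nhdsWithin_le_nhds
      exact this.eventually (gt_mem_nhds hc)
    exact (h1 _).and (h1 _)
  filter_upwards [hsum (ε / 3) hc, hsmall, self_mem_nhdsWithin] with h h1 h2 hh
  have hh : 0 < h := hh
  have hgrid : ∀ k : ℕ, gridMean μ μs h k 0 = g (h * k) := fun k => by
    simp [gridMean, hg]
  have h3 := sum_le_gridSolution_zero (h := h) (m := gridMean μ μs h)
    (s := fun i j => σ (h * i, h * j)) ⌊X / h⌋₊
  have h4 := gridSolution_zero_le (M := M) hh (fun i j => (hM h hh i j).1)
    (fun i j => (hM h hh i j).2.2) hc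
    (pow_le_pow_left₀ (by positivity) h2.1.le 2) ⌊X / h⌋₊
  simp only [hgrid] at h3 h4
  have h5 : h * (M ^ 2 / (ε / 3)) * (h * ⌊X / h⌋₊) ≤ h * (M ^ 2 / (ε / 3) * X) := by
    rw [mul_assoc]
    gcongr
    exact mul_floor_le hh hX
  rw [Real.dist_eq, abs_lt] at h1 ⊢
  have h6 : numericalSolution μ σ μs h (X, 0) = gridSolution h (gridMean μ μs h)
      (fun i j => σ (h * i, h * j)) ⌊X / h⌋₊ 0 := by
    simp [numericalSolution]
  rw [h6]
  constructor <;> linarith [h1.1, h1.2, h2.2]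

theorem boundaryData_swap (x : ℝ × ℝ) :
    boundaryData (fun x => μ x.swap) (fun x => μs x.swap) x = boundaryData μ μs x.swap := by
  unfold boundaryData
  rw [Prod.fst_swap, Prod.snd_swap, add_comm]
  rfl

theorem numericalSolution_tendsto_axes (hA : Admissible μ σ) (hs : F2 μs) {x : ℝ × ℝ}
    (hx : x ∈ axes) :
    Tendsto (fun h => numericalSolution μ σ μs h x) (𝓝[>] 0) (𝓝 (boundaryData μ μs x)) := by
  obtain ⟨x₁, x₂⟩ := x
  rcases hx.2 with h0 | h0
  · obtain rfl : x₁ = 0 := h0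
    have := numericalSolution_tendsto_fst hA.swap hs.swap hx.1.2
    simpa only [numericalSolution_swap, boundaryData_swap, Prod.swap_prod_mk] using this
  · obtain rfl : x₂ = 0 := h0
    exact numericalSolution_tendsto_fst hA hs hx.1.1

/-! ### Limits of the scheme are viscosity solutions -/

theorem eventually_forall_mem_compact {ι : Type*} {l : Filter ι} {P : ι → ℝ × ℝ → Prop}
    {Q K : Set (ℝ × ℝ)} (hK : IsCompact K) (hKQ : K ⊆ Q)
    (h : ∀ x ∈ Q, ∃ r > 0, ∀ᶠ i in l, ∀ z ∈ Q ∩ Metric.ball x r, P i z) :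
    ∀ᶠ i in l, ∀ z ∈ K, P i z := by
  refine hK.induction_on (p := fun K => ∀ᶠ i in l, ∀ z ∈ K, P i z) (by simp)
    (fun s t hst ht => ht.mono fun i hi z hz => hi z (hst hz))
    (fun s t h1 h2 => by
      filter_upwards [h1, h2] with i hs ht z hz using hz.elim (hs z) (ht z)) fun x hx => ?_
  obtain ⟨r, hr, hi⟩ := h x (hKQ hx)
  exact ⟨K ∩ Metric.ball x r, inter_mem self_mem_nhdsWithin
    (mem_nhdsWithin_of_mem_nhds (Metric.ball_mem_nhds x hr)),
    hi.mono fun i hi z hz => hi z ⟨hKQ hz.1, hz.2⟩⟩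

/-- Let piecewise constant functions `F h` have the upper relaxed limit `w`. For a supergradient `p`
of `w` at `x` there are grid points close to `x` at which the backward differences of `F h` are
almost as large as `p` predicts: `F h` minus a cone with slopes close to `p` attains its maximum over
the grid at such a point. -/
theorem frequently_backward_difference {F : ℝ → ℝ × ℝ → ℝ} {w : ℝ × ℝ → ℝ} {x p : ℝ × ℝ}
    (hx : x ∈ openQuadrant)
    (hF : ∀ h > 0, ∀ y ∈ quadrant, F h (h * ⌊y.1 / h⌋₊, h * ⌊y.2 / h⌋₊) = F h y)
    (hup : ∀ K ⊆ quadrant, IsCompact K → ∀ τ > 0, ∀ᶠ h in 𝓝[>] 0, ∀ z ∈ K, F h z ≤ w z + τ)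
    (hfreq : ∀ τ > 0, ∃ᶠ h in 𝓝[>] 0, w x - τ < F h x)
    (hp : p ∈ superdifferential openQuadrant w x) {ε ρ : ℝ} (hε : 0 < ε) (hρ : 0 < ρ) :
    ∃ᶠ h in 𝓝[>] 0, 0 < h ∧ ∃ i j : ℕ,
      (h * ((i + 1 : ℕ) : ℝ), h * ((j + 1 : ℕ) : ℝ)) ∈ Metric.ball x ρ ∧
      F h (h * (i : ℝ), h * ((j + 1 : ℕ) : ℝ)) + h * (p.1 - ε) ≤
        F h (h * ((i + 1 : ℕ) : ℝ), h * ((j + 1 : ℕ) : ℝ)) ∧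
      F h (h * ((i + 1 : ℕ) : ℝ), h * (j : ℝ)) + h * (p.2 - ε) ≤
        F h (h * ((i + 1 : ℕ) : ℝ), h * ((j + 1 : ℕ) : ℝ)) := by
  have hp' := hp (ε / 2) (half_pos hε)
  rw [isOpen_openQuadrant.nhdsWithin_eq hx] at hp'
  obtain ⟨r₀, hr₀, hball⟩ := Metric.nhds_basis_closedBall.eventually_iff.1
    (hp'.and (isOpen_openQuadrant.mem_nhds hx))
  set r := min r₀ ρ with hr
  have hr0 : 0 < r := lt_min hr₀ hρ
  set K := Metric.closedBall x r with hK
  have hKball := fun {y} (hy : y ∈ K) =>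
    hball (Metric.closedBall_subset_closedBall (min_le_left r₀ ρ) hy)
  have hKq : K ⊆ quadrant := fun y hy => openQuadrant_subset_quadrant (hKball hy).2
  set T : ℝ × ℝ → ℝ := fun y => p.1 * (y.1 - x.1) + p.2 * (y.2 - x.2) +
    ε * (|y.1 - x.1| + |y.2 - x.2|) with hT
  -- `h * L` bounds the cone `T` at the grid point `⌊x / h⌋`, which has the same value of `F h` as `x`
  set L := |p.1| + |p.2| + 2 * ε with hL
  have hL0 : 0 < L := by positivity
  set τ := ε * r / 16 with hτ
  have hτ0 : 0 < τ := by positivity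
  have hh0 : 0 < min (r / 2) (τ / L) := by positivity
  have hev := (hup K hKq (isCompact_closedBall x r) τ hτ0).and (Ioo_mem_nhdsGT hh0)
  refine ((hfreq τ hτ0).and_eventually hev).mono ?_
  rintro h ⟨hfx, hle, hh, hh'⟩
  have hhr : h < r / 2 := hh'.trans_le (min_le_left _ _)
  have hhL : h * L < τ := by
    rw [← lt_div_iff₀ hL0]
    exact hh'.trans_le (min_le_right _ _)
  set g : ℕ × ℕ → ℝ × ℝ := fun a => (h * a.1, h * a.2) with hg
  set A : Set (ℕ × ℕ) := {a | g a ∈ K} with hA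
  have hKmem : ∀ y : ℝ × ℝ, y ∈ K ↔ |y.1 - x.1| ≤ r ∧ |y.2 - x.2| ≤ r := fun y => by
    rw [hK, Metric.mem_closedBall, Prod.dist_eq, max_le_iff, Real.dist_eq, Real.dist_eq]
  have hfin : A.Finite := by
    have hb : ∀ (n : ℕ) (c : ℝ), |h * (n : ℝ) - c| ≤ r → n ≤ ⌊(c + r) / h⌋₊ := by
      intro n c hn
      refine Nat.le_floor ?_
      rw [le_div_iff₀ hh]
      linarith [(abs_le.1 hn).2]
    refine ((finite_Iic ⌊(x.1 + r) / h⌋₊).prod (finite_Iic ⌊(x.2 + r) / h⌋₊)).subset ?_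
    intro a ha
    have := (hKmem _).1 ha
    exact ⟨hb _ _ this.1, hb _ _ this.2⟩
  -- the grid point next to `x`
  set a₀ : ℕ × ℕ := (⌊x.1 / h⌋₊, ⌊x.2 / h⌋₊) with ha₀
  have hfloor : ∀ t : ℝ, 0 ≤ t → |h * (⌊t / h⌋₊ : ℝ) - t| ≤ h := fun t ht => by
    rw [abs_le]
    constructor <;> linarith [mul_floor_le hh ht, lt_mul_floor_add (t := t) hh]
  have hf1 := hfloor x.1 hx.1.le
  have hf2 := hfloor x.2 hx.2.le
  have ha₀A : a₀ ∈ A := (hKmem _).2 ⟨hf1.trans (by linarith), hf2.trans (by linarith)⟩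
  obtain ⟨⟨i, j⟩, haA, hmax⟩ := exists_max_image A (fun a => F h (g a) - T (g a)) hfin ⟨a₀, ha₀A⟩
  have haK : g (i, j) ∈ K := haA
  have h1 := hmax a₀ ha₀A
  have h2 : F h (g a₀) = F h x := hF h hh x (openQuadrant_subset_quadrant hx)
  have h3 : T (g a₀) ≤ h * L := by
    have e1 : p.1 * (h * (⌊x.1 / h⌋₊ : ℝ) - x.1) ≤ |p.1| * h :=
      (le_abs_self _).trans (by rw [abs_mul]; gcongr)
    have e2 : p.2 * (h * (⌊x.2 / h⌋₊ : ℝ) - x.2) ≤ |p.2| * h :=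
      (le_abs_self _).trans (by rw [abs_mul]; gcongr)
    have e3 : ε * (|h * (⌊x.1 / h⌋₊ : ℝ) - x.1| + |h * (⌊x.2 / h⌋₊ : ℝ) - x.2|) ≤ ε * (h + h) := by
      gcongr
    simp only [hT, hg, ha₀, hL]
    linarith
  have h4 := hle _ haK
  have h5 := (hKball haK).1
  have hnorm : ‖g (i, j) - x‖ ≤ |(g (i, j)).1 - x.1| + |(g (i, j)).2 - x.2| := by
    rw [Prod.norm_def]
    exact max_le (le_add_of_nonneg_right (abs_nonneg _)) (le_add_of_nonneg_left (abs_nonneg _))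
  have hnorm' := mul_le_mul_of_nonneg_left hnorm hε.le
  have h6 : ‖g (i, j) - x‖ < r / 2 := by
    have : ε / 2 * ‖g (i, j) - x‖ < ε / 2 * (r / 2) := by
      simp only [hT] at h1
      linarith
    exact lt_of_mul_lt_mul_left this (by positivity)
  obtain ⟨h7, h8⟩ := norm_lt_iff_fst_snd.1 h6
  simp only [hg, Prod.fst_sub, Prod.snd_sub] at h7 h8
  have hpos := (hKball haK).2
  obtain ⟨i, rfl⟩ : ∃ i', i = i' + 1 := Nat.exists_eq_succ_of_ne_zero (by
    rintro rfl
    have : (0 : ℝ) < h * ((0 : ℕ) : ℝ) := hpos.1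
    simp at this)
  obtain ⟨j, rfl⟩ : ∃ j', j = j' + 1 := Nat.exists_eq_succ_of_ne_zero (by
    rintro rfl
    have : (0 : ℝ) < h * ((0 : ℕ) : ℝ) := hpos.2
    simp at this)
  have hcast : ∀ n : ℕ, h * ((n + 1 : ℕ) : ℝ) = h * n + h := fun n => by push_cast; ring
  have habs : ∀ n : ℕ, ∀ c : ℝ, |h * (n : ℝ) - c| ≤ |h * ((n + 1 : ℕ) : ℝ) - c| + h := by
    intro n c
    rw [hcast, show h * (n : ℝ) - c = (h * n + h - c) - h by ring]
    exact (abs_sub _ _).trans (by rw [abs_of_pos hh])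
  refine ⟨hh, i, j, ?_, ?_, ?_⟩
  · rw [mem_ball_iff_norm]
    exact h6.trans_le (by linarith [min_le_right r₀ ρ])
  · have h9 := hmax (i, j + 1) ((hKmem _).2 ⟨(habs i x.1).trans (by linarith),
      by simp only [hg]; linarith⟩)
    have h10 := mul_le_mul_of_nonneg_left (habs i x.1) hε.le
    have h11 := hcast i
    simp only [hT, hg] at h9
    have h12 : p.1 * (h * ((i + 1 : ℕ) : ℝ) - x.1) = p.1 * (h * i - x.1) + h * p.1 := by
      rw [hcast]; ring
    linarith
  · have h9 := hmax (i + 1, j) ((hKmem _).2 ⟨by simp only [hg]; linarith,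
      (habs j x.2).trans (by linarith)⟩)
    have h10 := mul_le_mul_of_nonneg_left (habs j x.2) hε.le
    simp only [hT, hg] at h9
    have h12 : p.2 * (h * ((j + 1 : ℕ) : ℝ) - x.2) = p.2 * (h * j - x.2) + h * p.2 := by
      rw [hcast]; ring
    linarith

theorem numericalSolution_grid {h : ℝ} (hh : 0 < h) (i j : ℕ) :
    numericalSolution μ σ μs h (h * i, h * j) =
      gridSolution h (gridMean μ μs h) (fun i j => σ (h * i, h * j)) i j := by
  simp [numericalSolution, mul_div_cancel_left₀ _ hh.ne']

theorem numericalSolution_floor {h : ℝ} (hh : 0 < h) (y : ℝ × ℝ) :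
    numericalSolution μ σ μs h (h * ⌊y.1 / h⌋₊, h * ⌊y.2 / h⌋₊) = numericalSolution μ σ μs h y := by
  rw [numericalSolution_grid hh]
  rfl

theorem gridMean_succ_succ {h : ℝ} (hh : 0 < h) (i j : ℕ) :
    gridMean μ μs h (i + 1) (j + 1) = μ (h * ((i + 1 : ℕ) : ℝ), h * ((j + 1 : ℕ) : ℝ)) := by
  have : axes.indicator μs (h * ((i + 1 : ℕ) : ℝ), h * ((j + 1 : ℕ) : ℝ)) = 0 := by
    refine indicator_of_notMem (fun hax => ?_) _
    have h2 : (0 : ℝ) < h * ((i + 1 : ℕ) : ℝ) := by positivity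
    have h3 : (0 : ℝ) < h * ((j + 1 : ℕ) : ℝ) := by positivity
    rcases hax.2 with h4 | h4 <;> simp only at h4 <;> linarith
  rw [gridMean, this, add_zero]

theorem numericalSolution_succ_succ {h : ℝ} (hh : 0 < h) (i j : ℕ) :
    numericalSolution μ σ μs h (h * ((i + 1 : ℕ) : ℝ), h * ((j + 1 : ℕ) : ℝ)) =
      update h (μ (h * ((i + 1 : ℕ) : ℝ), h * ((j + 1 : ℕ) : ℝ)))
        (σ (h * ((i + 1 : ℕ) : ℝ), h * ((j + 1 : ℕ) : ℝ)))
        (numericalSolution μ σ μs h (h * (i : ℝ), h * ((j + 1 : ℕ) : ℝ)))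
        (numericalSolution μ σ μs h (h * ((i + 1 : ℕ) : ℝ), h * (j : ℝ))) := by
  rw [numericalSolution_grid hh, numericalSolution_grid hh, numericalSolution_grid hh,
    gridSolution_eq, gridMean_succ_succ hh]
  simp

/-- The upper limit of the numerical solutions as `h → 0`. -/
noncomputable def upperLimit (μ σ μs : ℝ × ℝ → ℝ) (x : ℝ × ℝ) : ℝ :=
  limsup (fun h => numericalSolution μ σ μs h x) (𝓝[>] 0)

/-- The lower limit of the numerical solutions as `h → 0`. -/
noncomputable def lowerLimit (μ σ μs : ℝ × ℝ → ℝ) (x : ℝ × ℝ) : ℝ :=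
  liminf (fun h => numericalSolution μ σ μs h x) (𝓝[>] 0)

theorem continuousOn_upperLimit (hA : Admissible μ σ) (hs : F2 μs) :
    ContinuousOn (upperLimit μ σ μs) quadrant := fun _ hx =>
  continuousWithinAt_of_le_add hx fun _ hε =>
    (numericalSolution_asympEquicontAt hA hs hx).limsup
      (fun _ hz => numericalSolution_bounded hA hs hz) hε

theorem continuousOn_lowerLimit (hA : Admissible μ σ) (hs : F2 μs) :
    ContinuousOn (lowerLimit μ σ μs) quadrant := fun _ hx =>
  continuousWithinAt_of_le_add hx fun _ hε =>
    (numericalSolution_asympEquicontAt hA hs hx).liminf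
      (fun _ hz => numericalSolution_bounded hA hs hz) hε

theorem monotoneOn_upperLimit (hA : Admissible μ σ) (hs : F2 μs) :
    MonotoneOn (upperLimit μ σ μs) quadrant := fun _ hx _ hy hxy => by
  have := limsup_le_limsup_add (fun _ hz => numericalSolution_bounded hA hs hz) hx hy (ε := 0)
    (eventually_mem_nhdsWithin.mono fun h hh => by
      simpa using numericalSolution_monotone (σ := σ) hA hs hh hxy)
  simpa [upperLimit] using this

theorem monotoneOn_lowerLimit (hA : Admissible μ σ) (hs : F2 μs) :
    MonotoneOn (lowerLimit μ σ μs) quadrant := fun _ hx _ hy hxy => by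
  have := liminf_le_liminf_add (fun _ hz => numericalSolution_bounded hA hs hz) hx hy (ε := 0)
    (eventually_mem_nhdsWithin.mono fun h hh => by
      simpa using numericalSolution_monotone (σ := σ) hA hs hh hxy)
  simpa [lowerLimit] using this

theorem upperLimit_subsolution (hA : Admissible μ σ) (hs : F2 μs) :
    IsViscositySubsolution (hamiltonian μ σ) openQuadrant (upperLimit μ σ μs) := by
  refine ⟨((continuousOn_upperLimit hA hs).mono
    openQuadrant_subset_quadrant).upperSemicontinuousOn, fun x hx p hp => ?_⟩
  have hq := openQuadrant_subset_quadrant hx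
  obtain ⟨N, hN⟩ := hA.exists_sq_bound
  suffices hamiltonian μ σ x p ≤ 0 by
    refine (liminf_le_of_frequently_le ?_ ?_ : liminf _ _ ≤ hamiltonian μ σ x p).trans this
    · exact fun h => h.self_of_nhdsWithin hx le_rfl
    · refine isBoundedUnder_of_eventually_ge (a := -N) ?_
      filter_upwards [self_mem_nhdsWithin] with y hy
      exact neg_le_hamiltonian hN (openQuadrant_subset_quadrant hy) p
  by_contra! hpos
  obtain ⟨η, hη1, hη⟩ := (((tendsto_posPart_mul p (μ x) (σ x ^ 2)).eventually
    (lt_mem_nhds hpos)).and self_mem_nhdsWithin).exists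
  have hη : 0 < η := hη
  obtain ⟨ρ, hρ, hball⟩ := Metric.mem_nhdsWithin_iff.1
    ((hA.usc.1 x hq (μ x + η / 2) (by linarith)).and
      (hA.usc.2 x hq (σ x ^ 2 + η) (by linarith)))
  have hbd := fun z (hz : z ∈ quadrant) => numericalSolution_bounded (σ := σ) hA hs hz
  obtain ⟨h, hh, i, j, hg, h1, h2⟩ := (frequently_backward_difference hx
    (F := fun h => numericalSolution μ σ μs h) (w := upperLimit μ σ μs)
    (fun h hh y _ => numericalSolution_floor hh y)
    (fun K hK hKc τ hτ => eventually_forall_mem_compact hKc hK fun z hz =>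
      (numericalSolution_asympEquicontAt hA hs hz).eventually_le_limsup_add hbd hz hτ)
    (fun τ hτ => frequently_limsup_sub_lt hbd hq hτ) hp (half_pos hη) hρ).exists
  simp only [numericalSolution_succ_succ hh i j] at h1 h2
  have h3 := posPart_mul_le_of_le_update hh (le_sub_iff_add_le'.2 h1) (le_sub_iff_add_le'.2 h2)
  obtain ⟨h4, h4'⟩ : μ (h * ((i + 1 : ℕ) : ℝ), h * ((j + 1 : ℕ) : ℝ)) < μ x + η / 2 ∧
      σ (h * ((i + 1 : ℕ) : ℝ), h * ((j + 1 : ℕ) : ℝ)) ^ 2 < σ x ^ 2 + η :=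
    hball ⟨hg, grid_mem_quadrant hh _ _⟩
  have h5 := (mul_le_mul
    (max_le_max (by linarith : p.1 - (μ x + η) ≤ _) (le_refl (0 : ℝ)))
    (max_le_max (by linarith : p.2 - (μ x + η) ≤ _) (le_refl (0 : ℝ)))
    (le_max_right _ _) (le_max_right _ _)).trans h3
  linarith

theorem lowerLimit_supersolution (hA : Admissible μ σ) (hs : F2 μs) :
    IsViscositySupersolution (hamiltonian μ σ) openQuadrant (lowerLimit μ σ μs) := by
  refine ⟨((continuousOn_lowerLimit hA hs).mono
    openQuadrant_subset_quadrant).lowerSemicontinuousOn, fun x hx p hp => ?_⟩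
  have hq := openQuadrant_subset_quadrant hx
  by_contra! hneg
  obtain ⟨κ, hκ1, hκ0⟩ := exists_between hneg
  have hbdd : IsBoundedUnder (fun a b => a ≤ b) (𝓝[openQuadrant] x)
      (fun y => hamiltonian μ σ y p) := by
    refine isBoundedUnder_of_eventually_le (a := max p.1 0 * max p.2 0) ?_
    filter_upwards [self_mem_nhdsWithin] with y hy
    have := hamiltonian_le_mul (p := p) (hA.nonneg y (openQuadrant_subset_quadrant hy)).1
      (sq_nonneg (σ y))
    simpa using this
  obtain ⟨ρ, hρ, hball⟩ := Metric.mem_nhdsWithin_iff.1 (eventually_lt_of_limsup_lt hκ1 hbdd)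
  -- the slopes `p + ε` increase the Hamiltonian by at most `ε * L`
  set L := |p.1| + |p.2| + 1 with hL
  have hL0 : 0 < L := by positivity
  set ε := min 1 (-κ / L) with hε
  have hε0 : 0 < ε := lt_min one_pos (div_pos (neg_pos.2 hκ0) hL0)
  have hεL : ε * L ≤ -κ := by
    rw [← le_div_iff₀ hL0]
    exact min_le_right _ _
  have hε1 : ε ≤ 1 := min_le_left _ _
  have hbd := fun z (hz : z ∈ quadrant) => numericalSolution_bounded (σ := σ) hA hs hz
  have hp' : -p ∈ superdifferential openQuadrant (fun y => -lowerLimit μ σ μs y) x := by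
    rw [mem_superdifferential_iff_neg]
    simpa using hp
  obtain ⟨h, hh, i, j, hg, h1, h2⟩ := (frequently_backward_difference hx
    (F := fun h y => -numericalSolution μ σ μs h y) (w := fun y => -lowerLimit μ σ μs y)
    (fun h hh y _ => by rw [numericalSolution_floor hh y])
    (fun K hK hKc τ hτ => by
      filter_upwards [eventually_forall_mem_compact hKc hK fun z hz =>
        (numericalSolution_asympEquicontAt hA hs hz).eventually_liminf_le_add hbd hz hτ] with h h1 z hz
      have := h1 z hz
      simp only [lowerLimit]
      linarith)
    (fun τ hτ => (frequently_lt_liminf_add hbd hq hτ).mono fun h h1 => by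
      simp only [lowerLimit]
      linarith) hp' hε0 hρ).exists
  have hgO : ((h * ((i + 1 : ℕ) : ℝ), h * ((j + 1 : ℕ) : ℝ)) : ℝ × ℝ) ∈ openQuadrant :=
    ⟨by simp only; positivity, by simp only; positivity⟩
  have h4 : hamiltonian μ σ _ p < κ := hball ⟨hg, hgO⟩
  have h5 := (hA.nonneg _ (openQuadrant_subset_quadrant hgO)).1
  simp only [numericalSolution_succ_succ hh i j, Prod.fst_neg, Prod.snd_neg] at h1 h2
  have h3 := le_posPart_mul_of_update_le hh (q₁ := p.1 + ε) (q₂ := p.2 + ε)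
    (by linarith) (by linarith)
  set m := μ (h * ((i + 1 : ℕ) : ℝ), h * ((j + 1 : ℕ) : ℝ))
  unfold hamiltonian at h4
  have hpart : ∀ t : ℝ, max (t + ε - m) 0 ≤ max (t - m) 0 + ε := fun t =>
    max_le (by linarith [le_max_left (t - m) 0]) (by linarith [le_max_right (t - m) 0])
  have hpart' : ∀ t : ℝ, max (t - m) 0 ≤ |t| := fun t =>
    max_le (by linarith [le_abs_self t]) (abs_nonneg t)
  have h6 := mul_le_mul (hpart p.1) (hpart p.2) (le_max_right _ _)
    (add_nonneg (le_max_right _ _) hε0.le)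
  have h7 : ε * (max (p.1 - m) 0 + max (p.2 - m) 0 + ε) ≤ ε * L := by
    refine mul_le_mul_of_nonneg_left ?_ hε0.le
    linarith [hpart' p.1, hpart' p.2]
  linarith

theorem upperLimit_axes (hA : Admissible μ σ) (hs : F2 μs) {x : ℝ × ℝ} (hx : x ∈ axes) :
    upperLimit μ σ μs x = boundaryData μ μs x :=
  (numericalSolution_tendsto_axes hA hs hx).limsup_eq

theorem lowerLimit_axes (hA : Admissible μ σ) (hs : F2 μs) {x : ℝ × ℝ} (hx : x ∈ axes) :
    lowerLimit μ σ μs x = boundaryData μ μs x :=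
  (numericalSolution_tendsto_axes hA hs hx).liminf_eq

theorem upperLimit_eq_lowerLimit (hA : Admissible μ σ) (hs : F2 μs) {x : ℝ × ℝ}
    (hx : x ∈ quadrant) : upperLimit μ σ μs x = lowerLimit μ σ μs x := by
  refine le_antisymm (hA.comparison (continuousOn_upperLimit hA hs) (continuousOn_lowerLimit hA hs)
    (monotoneOn_lowerLimit hA hs) (upperLimit_subsolution hA hs) (lowerLimit_supersolution hA hs)
    (fun y hy => by rw [upperLimit_axes hA hs hy, lowerLimit_axes hA hs hy]) x hx) ?_
  obtain ⟨C, hC⟩ := numericalSolution_bounded (σ := σ) hA hs hx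
  exact liminf_le_limsup (isBoundedUnder_of_eventually_le (hC.mono fun _ h => h.2))
    (isBoundedUnder_of_eventually_ge (hC.mono fun _ h => h.1))

/-- Comparison of the upper and the lower limit makes them equal to one solution; comparison with any
other solution makes it unique; asymptotic equicontinuity makes the convergence locally uniform. -/
theorem Admissible.exists_unique_solution (hA : Admissible μ σ) (hs : F2 μs) :
    ∃ U : ℝ × ℝ → ℝ, IsMonotoneSolution μ σ μs U ∧
      (∀ V : ℝ × ℝ → ℝ, IsMonotoneSolution μ σ μs V → EqOn V U quadrant) ∧
      TendstoLocallyUniformlyOn (fun h : ℝ => numericalSolution μ σ μs h) U (𝓝[>] 0) quadrant := by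
  have heq : EqOn (upperLimit μ σ μs) (lowerLimit μ σ μs) quadrant :=
    fun x hx => upperLimit_eq_lowerLimit hA hs hx
  have hsol : IsMonotoneSolution μ σ μs (upperLimit μ σ μs) := by
    refine ⟨continuousOn_upperLimit hA hs, monotoneOn_upperLimit hA hs,
      upperLimit_subsolution hA hs, ⟨?_, fun x hx p hp => ?_⟩, fun x hx => upperLimit_axes hA hs hx⟩
    · exact ((continuousOn_upperLimit hA hs).mono
        openQuadrant_subset_quadrant).lowerSemicontinuousOn
    · refine (lowerLimit_supersolution hA hs).2 x hx p fun ε hε => ?_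
      filter_upwards [hp ε hε, self_mem_nhdsWithin] with y hy hyO
      rwa [← heq (openQuadrant_subset_quadrant hx), ← heq (openQuadrant_subset_quadrant hyO)]
  refine ⟨upperLimit μ σ μs, hsol, fun V hV x hx => ?_, ?_⟩
  · exact le_antisymm
      (hA.comparison hV.continuousOn hsol.continuousOn hsol.monotoneOn hV.subsolution
        hsol.supersolution (fun y hy => by rw [hV.boundary y hy, hsol.boundary y hy]) x hx)
      (hA.comparison hsol.continuousOn hV.continuousOn hV.monotoneOn hsol.subsolution
        hV.supersolution (fun y hy => by rw [hV.boundary y hy, hsol.boundary y hy]) x hx)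
  · rw [Metric.tendstoLocallyUniformlyOn_iff]
    intro ε hε x hx
    have hbd := fun z (hz : z ∈ quadrant) => numericalSolution_bounded (σ := σ) hA hs hz
    have hec := numericalSolution_asympEquicontAt (σ := σ) hA hs hx
    obtain ⟨r₁, hr₁, h₁⟩ := hec.eventually_le_limsup_add hbd hx (half_pos hε)
    obtain ⟨r₂, hr₂, h₂⟩ := hec.eventually_liminf_le_add hbd hx (half_pos hε)
    refine ⟨quadrant ∩ Metric.ball x (min r₁ r₂), inter_mem self_mem_nhdsWithin
      (mem_nhdsWithin_of_mem_nhds (Metric.ball_mem_nhds x (lt_min hr₁ hr₂))), ?_⟩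
    filter_upwards [h₁, h₂] with h h3 h4 y hy
    have h5 := h3 y ⟨hy.1, Metric.ball_subset_ball (min_le_left _ _) hy.2⟩
    have h6 := h4 y ⟨hy.1, Metric.ball_subset_ball (min_le_right _ _) hy.2⟩
    have h7 : upperLimit μ σ μs y = lowerLimit μ σ μs y := heq hy.1
    simp only [upperLimit, lowerLimit] at h7 ⊢
    rw [Real.dist_eq, abs_lt]
    constructor <;> linarith

/-! ### Geometry of the configuration -/

/-- `F` is a strictly decreasing continuous function on the whole line whose graph meets the closed
quadrant exactly in `Γ`. -/
structure Configuration.IsGraph (G : Configuration) (F : ℝ → ℝ) : Prop where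
  continuous : Continuous F
  strictAnti : StrictAnti F
  eq : G.Γ = {x | x ∈ quadrant ∧ x.2 = F x.1}

theorem Configuration.exists_isGraph (G : Configuration) : ∃ F, G.IsGraph F := by
  obtain ⟨I, f, hI, hfc, hfa, hΓ⟩ := G.decreasing
  have hsq := G.subset_square
  have h1 := G.endpoint_right
  have h0 := G.endpoint_top
  rw [hΓ] at h1 h0 hsq
  obtain ⟨t, ht, he⟩ := h1
  obtain ⟨rfl, hf1⟩ := Prod.mk.inj he
  obtain ⟨s, hs, he⟩ := h0
  obtain ⟨rfl, hf0⟩ := Prod.mk.inj he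
  have hIeq : I = Icc 0 1 := by
    refine Subset.antisymm (fun u hu => ?_) (hI.out hs ht)
    have := hsq ⟨u, hu, rfl⟩
    exact ⟨this.1.1, this.2.1⟩
  subst hIeq
  set c : ℝ → ℝ := fun t => max 0 (min 1 t) with hc
  have hcI : ∀ t, c t ∈ Icc (0 : ℝ) 1 := fun t =>
    ⟨le_max_left _ _, max_le zero_le_one (min_le_left _ _)⟩
  have hct : ∀ t ∈ Icc (0 : ℝ) 1, c t = t := fun t ht => by
    simp only [hc, min_eq_right ht.2, max_eq_right ht.1]
  have hcc : Continuous c := by fun_prop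
  refine ⟨fun t => f (c t) - (t - c t), ?_, ?_, ?_⟩
  · exact (hfc.comp_continuous hcc hcI).sub (continuous_id.sub hcc)
  · intro s t hst
    simp only
    have hmono : c s ≤ c t := by simp only [hc]; gcongr
    have hmono' : s - c s ≤ t - c t := by
      simp only [hc]
      rcases max_cases 0 (min 1 s) with h1 | h1 <;> rcases max_cases 0 (min 1 t) with h2 | h2 <;>
        rcases min_cases 1 s with h3 | h3 <;> rcases min_cases 1 t with h4 | h4 <;> linarith
    rcases hmono.eq_or_lt with he | hlt
    · rw [he]; linarith
    · linarith [hfa (hcI s) (hcI t) hlt]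
  · rw [hΓ]
    ext ⟨t, y⟩
    constructor
    · rintro ⟨u, hu, he⟩
      obtain ⟨rfl, rfl⟩ := Prod.mk.inj he
      have := hsq ⟨u, hu, rfl⟩
      refine ⟨this.1, ?_⟩
      simp only [hct u hu]
      ring
    · rintro ⟨⟨h1, h2⟩, h3⟩
      simp only at h1 h2 h3
      have ht1 : t ≤ 1 := by
        by_contra! hlt
        have : c t = 1 := by simp only [hc, min_eq_left hlt.le, max_eq_right zero_le_one]
        rw [this, hf1] at h3
        linarith
      have := hct t ⟨h1, ht1⟩
      exact ⟨t, ⟨h1, ht1⟩, by simp only [h3, this]; ring_nf⟩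

/-- The region over an interval between a graph and a horizontal line is connected; the set `T` of
interpolation parameters decides which of its sides belong to it. -/
theorem isPreconnected_between {J T : Set ℝ} (hJ : IsPreconnected J) (hT : IsPreconnected T)
    {φ : ℝ → ℝ} (hφ : ContinuousOn φ J) (c : ℝ) :
    IsPreconnected ((fun q : ℝ × ℝ => (q.1, φ q.1 + q.2 * (c - φ q.1))) '' J ×ˢ T) := by
  refine (hJ.prod hT).image _ ?_
  have h1 : ContinuousOn (fun q : ℝ × ℝ => φ q.1) (J ×ˢ T) :=
    hφ.comp continuousOn_fst fun q hq => hq.1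
  exact continuousOn_fst.prodMk (h1.add (continuousOn_snd.mul (continuousOn_const.sub h1)))

namespace Configuration

variable {G : Configuration} {F : ℝ → ℝ}

theorem IsGraph.apply_one (hF : G.IsGraph F) : F 1 = 0 := by
  have := G.endpoint_right
  rw [hF.eq] at this
  exact this.2.symm

theorem IsGraph.apply_zero (hF : G.IsGraph F) : F 0 = 1 := by
  have := G.endpoint_top
  rw [hF.eq] at this
  exact this.2.symm

theorem IsGraph.isOpen_below (hF : G.IsGraph F) : IsOpen {x : ℝ × ℝ | x.2 < F x.1} :=
  isOpen_lt continuous_snd (hF.continuous.comp continuous_fst)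

theorem IsGraph.isOpen_above (hF : G.IsGraph F) : IsOpen {x : ℝ × ℝ | F x.1 < x.2} :=
  isOpen_lt (hF.continuous.comp continuous_fst) continuous_snd

theorem IsGraph.isClosed (hF : G.IsGraph F) : IsClosed G.Γ := by
  rw [hF.eq]
  exact isClosed_quadrant.inter (isClosed_eq continuous_snd (hF.continuous.comp continuous_fst))

theorem IsGraph.mem_boundedPart (hF : G.IsGraph F) {x : ℝ × ℝ} :
    x ∈ boundedPart G.Γ ↔ x ∈ quadrant ∧ x.2 < F x.1 := by
  have hΓ : ∀ y, y ∈ quadrant \ G.Γ ↔ y ∈ quadrant ∧ (y.2 < F y.1 ∨ F y.1 < y.2) := by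
    intro y
    rw [hF.eq, Set.mem_sdiff, mem_ofPred_eq, not_and, ← ne_iff_lt_or_gt]
    exact ⟨fun h => ⟨h.1, h.2 h.1⟩, fun h => ⟨h.1, fun _ => h.2⟩⟩
  have hdisj : Disjoint {x : ℝ × ℝ | x.2 < F x.1} {x : ℝ × ℝ | F x.1 < x.2} :=
    disjoint_left.2 fun y (h1 : y.2 < F y.1) (h2 : F y.1 < y.2) => lt_asymm h1 h2
  constructor
  · rintro ⟨hx, hb⟩
    have hxq := (hΓ x).1 hx
    refine ⟨hxq.1, hxq.2.resolve_right fun hlt => ?_⟩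
    -- above the graph the component contains a diagonal half-line
    have hray : (fun t : ℝ => (x.1 + t, x.2 + t)) '' Ici 0 ⊆ connectedComponentIn (quadrant \ G.Γ) x := by
      refine (isPreconnected_Ici.image _ (by fun_prop)).subset_connectedComponentIn
        ⟨0, mem_Ici.2 le_rfl, by simp⟩ ?_
      rintro _ ⟨t, ht, rfl⟩
      have ht : 0 ≤ t := ht
      refine (hΓ _).2 ⟨⟨add_nonneg hxq.1.1 ht, add_nonneg hxq.1.2 ht⟩, Or.inr ?_⟩
      have := hF.strictAnti.antitone (le_add_of_nonneg_right ht : x.1 ≤ x.1 + t)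
      simp only
      linarith
    obtain ⟨R, hR⟩ := (hb.subset hray).exists_norm_le
    have h1 := hR _ ⟨|R| + 1, by simp only [mem_Ici]; positivity, rfl⟩
    have h2 := (norm_fst_le _).trans h1
    rw [Real.norm_eq_abs] at h2
    have h3 := hxq.1.1
    linarith [le_abs_self (x.1 + (|R| + 1)), le_abs_self R]
  · rintro ⟨hxq, hlt⟩
    have hx := (hΓ x).2 ⟨hxq, Or.inl hlt⟩
    refine ⟨hx, (Metric.isBounded_Icc ((0, 0) : ℝ × ℝ) (1, 1)).subset fun y hy => ?_⟩
    have hsub : connectedComponentIn (quadrant \ G.Γ) x ⊆ {x : ℝ × ℝ | x.2 < F x.1} :=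
      isPreconnected_connectedComponentIn.subset_left_of_subset_union hF.isOpen_below
        hF.isOpen_above hdisj
        (fun z hz => ((hΓ z).1 (connectedComponentIn_subset _ _ hz)).2)
        ⟨x, mem_connectedComponentIn hx, hlt⟩
    have hyq := ((hΓ y).1 (connectedComponentIn_subset _ _ hy)).1
    have hylt : y.2 < F y.1 := hsub hy
    refine ⟨hyq, ?_, ?_⟩
    · have : F 1 < F y.1 := by rw [hF.apply_one]; exact hyq.2.trans_lt hylt
      exact (hF.strictAnti.lt_iff_gt.1 this).le
    · have := hF.strictAnti.antitone hyq.1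
      rw [hF.apply_zero] at this
      simp only
      linarith

theorem IsGraph.mem_outer (hF : G.IsGraph F) {x : ℝ × ℝ} :
    x ∈ quadrant \ boundedPart G.Γ ↔ x ∈ quadrant ∧ F x.1 ≤ x.2 := by
  rw [Set.mem_sdiff, hF.mem_boundedPart, not_and, not_lt]
  exact ⟨fun h => ⟨h.1, h.2 h.1⟩, fun h => ⟨h.1, fun _ => h.2⟩⟩

/-- The interior points of the quadrant on `∂([0,∞)² \ Ω)` are on `Γ`. -/
theorem IsGraph.mem_of_mem_frontier (hF : G.IsGraph F) {x : ℝ × ℝ} (hx : x ∈ openQuadrant)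
    (hfr : x ∈ frontier (quadrant \ boundedPart G.Γ)) : x ∈ G.Γ := by
  rw [hF.eq]
  refine ⟨openQuadrant_subset_quadrant hx, ?_⟩
  rcases lt_trichotomy x.2 (F x.1) with h | h | h
  · have h1 := mem_closure_iff_nhds.1 hfr.1 _ (hF.isOpen_below.mem_nhds h)
    obtain ⟨y, hy1, hy2⟩ := h1
    exact absurd (hF.mem_outer.1 hy2).2 (not_le.2 hy1)
  · exact h
  · refine absurd (mem_interior_iff_mem_nhds.2 ?_) hfr.2
    filter_upwards [hF.isOpen_above.mem_nhds h, quadrant_mem_nhds hx] with y hy hyq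
    exact hF.mem_outer.2 ⟨hyq, le_of_lt hy⟩

/-- A parametrization of `Γ_i`: the parameter interval has a least element, which belongs to the
endpoint, and no greatest one. -/
theorem exists_param (G : Configuration) (i : ℤ) : ∃ (J : Set ℝ) (f : ℝ → ℝ) (a : ℝ),
    J.OrdConnected ∧ ContinuousOn f J ∧ StrictMonoOn f J ∧ G.curve i = (fun t => (t, f t)) '' J ∧
    a ∈ J ∧ (∀ t ∈ J, a ≤ t) ∧ (∀ t ∈ J, ∃ t' ∈ J, t < t') ∧
    (a, f a) ∈ frontier (quadrant \ boundedPart G.Γ) := by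
  obtain ⟨J, f, hJ, hfc, hfm, heq⟩ := G.increasing i
  obtain ⟨p, hp, hmin, hfr⟩ := G.start i
  have hunb := G.unbounded i
  rw [heq] at hp hmin hunb
  obtain ⟨a, ha, rfl⟩ := hp
  have hmin' : ∀ t ∈ J, a ≤ t := fun t ht => (hmin _ ⟨t, ht, rfl⟩).1
  refine ⟨J, f, a, hJ, hfc, hfm, heq, ha, hmin', fun t ht => ?_, hfr⟩
  by_contra! hmax
  refine hunb ((Metric.isBounded_Icc (a, f a) (t, f t)).subset ?_)
  rintro _ ⟨s, hs, rfl⟩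
  exact ⟨hmin _ ⟨s, hs, rfl⟩, hmax s hs, hfm.monotoneOn hs ht (hmax s hs)⟩

theorem curve_subset_outer (hF : G.IsGraph F) (i : ℤ) : G.curve i ⊆ quadrant \ boundedPart G.Γ := by
  intro q hq
  obtain ⟨p, hp, hmin, hfr⟩ := G.start i
  have hcl : IsClosed {x : ℝ × ℝ | F x.1 ≤ x.2} :=
    isClosed_le (hF.continuous.comp continuous_fst) continuous_snd
  have h1 : F p.1 ≤ p.2 := closure_minimal (fun x hx => (hF.mem_outer.1 hx).2) hcl hfr.1
  have h2 := hmin q hq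
  exact hF.mem_outer.2 ⟨G.curve_subset i hq,
    (hF.strictAnti.antitone h2.1).trans (h1.trans h2.2)⟩

theorem isClosed_curve (G : Configuration) (i : ℤ) : IsClosed (G.curve i) := by
  obtain ⟨J, f, a, hJ, hfc, hfm, heq, ha, hmin, -, -⟩ := G.exists_param i
  refine isClosed_of_closure_subset fun x hx => ?_
  -- near `x` the curve stays in a compact arc
  obtain ⟨t, ht, hfar⟩ : ∃ t ∈ J, x.1 + 1 < t ∨ x.2 + 1 < f t := by
    by_contra! hcon
    refine G.unbounded i ((Metric.isBounded_Icc (a, f a) (x.1 + 1, x.2 + 1)).subset ?_)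
    rw [heq]
    rintro _ ⟨s, hs, rfl⟩
    exact ⟨⟨hmin s hs, hfm.monotoneOn ha hs (hmin s hs)⟩, hcon s hs⟩
  have hsub : Icc a t ⊆ J := hJ.out ha ht
  have hK : IsCompact ((fun t => (t, f t)) '' Icc a t) :=
    isCompact_Icc.image_of_continuousOn (continuousOn_id.prodMk (hfc.mono hsub))
  have hU : {y : ℝ × ℝ | y.1 < x.1 + 1 ∧ y.2 < x.2 + 1} ∈ 𝓝 x :=
    ((isOpen_lt continuous_fst continuous_const).inter
      (isOpen_lt continuous_snd continuous_const)).mem_nhds ⟨by simp, by simp⟩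
  have hxK : x ∈ closure ((fun t => (t, f t)) '' Icc a t) := by
    rw [mem_closure_iff_nhds] at hx ⊢
    intro V hV
    obtain ⟨y, ⟨hyV, hyU⟩, hy⟩ := hx _ (inter_mem hV hU)
    rw [heq] at hy
    obtain ⟨s, hs, rfl⟩ := hy
    refine ⟨_, hyV, s, ⟨hmin s hs, ?_⟩, rfl⟩
    by_contra! hlt
    have h1 := hfm ht hs hlt
    rcases hfar with h | h
    · linarith [hyU.1]
    · linarith [hyU.2]
  rw [hK.isClosed.closure_eq] at hxK
  rw [heq]
  exact image_mono hsub hxK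

theorem isClosed_iUnion_curve (G : Configuration) : IsClosed (⋃ i, G.curve i) :=
  G.locallyFinite.isClosed_iUnion G.isClosed_curve

/-- Connected sets which avoid `Ω` and all curves are contained in one region. -/
theorem exists_subset_region (G : Configuration) {P : Set (ℝ × ℝ)} (hP : IsPreconnected P)
    (hne : P.Nonempty) (hsub : P ⊆ (quadrant \ boundedPart G.Γ) \ ⋃ j, G.curve j) :
    ∃ i, P ⊆ G.region i := by
  obtain ⟨x, hx⟩ := hne
  obtain ⟨i, hi⟩ := mem_iUnion.1 (G.region_cover (hsub hx))
  obtain ⟨y, -, hy⟩ := G.region_component i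
  refine ⟨i, ?_⟩
  rw [hy] at hi ⊢
  rw [connectedComponentIn_eq hi]
  exact hP.subset_connectedComponentIn hx hsub

theorem region_subset (G : Configuration) (i : ℤ) :
    G.region i ⊆ (quadrant \ boundedPart G.Γ) \ ⋃ j, G.curve j := by
  obtain ⟨y, -, hy⟩ := G.region_component i
  rw [hy]
  exact connectedComponentIn_subset _ _

theorem eq_of_mem_region (G : Configuration) {i j : ℤ} {x : ℝ × ℝ} (hi : x ∈ G.region i)
    (hj : x ∈ G.region j) : i = j := by
  obtain ⟨y, -, hy⟩ := G.region_component i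
  obtain ⟨z, -, hz⟩ := G.region_component j
  apply G.region_injective
  rw [hy] at hi ⊢
  rw [hz] at hj ⊢
  rw [connectedComponentIn_eq hi, connectedComponentIn_eq hj]

theorem curve_subset_closure (G : Configuration) {i j : ℤ} (h : j = i ∨ j = i - 1) :
    G.curve i ⊆ closure (G.region j) :=
  ((G.curve_boundary i j).2 h).trans frontier_subset_closure

/-- The weights are continuous off `Γ` and the curves. -/
theorem continuousWithinAt_of_notMem (hF : G.IsGraph F) {g : ℝ × ℝ → ℝ} (hg : G.F1 g)
    {x : ℝ × ℝ} (hx : x ∈ quadrant) (hxE : x ∉ G.Γ ∪ ⋃ i, G.curve i) :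
    ContinuousWithinAt g quadrant x := by
  simp only [mem_union, not_or] at hxE
  have hne : x.2 ≠ F x.1 := fun h => hxE.1 (by rw [hF.eq]; exact ⟨hx, h⟩)
  rcases hne.lt_or_gt with h | h
  · have h0 : ∀ᶠ y in 𝓝[quadrant] x, g y = 0 := by
      filter_upwards [self_mem_nhdsWithin, mem_nhdsWithin_of_mem_nhds (hF.isOpen_below.mem_nhds h)]
        with y hyq hy
      exact hg.zero y (hF.mem_boundedPart.2 ⟨hyq, hy⟩)
    exact (continuousWithinAt_const (b := (0 : ℝ))).congr_of_eventuallyEq h0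
      (hg.zero x (hF.mem_boundedPart.2 ⟨hx, h⟩))
  · obtain ⟨r, hr, hball⟩ := Metric.mem_nhds_iff.1
      (inter_mem (hF.isOpen_above.mem_nhds h) (G.isClosed_iUnion_curve.isOpen_compl.mem_nhds hxE.2))
    have hqc : Convex ℝ quadrant := by
      have : quadrant = Ici (0 : ℝ × ℝ) := rfl
      rw [this]
      exact convex_Ici _
    obtain ⟨i, hi⟩ := G.exists_subset_region (P := quadrant ∩ Metric.ball x r)
      (hqc.inter (convex_ball x r)).isPreconnected ⟨x, hx, Metric.mem_ball_self hr⟩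
      (fun y hy => ⟨hF.mem_outer.2 ⟨hy.1, le_of_lt (hball hy.2).1⟩, (hball hy.2).2⟩)
    obtain ⟨C, hC⟩ := hg.lipschitz
    have hc := ((hC i).mono hi).continuousOn x ⟨hx, Metric.mem_ball_self hr⟩
    exact hc.mono_of_mem_nhdsWithin (inter_mem self_mem_nhdsWithin
      (mem_nhdsWithin_of_mem_nhds (Metric.ball_mem_nhds x hr)))

end Configuration

/-! ### Favorable directions -/

theorem hasFavorableDirection_of_continuousWithinAt {μ σ : ℝ × ℝ → ℝ} {x : ℝ × ℝ}
    (hx : x ∈ openQuadrant) (hμ : ContinuousWithinAt μ quadrant x)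
    (hσ : ContinuousWithinAt (fun x => σ x ^ 2) quadrant x) : HasFavorableDirection μ σ x := by
  refine ⟨0, 1, one_pos, fun η hη => ?_⟩
  have hμ' := hμ.continuousAt (quadrant_mem_nhds hx)
  have hσ' := hσ.continuousAt (quadrant_mem_nhds hx)
  obtain ⟨r₁, hr₁, h₁⟩ := Metric.continuousAt_iff.1 hμ' (η / 2) (half_pos hη)
  obtain ⟨r₂, hr₂, h₂⟩ := Metric.continuousAt_iff.1 hσ' (η / 2) (half_pos hη)
  have hr : 0 < min r₁ r₂ / 2 := by positivity
  refine ⟨min r₁ r₂ / 2, hr, fun z hz δ _ hδr y hy => ?_⟩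
  rw [smul_zero, sub_zero, one_mul, ← dist_eq_norm] at hy
  have hz' := Metric.mem_ball.1 hz
  have hyx := dist_triangle y z x
  have h3 := min_le_left r₁ r₂
  have h4 := min_le_right r₁ r₂
  have e1 := h₁ (show dist z x < r₁ by linarith)
  have e2 := h₁ (show dist y x < r₁ by linarith)
  have e3 := h₂ (show dist z x < r₂ by linarith)
  have e4 := h₂ (show dist y x < r₂ by linarith)
  rw [Real.dist_eq, abs_lt] at e1 e2 e3 e4
  constructor <;> linarith [e1.1, e1.2, e2.1, e2.2, e3.1, e3.2, e4.1, e4.2]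

/-- A one-sided Lipschitz estimate in the directions close to `e` makes `e` favorable. -/
theorem hasFavorableDirection_of_le_add {μ σ : ℝ × ℝ → ℝ} {x e : ℝ × ℝ} (he : ‖e‖ ≤ 1) {ρ C : ℝ}
    (hρ : 0 < ρ) (hC : 0 ≤ C)
    (h : ∀ z ∈ Metric.ball x ρ, ∀ y ∈ Metric.ball x ρ, ∀ δ > 0, ‖y - z - δ • e‖ < 1 / 2 * δ →
      μ z ≤ μ y + C * ‖y - z‖ ∧ σ z ^ 2 ≤ σ y ^ 2 + C * ‖y - z‖) :
    HasFavorableDirection μ σ x := by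
  refine ⟨e, 1 / 2, by norm_num, fun η hη => ?_⟩
  have hr : 0 < min (ρ / 3) (η / (2 * (C + 1))) := by positivity
  refine ⟨min (ρ / 3) (η / (2 * (C + 1))), hr, fun z hz δ hδ hδr y hy => ?_⟩
  have h1 := min_le_left (ρ / 3) (η / (2 * (C + 1)))
  have hyz : ‖y - z‖ ≤ 2 * δ := by
    calc ‖y - z‖ = ‖(y - z - δ • e) + δ • e‖ := by rw [sub_add_cancel]
      _ ≤ ‖y - z - δ • e‖ + ‖δ • e‖ := norm_add_le _ _
      _ ≤ 1 / 2 * δ + δ * 1 := by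
        rw [norm_smul, Real.norm_eq_abs, abs_of_pos hδ]
        gcongr
      _ ≤ 2 * δ := by linarith
  have hz' := Metric.mem_ball.1 hz
  have hyx := dist_triangle y z x
  rw [dist_eq_norm y z] at hyx
  have hCη : C * ‖y - z‖ ≤ η := by
    have h2 : δ ≤ η / (2 * (C + 1)) := hδr.le.trans (min_le_right _ _)
    rw [le_div_iff₀ (by positivity)] at h2
    have h3 := mul_le_mul_of_nonneg_left hyz hC
    linarith
  have := h z (Metric.mem_ball.2 (by linarith)) y (Metric.mem_ball.2 (by linarith)) δ hδ hy
  exact ⟨this.1.trans (by linarith), this.2.trans (by linarith)⟩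

/-- If `|e₁| = |e₂| = 1`, this means that both coordinates move by at least `δ / 2`, with the signs
of `e`. -/
theorem abs_lt_of_norm_sub_lt {y z e : ℝ × ℝ} {δ : ℝ} (h : ‖y - z - δ • e‖ < 1 / 2 * δ) :
    |y.1 - z.1 - δ * e.1| < 1 / 2 * δ ∧ |y.2 - z.2 - δ * e.2| < 1 / 2 * δ :=
  norm_lt_iff_fst_snd.1 h

/-- A neighbourhood of a point `(t₀, f t₀)` of the graph of a continuous function, in the shape of a
rectangle which the graph leaves only through its left and right sides. -/
theorem exists_rectangle {f : ℝ → ℝ} {t₀ : ℝ} (hf : ContinuousAt f t₀) {U : Set (ℝ × ℝ)}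
    (hU : U ∈ 𝓝 (t₀, f t₀)) {V : Set ℝ} (hV : V ∈ 𝓝 t₀) : ∃ ρ > 0, ∃ r > 0, ρ ≤ r ∧
      Ioo (t₀ - ρ) (t₀ + ρ) ⊆ V ∧
      (∀ t ∈ Ioo (t₀ - ρ) (t₀ + ρ), f t ∈ Ioo (f t₀ - r) (f t₀ + r)) ∧
      Ioo (t₀ - ρ) (t₀ + ρ) ×ˢ Ioo (f t₀ - r) (f t₀ + r) ⊆ U := by
  obtain ⟨r, hr, hball⟩ := Metric.mem_nhds_iff.1 hU
  have hev := inter_mem hV (hf.preimage_mem_nhds (Ioo_mem_nhds (sub_lt_self (f t₀) hr)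
    (lt_add_of_pos_right (f t₀) hr)))
  obtain ⟨ρ, hρ, hsub⟩ := Metric.mem_nhds_iff.1 hev
  rw [Real.ball_eq_Ioo] at hsub
  have hmono : Ioo (t₀ - min ρ r) (t₀ + min ρ r) ⊆ Ioo (t₀ - ρ) (t₀ + ρ) :=
    Ioo_subset_Ioo (by linarith [min_le_left ρ r]) (by linarith [min_le_left ρ r])
  refine ⟨min ρ r, lt_min hρ hr, r, hr, min_le_right _ _, fun t ht => (hsub (hmono ht)).1,
    fun t ht => (hsub (hmono ht)).2, fun y hy => hball ?_⟩
  rw [Metric.mem_ball, Prod.dist_eq, max_lt_iff, Real.dist_eq, Real.dist_eq, abs_lt, abs_lt]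
  have h1 := hy.1.1
  have h2 := hy.1.2
  have h3 := hy.2.1
  have h4 := hy.2.2
  have h5 := min_le_right ρ r
  refine ⟨⟨?_, ?_⟩, ?_, ?_⟩ <;> simp only <;> linarith

namespace Configuration

variable {G : Configuration} {F : ℝ → ℝ}

/-- At points of `Γ` away from the curves the direction `(1, 1)`, out of `Ω`, is favorable. -/
theorem hasFavorableDirection_Γ (hF : G.IsGraph F) {μ σ : ℝ × ℝ → ℝ} (hμ : G.F1 μ)
    (hσ : G.F1 fun x => σ x ^ 2) {x : ℝ × ℝ} (hx : x ∈ openQuadrant) (hxΓ : x ∈ G.Γ)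
    (hxc : x ∉ ⋃ i, G.curve i) : HasFavorableDirection μ σ x := by
  obtain ⟨t₀, x₂⟩ := x
  have hxF := hxΓ
  rw [hF.eq] at hxF
  obtain rfl : x₂ = F t₀ := hxF.2
  obtain ⟨ρ, hρ, r, hr, hρr, -, hFr, hsub⟩ := exists_rectangle hF.continuous.continuousAt
    (inter_mem (isOpen_openQuadrant.mem_nhds hx) (G.isClosed_iUnion_curve.isOpen_compl.mem_nhds hxc))
    univ_mem
  set B := Ioo (t₀ - ρ) (t₀ + ρ) ×ˢ Ioo (F t₀ - r) (F t₀ + r) with hB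
  have hballB : Metric.ball (t₀, F t₀) ρ ⊆ B := by
    intro y hy
    rw [Metric.mem_ball, Prod.dist_eq, max_lt_iff, Real.dist_eq, Real.dist_eq, abs_lt, abs_lt] at hy
    obtain ⟨⟨h1, h2⟩, h3, h4⟩ := hy
    simp only at h1 h2 h3 h4
    exact ⟨⟨by linarith, by linarith⟩, by linarith, by linarith⟩
  -- the part of the rectangle outside of `Ω` belongs to one region
  obtain ⟨i, hi⟩ : ∃ i, {y ∈ B | F y.1 ≤ y.2} ⊆ G.region i := by
    have hconn := isPreconnected_between (isPreconnected_Ioo (a := t₀ - ρ) (b := t₀ + ρ))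
      (isPreconnected_Ico (a := (0 : ℝ)) (b := 1)) hF.continuous.continuousOn (F t₀ + r)
    have himg : {y ∈ B | F y.1 ≤ y.2} ⊆ (fun q : ℝ × ℝ => (q.1, F q.1 + q.2 * (F t₀ + r - F q.1))) ''
        Ioo (t₀ - ρ) (t₀ + ρ) ×ˢ Ico 0 1 := by
      rintro ⟨s, y⟩ ⟨⟨hs, hy⟩, hle⟩
      have hd : 0 < F t₀ + r - F s := by linarith [(hFr s hs).2]
      simp only at hle hy
      refine ⟨(s, (y - F s) / (F t₀ + r - F s)), ⟨hs, div_nonneg (by linarith) hd.le, ?_⟩, ?_⟩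
      · rw [div_lt_one hd]; linarith [hy.2]
      · simp only [Prod.mk.injEq, true_and]; field_simp; ring
    have himg' : (fun q : ℝ × ℝ => (q.1, F q.1 + q.2 * (F t₀ + r - F q.1))) ''
        Ioo (t₀ - ρ) (t₀ + ρ) ×ˢ Ico 0 1 ⊆ {y ∈ B | F y.1 ≤ y.2} := by
      rintro _ ⟨⟨s, u⟩, ⟨hs, hu⟩, rfl⟩
      have hd : 0 < F t₀ + r - F s := by linarith [(hFr s hs).2]
      have h1 : 0 ≤ u * (F t₀ + r - F s) := mul_nonneg hu.1 hd.le
      have h2 : u * (F t₀ + r - F s) < 1 * (F t₀ + r - F s) := mul_lt_mul_of_pos_right hu.2 hd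
      have h3 := (hFr s hs).1
      exact ⟨⟨hs, by simp only; linarith, by simp only; linarith⟩, by simp only; linarith⟩
    rw [← Subset.antisymm himg himg'] at hconn
    refine G.exists_subset_region hconn ⟨(t₀, F t₀), hballB (Metric.mem_ball_self hρ), le_rfl⟩ ?_
    exact fun y hy => ⟨hF.mem_outer.2 ⟨openQuadrant_subset_quadrant (hsub hy.1).1, hy.2⟩,
      (hsub hy.1).2⟩
  have key : ∀ g, G.F1 g → ∃ C : NNReal, ∀ z ∈ B, ∀ y ∈ B, z.1 < y.1 → z.2 < y.2 →
      g z ≤ g y + C * ‖y - z‖ := by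
    intro g hg
    obtain ⟨C, hC⟩ := hg.lipschitz
    refine ⟨C, fun z hz y hy h1 h2 => ?_⟩
    rcases lt_or_ge z.2 (F z.1) with h | h
    · rw [hg.zero z (hF.mem_boundedPart.2 ⟨openQuadrant_subset_quadrant (hsub hz).1, h⟩)]
      have := hg.nonneg y (openQuadrant_subset_quadrant (hsub hy).1)
      positivity
    · have h3 := hF.strictAnti h1
      have h4 := (hC i).dist_le_mul y (hi ⟨hy, by linarith⟩) z (hi ⟨hz, h⟩)
      rw [Real.dist_eq, dist_eq_norm] at h4
      linarith [(abs_le.1 h4).1]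
  obtain ⟨C₁, h₁⟩ := key μ hμ
  obtain ⟨C₂, h₂⟩ := key _ hσ
  refine hasFavorableDirection_of_le_add (e := (1, 1)) (C := max C₁ C₂)
    (by simp [Prod.norm_def]) hρ (le_max_of_le_left C₁.2) fun z hz y hy δ hδ hyz => ?_
  obtain ⟨h3, h4⟩ := abs_lt_of_norm_sub_lt hyz
  rw [abs_lt] at h3 h4
  have h5 : z.1 < y.1 := by linarith [h3.1]
  have h6 : z.2 < y.2 := by linarith [h4.1]
  have h7 := h₁ z (hballB hz) y (hballB hy) h5 h6
  have h8 := h₂ z (hballB hz) y (hballB hy) h5 h6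
  have h9 := mul_le_mul_of_nonneg_right (le_max_left (C₁ : ℝ) C₂) (norm_nonneg (y - z))
  have h10 := mul_le_mul_of_nonneg_right (le_max_right (C₁ : ℝ) C₂) (norm_nonneg (y - z))
  exact ⟨by linarith, by linarith⟩

/-- Let `g` be Lipschitz on both sides `D'` and `D` of a curve `S`, with the value on `S` being the
limit from the side `D`, and not smaller than the limit from the side `D'`. Then `g` can jump upwards,
but not downwards, when the curve is approached from `D'` or crossed from `D'` to `D`. -/
theorem le_add_across {g : ℝ × ℝ → ℝ} {C : NNReal} {D D' S : Set (ℝ × ℝ)}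
    (hD : LipschitzOnWith C g D) (hD' : LipschitzOnWith C g D') (hcl : S ⊆ closure D)
    (hcl' : S ⊆ closure D') (hlim : ∀ y ∈ S, Tendsto g (𝓝[D] y) (𝓝 (g y)) ∧
      ∃ β ≤ g y, Tendsto g (𝓝[D'] y) (𝓝 β)) {z w : ℝ × ℝ}
    (h : (z ∈ D ∧ w ∈ D) ∨ (z ∈ S ∧ w ∈ D) ∨ (z ∈ D' ∧ w ∈ D') ∨ (z ∈ D' ∧ w ∈ S) ∨
      (z ∈ D' ∧ w ∈ D ∧ ∃ y ∈ S, dist z y ≤ dist w z ∧ dist y w ≤ dist w z)) :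
    g z ≤ g w + 2 * C * dist w z := by
  have hlip : ∀ {A : Set (ℝ × ℝ)}, LipschitzOnWith C g A → ∀ {a b}, a ∈ A → b ∈ A →
      g a ≤ g b + C * dist a b := by
    intro A hA a b ha hb
    have := hA.dist_le_mul a ha b hb
    rw [Real.dist_eq] at this
    linarith [(abs_le.1 this).2]
  have hSD : ∀ {y b}, y ∈ S → b ∈ D → g y ≤ g b + C * dist y b := by
    intro y b hy hb
    have : (𝓝[D] y).NeBot := mem_closure_iff_nhdsWithin_neBot.1 (hcl hy)
    have hc : Tendsto (fun a => g b + C * dist a b) (𝓝[D] y) (𝓝 (g b + C * dist y b)) :=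
      ((by fun_prop : Continuous fun a : ℝ × ℝ => g b + C * dist a b).tendsto y).mono_left
        nhdsWithin_le_nhds
    refine le_of_tendsto_of_tendsto (hlim y hy).1 hc ?_
    filter_upwards [self_mem_nhdsWithin] with a ha
    exact hlip hD ha hb
  have hD'S : ∀ {a y}, a ∈ D' → y ∈ S → g a ≤ g y + C * dist a y := by
    intro a y ha hy
    have : (𝓝[D'] y).NeBot := mem_closure_iff_nhdsWithin_neBot.1 (hcl' hy)
    obtain ⟨β, hβ, hlim'⟩ := (hlim y hy).2
    have hc : Tendsto (fun b => g b + C * dist a b) (𝓝[D'] y) (𝓝 (β + C * dist a y)) :=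
      hlim'.add (((by fun_prop : Continuous fun b : ℝ × ℝ => C * dist a b).tendsto y).mono_left
        nhdsWithin_le_nhds)
    have h1 : g a ≤ β + C * dist a y := by
      refine ge_of_tendsto hc ?_
      filter_upwards [self_mem_nhdsWithin] with b hb
      exact hlip hD' ha hb
    linarith
  have hCd : 0 ≤ C * dist w z := mul_nonneg C.2 dist_nonneg
  rcases h with ⟨h1, h2⟩ | ⟨h1, h2⟩ | ⟨h1, h2⟩ | ⟨h1, h2⟩ | ⟨h1, h2, y, hy, h3, h4⟩
  · have := hlip hD h1 h2
    rw [dist_comm] at this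
    linarith
  · have := hSD h1 h2
    rw [dist_comm] at this
    linarith
  · have := hlip hD' h1 h2
    rw [dist_comm] at this
    linarith
  · have := hD'S h1 h2
    rw [dist_comm] at this
    linarith
  · have e1 := hD'S h1 hy
    have e2 := hSD hy h2
    have e3 := mul_le_mul_of_nonneg_left h3 C.2
    have e4 := mul_le_mul_of_nonneg_left h4 C.2
    change (C : ℝ) * dist z y ≤ C * dist w z at e3
    change (C : ℝ) * dist y w ≤ C * dist w z at e4
    linarith

/-- With the sign `ζ` of `SignedJump`, the value on the curve is the limit from the side selected by `ζ`. -/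
theorem limits_of_signedJump {g : ℝ × ℝ → ℝ} (hmax : G.MaxOnCurves g) {i : ℤ} {ζ : ℝ}
    (hζ : ζ = -1 ∨ ζ = 1) {y : ℝ × ℝ} (hy : y ∈ G.curve i) (hj : G.SignedJump g i ζ y) :
    Tendsto g (𝓝[G.region (if ζ = 1 then i - 1 else i)] y) (𝓝 (g y)) ∧
      ∃ β ≤ g y, Tendsto g (𝓝[G.region (if ζ = 1 then i else i - 1)] y) (𝓝 β) := by
  obtain ⟨a, b, ha, hb, hab⟩ := hmax i y hy
  obtain ⟨a', b', ha', hb', hab'⟩ := hj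
  have : (𝓝[G.region (i - 1)] y).NeBot :=
    mem_closure_iff_nhdsWithin_neBot.1 (G.curve_subset_closure (Or.inr rfl) hy)
  have : (𝓝[G.region i] y).NeBot :=
    mem_closure_iff_nhdsWithin_neBot.1 (G.curve_subset_closure (Or.inl rfl) hy)
  obtain rfl := tendsto_nhds_unique ha ha'
  obtain rfl := tendsto_nhds_unique hb hb'
  rcases hζ with rfl | rfl
  · have h1 : g y = b := by rw [hab, max_eq_right]; linarith
    rw [if_neg (by norm_num), if_neg (by norm_num), h1]
    exact ⟨hb, a, by linarith, ha⟩
  · have h1 : g y = a := by rw [hab, max_eq_left]; linarith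
    rw [if_pos rfl, if_pos rfl, h1]
    exact ⟨ha, b, by linarith, hb⟩

/-- Along a segment which joins two points on different sides of the graph of `f` there is a point of
the graph. -/
theorem exists_mem_graph_between {f : ℝ → ℝ} {I I' : Set ℝ} (hI : Convex ℝ I) (hI' : Convex ℝ I')
    (hf : ContinuousOn f I) {z w : ℝ × ℝ} (hz : z ∈ I ×ˢ I') (hw : w ∈ I ×ˢ I')
    (h : (z.2 < f z.1 ∧ f w.1 < w.2) ∨ (f z.1 < z.2 ∧ w.2 < f w.1)) :
    ∃ y ∈ I ×ˢ I', y.2 = f y.1 ∧ dist z y ≤ dist w z ∧ dist y w ≤ dist w z := by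
  set γ : ℝ → ℝ × ℝ := fun s => AffineMap.lineMap z w s with hγ
  have hγm : ∀ s ∈ Icc (0 : ℝ) 1, γ s ∈ I ×ˢ I' := fun s hs =>
    (hI.prod hI').lineMap_mem hz hw hs
  have hγc : Continuous γ := AffineMap.lineMap_continuous
  have hcont : ContinuousOn (fun s => (γ s).2 - f (γ s).1) (uIcc 0 1) := by
    rw [uIcc_of_le zero_le_one]
    exact (continuous_snd.comp hγc).continuousOn.sub
      (hf.comp (continuous_fst.comp hγc).continuousOn fun s hs => (hγm s hs).1)
  have h0 : (0 : ℝ) ∈ uIcc ((γ 0).2 - f (γ 0).1) ((γ 1).2 - f (γ 1).1) := by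
    simp only [hγ, AffineMap.lineMap_apply_zero, AffineMap.lineMap_apply_one]
    rw [mem_uIcc]
    rcases h with h | h
    · exact Or.inl ⟨by linarith [h.1], by linarith [h.2]⟩
    · exact Or.inr ⟨by linarith [h.2], by linarith [h.1]⟩
  obtain ⟨s, hs, hs0⟩ := intermediate_value_uIcc hcont h0
  rw [uIcc_of_le zero_le_one] at hs
  refine ⟨γ s, hγm s hs, by simp only at hs0; linarith, ?_, ?_⟩
  · simp only [hγ, dist_left_lineMap, Real.norm_eq_abs, abs_of_nonneg hs.1, dist_comm w z]
    exact mul_le_of_le_one_left dist_nonneg hs.2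
  · simp only [hγ, dist_lineMap_right, Real.norm_eq_abs, dist_comm w z]
    rw [abs_of_nonneg (by linarith [hs.2])]
    exact mul_le_of_le_one_left dist_nonneg (by linarith [hs.1])

/-- At points of a curve off `Γ` one of the directions `(1, -1)` and `(-1, 1)` is favorable, namely
the one which points to the side with the larger weights. As the curve is increasing, all directions
close to it point to this side as well. -/
theorem hasFavorableDirection_curve (hF : G.IsGraph F) {μ σ : ℝ × ℝ → ℝ} (hμ : G.F1 μ)
    (hσ : G.F1 fun x => σ x ^ 2) (hμmax : G.MaxOnCurves μ) (hσmax : G.MaxOnCurves fun x => σ x ^ 2)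
    (h3 : G.SimultaneousF3 μ fun x => σ x ^ 2) {x : ℝ × ℝ} (hx : x ∈ openQuadrant)
    (hxΓ : x ∉ G.Γ) {i : ℤ} (hxi : x ∈ G.curve i) : HasFavorableDirection μ σ x := by
  obtain ⟨J, f, a, hJ, hfc, hfm, heq, haJ, hmin, hmaxJ, hfr⟩ := G.exists_param i
  have hxi' := hxi
  rw [heq] at hxi'
  obtain ⟨t₀, ht₀, rfl⟩ := hxi'
  have hat₀ : a < t₀ := by
    refine lt_of_le_of_ne (hmin t₀ ht₀) ?_
    rintro rfl
    exact hxΓ (hF.mem_of_mem_frontier hx hfr)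
  obtain ⟨t₁, ht₁, ht₀₁⟩ := hmaxJ t₀ ht₀
  have hJnhds : J ∈ 𝓝 t₀ := mem_of_superset (Icc_mem_nhds hat₀ ht₀₁) (hJ.out haJ ht₁)
  have habove : F t₀ < f t₀ := by
    refine lt_of_le_of_ne (hF.mem_outer.1 (curve_subset_outer hF i hxi)).2 fun h => hxΓ ?_
    rw [hF.eq]
    exact ⟨openQuadrant_subset_quadrant hx, h.symm⟩
  -- the other curves stay away from `x`
  have hother : IsClosed (⋃ j : {j // j ≠ i}, G.curve j) :=
    (G.locallyFinite.comp_injective Subtype.val_injective).isClosed_iUnion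
      fun j => G.isClosed_curve j
  have hxother : (t₀, f t₀) ∉ ⋃ j : {j // j ≠ i}, G.curve j := by
    rw [mem_iUnion]
    rintro ⟨⟨j, hj⟩, hxj⟩
    exact disjoint_left.1 (G.disjoint hj) hxj hxi
  obtain ⟨ε, hε, ζ, hζ, hjump⟩ := h3 i _ hxi
  obtain ⟨ρ, hρ, r, hr, hρr, hρJ, hfr', hsub⟩ := exists_rectangle (hfc.continuousAt hJnhds)
    (inter_mem (inter_mem (isOpen_openQuadrant.mem_nhds hx) (hF.isOpen_above.mem_nhds habove))
      (inter_mem (hother.isOpen_compl.mem_nhds hxother) (Metric.ball_mem_nhds _ hε))) hJnhds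
  set I := Ioo (t₀ - ρ) (t₀ + ρ) with hI
  set B := I ×ˢ Ioo (f t₀ - r) (f t₀ + r) with hB
  have hxB : (t₀, f t₀) ∈ B := ⟨⟨by linarith, by linarith⟩, by simp only; linarith, by
    simp only; linarith⟩
  have hBopen : IsOpen B := isOpen_Ioo.prod isOpen_Ioo
  have hballB : Metric.ball (t₀, f t₀) ρ ⊆ B := by
    intro y hy
    rw [Metric.mem_ball, Prod.dist_eq, max_lt_iff, Real.dist_eq, Real.dist_eq, abs_lt, abs_lt] at hy
    obtain ⟨⟨h1, h2⟩, h3, h4⟩ := hy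
    simp only at h1 h2 h3 h4
    exact ⟨⟨by linarith, by linarith⟩, by linarith, by linarith⟩
  have hfI : ContinuousOn f I := hfc.mono hρJ
  have hmemcurve : ∀ y ∈ B, y ∈ G.curve i ↔ y.2 = f y.1 := by
    intro y hy
    rw [heq]
    constructor
    · rintro ⟨t, ht, rfl⟩; rfl
    · intro h; exact ⟨y.1, hρJ hy.1, Prod.ext rfl h.symm⟩
  have hBW : ∀ y ∈ B, y.2 ≠ f y.1 → y ∈ (quadrant \ boundedPart G.Γ) \ ⋃ j, G.curve j := by
    intro y hy hne
    obtain ⟨⟨h1, h2⟩, h4, -⟩ := hsub hy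
    refine ⟨hF.mem_outer.2 ⟨openQuadrant_subset_quadrant h1, le_of_lt h2⟩, fun hmem => ?_⟩
    obtain ⟨j, hj⟩ := mem_iUnion.1 hmem
    by_cases hji : j = i
    · subst hji
      exact hne ((hmemcurve y hy).1 hj)
    · exact h4 (mem_iUnion.2 ⟨⟨j, hji⟩, hj⟩)
  -- each side of the curve in the rectangle belongs to one region
  have hside : ∀ c : ℝ, |c - f t₀| = r → ∃ k, ∀ s ∈ I, ∀ u ∈ Ioo (0 : ℝ) 1,
      (s, f s + u * (c - f s)) ∈ G.region k := by
    intro c hc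
    have hconn := isPreconnected_between (isPreconnected_Ioo (a := t₀ - ρ) (b := t₀ + ρ))
      (isPreconnected_Ioo (a := (0 : ℝ)) (b := 1)) hfI c
    obtain ⟨k, hk⟩ := G.exists_subset_region hconn
      ⟨_, (t₀, 1 / 2), ⟨hxB.1, by norm_num, by norm_num⟩, rfl⟩ (by
        rintro _ ⟨⟨s, u⟩, ⟨hs, hu⟩, rfl⟩
        have hfs := hfr' s hs
        simp only at hs hu ⊢
        have hconv : f s + u * (c - f s) = (1 - u) * f s + u * c := by ring
        have hu1 : 0 < 1 - u := by linarith [hu.2]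
        have hcr : c = f t₀ + r ∨ c = f t₀ - r := by
          rcases (abs_eq hr.le).1 hc with h | h
          · left; linarith
          · right; linarith
        refine hBW _ ⟨hs, ?_⟩ ?_
        · simp only [hconv]
          have h1 := mul_lt_mul_of_pos_left hfs.1 hu1
          have h2 := mul_lt_mul_of_pos_left hfs.2 hu1
          have hur := mul_pos hu.1 hr
          have hur' := mul_pos hu1 hr
          rcases hcr with rfl | rfl
          · constructor <;> nlinarith
          · constructor <;> nlinarith
        · simp only [ne_eq, add_eq_left, mul_eq_zero, not_or]
          refine ⟨hu.1.ne', ?_⟩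
          rcases hcr with rfl | rfl
          · exact fun e => by linarith [hfs.2]
          · exact fun e => by linarith [hfs.1])
    exact ⟨k, fun s hs u hu => hk ⟨(s, u), ⟨hs, hu⟩, rfl⟩⟩
  obtain ⟨k, hk⟩ := hside (f t₀ + r) (by rw [add_sub_cancel_left, abs_of_pos hr])
  obtain ⟨k', hk'⟩ := hside (f t₀ - r) (by rw [sub_sub_cancel_left, abs_neg, abs_of_pos hr])
  have hupper : ∀ y ∈ B, f y.1 < y.2 → y ∈ G.region k := by
    rintro ⟨s, y⟩ ⟨hs, hy⟩ hlt
    simp only at hs hy hlt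
    have hd : 0 < f t₀ + r - f s := by linarith [(hfr' s hs).2]
    have := hk s hs ((y - f s) / (f t₀ + r - f s)) ⟨div_pos (by linarith) hd, by
      rw [div_lt_one hd]; linarith [hy.2]⟩
    rw [div_mul_cancel₀ _ hd.ne'] at this
    simpa using this
  have hlower : ∀ y ∈ B, y.2 < f y.1 → y ∈ G.region k' := by
    rintro ⟨s, y⟩ ⟨hs, hy⟩ hlt
    simp only at hs hy hlt
    have hd : f t₀ - r - f s < 0 := by linarith [(hfr' s hs).1]
    have := hk' s hs ((y - f s) / (f t₀ - r - f s)) ⟨div_pos_of_neg_of_neg (by linarith) hd, by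
      rw [div_lt_one_of_neg hd]; linarith [hy.1]⟩
    rw [div_mul_cancel₀ _ hd.ne] at this
    simpa using this
  have hmeets : ∀ j, j = i ∨ j = i - 1 → j = k ∨ j = k' := by
    intro j hj
    obtain ⟨y, hyB, hyj⟩ := mem_closure_iff_nhds.1 (G.curve_subset_closure hj hxi) B
      (hBopen.mem_nhds hxB)
    have hne : y.2 ≠ f y.1 := fun h => (G.region_subset j hyj).2
      (mem_iUnion.2 ⟨i, (hmemcurve y hyB).2 h⟩)
    rcases hne.lt_or_gt with h | h
    · exact Or.inr (G.eq_of_mem_region hyj (hlower y hyB h))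
    · exact Or.inl (G.eq_of_mem_region hyj (hupper y hyB h))
  -- `κ` labels the side with the larger weights; it is the one above the curve if `k = κ`
  set κ := if ζ = 1 then i - 1 else i with hκ
  set κ' := if ζ = 1 then i else i - 1 with hκ'
  have hκκ' : (k = κ ∧ k' = κ') ∨ (k = κ' ∧ k' = κ) := by
    have e1 := hmeets i (Or.inl rfl)
    have e2 := hmeets (i - 1) (Or.inr rfl)
    rw [hκ, hκ']
    split_ifs <;> omega
  have hκi : κ = i ∨ κ = i - 1 := by rw [hκ]; split_ifs <;> simp
  have hκi' : κ' = i ∨ κ' = i - 1 := by rw [hκ']; split_ifs <;> simp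
  have key : ∀ g, G.F1 g → G.MaxOnCurves g →
      (∀ y ∈ Metric.ball (t₀, f t₀) ε ∩ G.curve i, G.SignedJump g i ζ y) →
      ∃ C : NNReal, ∀ z w, ((z ∈ G.region κ ∧ w ∈ G.region κ) ∨
        (z ∈ G.curve i ∩ Metric.ball (t₀, f t₀) ε ∧ w ∈ G.region κ) ∨
        (z ∈ G.region κ' ∧ w ∈ G.region κ') ∨
        (z ∈ G.region κ' ∧ w ∈ G.curve i ∩ Metric.ball (t₀, f t₀) ε) ∨
        (z ∈ G.region κ' ∧ w ∈ G.region κ ∧ ∃ y ∈ G.curve i ∩ Metric.ball (t₀, f t₀) ε,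
          dist z y ≤ dist w z ∧ dist y w ≤ dist w z)) → g z ≤ g w + 2 * C * dist w z := by
    intro g hg hgmax hj
    obtain ⟨C, hC⟩ := hg.lipschitz
    exact ⟨C, fun z w h => le_add_across (hC κ) (hC κ')
      (inter_subset_left.trans (G.curve_subset_closure hκi))
      (inter_subset_left.trans (G.curve_subset_closure hκi'))
      (fun y hy => limits_of_signedJump hgmax hζ hy.1 (hj y ⟨hy.2, hy.1⟩)) h⟩
  obtain ⟨C₁, h₁⟩ := key μ hμ hμmax fun y hy => (hjump y hy).1
  obtain ⟨C₂, h₂⟩ := key _ hσ hσmax fun y hy => (hjump y hy).2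
  have hconclude : ∀ e : ℝ × ℝ, ‖e‖ ≤ 1 → (∀ z ∈ B, ∀ w ∈ B, ∀ δ > 0,
      ‖w - z - δ • e‖ < 1 / 2 * δ → z ∉ G.region κ' → w ∈ G.region κ) →
      HasFavorableDirection μ σ (t₀, f t₀) := by
    intro e he hdir
    refine hasFavorableDirection_of_le_add (C := max (2 * C₁) (2 * C₂)) he hρ
      (le_max_of_le_left (by positivity)) fun z hz w hw δ hδ hzw => ?_
    have hzB := hballB hz
    have hwB := hballB hw
    have hmem : ∀ y ∈ B, y.2 = f y.1 → y ∈ G.curve i ∩ Metric.ball (t₀, f t₀) ε := fun y hy h =>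
      ⟨(hmemcurve y hy).2 h, (hsub hy).2.2⟩
    have htri : ∀ y ∈ B, y ∈ G.region κ ∨ y ∈ G.region κ' ∨ y.2 = f y.1 := by
      intro y hy
      rcases lt_trichotomy y.2 (f y.1) with h | h | h
      · have := hlower y hy h
        rcases hκκ' with ⟨-, e2⟩ | ⟨-, e2⟩ <;> rw [e2] at this <;> simp [this]
      · simp [h]
      · have := hupper y hy h
        rcases hκκ' with ⟨e1, -⟩ | ⟨e1, -⟩ <;> rw [e1] at this <;> simp [this]
    have hcases : (z ∈ G.region κ ∧ w ∈ G.region κ) ∨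
        (z ∈ G.curve i ∩ Metric.ball (t₀, f t₀) ε ∧ w ∈ G.region κ) ∨
        (z ∈ G.region κ' ∧ w ∈ G.region κ') ∨
        (z ∈ G.region κ' ∧ w ∈ G.curve i ∩ Metric.ball (t₀, f t₀) ε) ∨
        (z ∈ G.region κ' ∧ w ∈ G.region κ ∧ ∃ y ∈ G.curve i ∩ Metric.ball (t₀, f t₀) ε,
          dist z y ≤ dist w z ∧ dist y w ≤ dist w z) := by
      by_cases hz' : z ∈ G.region κ'
      · rcases htri w hwB with h | h | h
        · refine Or.inr (Or.inr (Or.inr (Or.inr ⟨hz', h, ?_⟩)))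
          have hzne : z.2 ≠ f z.1 := fun e => (G.region_subset _ hz').2
            (mem_iUnion.2 ⟨i, (hmemcurve z hzB).2 e⟩)
          have hwne : w.2 ≠ f w.1 := fun e => (G.region_subset _ h).2
            (mem_iUnion.2 ⟨i, (hmemcurve w hwB).2 e⟩)
          have hκne : κ ≠ κ' := by rw [hκ, hκ']; split_ifs <;> omega
          have hopp : (z.2 < f z.1 ∧ f w.1 < w.2) ∨ (f z.1 < z.2 ∧ w.2 < f w.1) := by
            rcases hzne.lt_or_gt with e1 | e1 <;> rcases hwne.lt_or_gt with e2 | e2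
            · exact absurd ((G.eq_of_mem_region h (hlower w hwB e2)).trans
                (G.eq_of_mem_region (hlower z hzB e1) hz')) hκne
            · exact Or.inl ⟨e1, e2⟩
            · exact Or.inr ⟨e1, e2⟩
            · exact absurd ((G.eq_of_mem_region h (hupper w hwB e2)).trans
                (G.eq_of_mem_region (hupper z hzB e1) hz')) hκne
          obtain ⟨y, hyB, hy, hd⟩ := exists_mem_graph_between (convex_Ioo _ _) (convex_Ioo _ _) hfI
            hzB hwB hopp
          exact ⟨y, hmem y hyB hy, hd⟩
        · exact Or.inr (Or.inr (Or.inl ⟨hz', h⟩))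
        · exact Or.inr (Or.inr (Or.inr (Or.inl ⟨hz', hmem w hwB h⟩)))
      · have hw' := hdir z hzB w hwB δ hδ hzw hz'
        rcases htri z hzB with h | h | h
        · exact Or.inl ⟨h, hw'⟩
        · exact absurd h hz'
        · exact Or.inr (Or.inl ⟨hmem z hzB h, hw'⟩)
    rw [← dist_eq_norm]
    have h9 := mul_le_mul_of_nonneg_right (le_max_left (2 * C₁ : ℝ) (2 * C₂))
      (dist_nonneg (x := w) (y := z))
    have h10 := mul_le_mul_of_nonneg_right (le_max_right (2 * C₁ : ℝ) (2 * C₂))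
      (dist_nonneg (x := w) (y := z))
    exact ⟨(h₁ z w hcases).trans (by linarith), (h₂ z w hcases).trans (by linarith)⟩
  rcases hκκ' with ⟨rfl, rfl⟩ | ⟨rfl, rfl⟩
  · refine hconclude (-1, 1) (by simp [Prod.norm_def]) fun z hz w hw δ hδ hzw hz' => ?_
    obtain ⟨e1, e2⟩ := abs_lt_of_norm_sub_lt hzw
    rw [abs_lt] at e1 e2
    have hzf : f z.1 ≤ z.2 := le_of_not_gt fun h => hz' (hlower z hz h)
    have := hfm (hρJ hw.1) (hρJ hz.1) (by linarith [e1.2] : w.1 < z.1)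
    exact hupper w hw (by linarith [e2.1])
  · refine hconclude (1, -1) (by simp [Prod.norm_def]) fun z hz w hw δ hδ hzw hz' => ?_
    obtain ⟨e1, e2⟩ := abs_lt_of_norm_sub_lt hzw
    rw [abs_lt] at e1 e2
    have hzf : z.2 ≤ f z.1 := le_of_not_gt fun h => hz' (hupper z hz h)
    have := hfm (hρJ hz.1) (hρJ hw.1) (by linarith [e1.1] : z.1 < w.1)
    exact hlower w hw (by linarith [e2.2])

/-- Only finitely many curves meet a compact set; this bounds intersections of the union of the
curves with sets which meet each curve in at most one point. -/
theorem finite_of_subsingleton {α : Type*} (G : Configuration) {K : Set (ℝ × ℝ)} (hK : IsCompact K)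
    (φ : α → ℝ × ℝ) {A : Set α} (hA : ∀ t ∈ A, φ t ∈ K ∩ ⋃ i, G.curve i)
    (hsub : ∀ i, {t ∈ A | φ t ∈ G.curve i}.Subsingleton) : A.Finite := by
  refine ((G.locallyFinite.finite_nonempty_inter_compact hK).biUnion fun i _ =>
    (hsub i).finite).subset fun t ht => ?_
  obtain ⟨h1, h2⟩ := hA t ht
  obtain ⟨i, hi⟩ := mem_iUnion.1 h2
  exact mem_biUnion (show i ∈ {i | (G.curve i ∩ K).Nonempty} from ⟨φ t, hi, h1⟩) ⟨ht, hi⟩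

/-- Points of `Γ` which belong to one of the curves need not have a favorable direction. They are
isolated, because every increasing curve meets the decreasing curve `Γ` at most once. -/
theorem admissible (G : Configuration) {μ σ : ℝ × ℝ → ℝ} (hσ0 : ∀ x ∈ quadrant, 0 ≤ σ x)
    (hμ : G.F1 μ) (hσ : G.F1 fun x => σ x ^ 2) (hμmax : G.MaxOnCurves μ)
    (hσmax : G.MaxOnCurves fun x => σ x ^ 2) (h3 : G.SimultaneousF3 μ fun x => σ x ^ 2)
    (hzero : ∀ x ∈ openQuadrant, σ x = 0 → μ x = 0) : Admissible μ σ := by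
  obtain ⟨F, hF⟩ := G.exists_isGraph
  refine ⟨fun x hx => ⟨hμ.nonneg x hx, hσ0 x hx⟩, ?_, ⟨hμ.usc, hσ.usc⟩, hzero, ?_, ?_⟩
  · obtain ⟨M, hM⟩ := hμ.bounded
    obtain ⟨N, hN⟩ := hσ.bounded
    refine ⟨max M (N + 1), fun x hx => ⟨le_max_of_le_left (hM ⟨x, hx, rfl⟩), le_max_of_le_right ?_⟩⟩
    exact (le_abs_self _).trans (abs_le_add_one_of_sq_le (hN ⟨x, hx, rfl⟩))
  · refine ⟨G.Γ ∪ ⋃ i, G.curve i, hF.isClosed.union G.isClosed_iUnion_curve, fun x hx hxE =>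
      ⟨continuousWithinAt_of_notMem hF hμ hx hxE, continuousWithinAt_of_notMem hF hσ hx hxE⟩,
      fun c R => ?_, fun c R => ?_⟩
    · have h1 : {t ∈ Icc 0 R | (c, t) ∈ ⋃ i, G.curve i}.Finite := by
        refine G.finite_of_subsingleton (isCompact_Icc.image (f := fun t => (c, t)) (by fun_prop))
          (fun t => (c, t)) (fun t ht => ⟨⟨t, ht.1, rfl⟩, ht.2⟩) fun i s hs t ht => ?_
        obtain ⟨J, f, -, -, -, heq⟩ := G.increasing i
        have hs := hs.2
        have ht := ht.2
        rw [heq] at hs ht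
        obtain ⟨u, -, hu⟩ := hs
        obtain ⟨v, -, hv⟩ := ht
        simp only [Prod.mk.injEq] at hu hv
        rw [← hu.2, ← hv.2, hu.1, hv.1]
      refine (h1.union (finite_singleton (F c))).subset ?_
      rintro t ⟨ht, hE | hE, -⟩
      · rw [hF.eq] at hE
        exact Or.inr hE.2
      · exact Or.inl ⟨ht, hE⟩
    · have h1 : {t ∈ Icc 0 R | (t, c) ∈ ⋃ i, G.curve i}.Finite := by
        refine G.finite_of_subsingleton (isCompact_Icc.image (f := fun t => (t, c)) (by fun_prop))
          (fun t => (t, c)) (fun t ht => ⟨⟨t, ht.1, rfl⟩, ht.2⟩) fun i s hs t ht => ?_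
        obtain ⟨J, f, -, -, hfm, heq⟩ := G.increasing i
        have hs := hs.2
        have ht := ht.2
        rw [heq] at hs ht
        obtain ⟨u, huJ, hu⟩ := hs
        obtain ⟨v, hvJ, hv⟩ := ht
        simp only [Prod.mk.injEq] at hu hv
        rw [← hu.1, ← hv.1]
        exact hfm.injOn huJ hvJ (hu.2.trans hv.2.symm)
      have h2 : {t | F t = c}.Finite :=
        (show {t | F t = c}.Subsingleton from fun s hs t ht =>
          hF.strictAnti.injective (Eq.trans hs (Eq.symm ht))).finite
      refine (h1.union h2).subset ?_
      rintro t ⟨ht, hE | hE, -⟩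
      · rw [hF.eq] at hE
        exact Or.inr hE.2.symm
      · exact Or.inl ⟨ht, hE⟩
  · refine ⟨G.Γ ∩ ⋃ i, G.curve i, fun z => ?_, fun x hx hxS => ?_⟩
    · refine G.finite_of_subsingleton (isCompact_Icc (a := ((0, 0) : ℝ × ℝ)) (b := z)) id
        (fun t ht => ⟨ht.2, ht.1.2⟩) fun i p hp q hq => ?_
      obtain ⟨⟨⟨hpΓ, -⟩, -⟩, hpi⟩ := hp
      obtain ⟨⟨⟨hqΓ, -⟩, -⟩, hqi⟩ := hq
      obtain ⟨J, f, -, -, hfm, heq⟩ := G.increasing i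
      rw [hF.eq] at hpΓ hqΓ
      rw [heq] at hpi hqi
      obtain ⟨s, hs, rfl⟩ := hpi
      obtain ⟨t, ht, rfl⟩ := hqi
      have e1 : f s = F s := hpΓ.2
      have e2 : f t = F t := hqΓ.2
      rcases lt_trichotomy s t with h | rfl | h
      · linarith [hfm hs ht h, hF.strictAnti h]
      · rfl
      · linarith [hfm ht hs h, hF.strictAnti h]
    · by_cases hxΓ : x ∈ G.Γ
      · exact hasFavorableDirection_Γ hF hμ hσ hx hxΓ fun h => hxS ⟨hxΓ, h⟩
      by_cases hxc : x ∈ ⋃ i, G.curve i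
      · obtain ⟨i, hi⟩ := mem_iUnion.1 hxc
        exact hasFavorableDirection_curve hF hμ hσ hμmax hσmax h3 hx hxΓ hi
      · have hq := openQuadrant_subset_quadrant hx
        have hxE : x ∉ G.Γ ∪ ⋃ i, G.curve i := fun h => h.elim hxΓ hxc
        exact hasFavorableDirection_of_continuousWithinAt hx
          (continuousWithinAt_of_notMem hF hμ hq hxE) (continuousWithinAt_of_notMem hF hσ hq hxE)

end Configuration

end DLPP

theorem mainTheorem9 (G : DLPP.Configuration) (μ σ μs : ℝ × ℝ → ℝ)
    (hσ : ∀ x ∈ DLPP.quadrant, 0 ≤ σ x)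
    (hμ1 : G.F1 μ) (hσ1 : G.F1 (fun x => σ x ^ 2))
    (hμmax : G.MaxOnCurves μ) (hσmax : G.MaxOnCurves (fun x => σ x ^ 2))
    (h3 : G.SimultaneousF3 μ (fun x => σ x ^ 2))
    (hzero : ∀ x ∈ DLPP.openQuadrant, σ x = 0 → μ x = 0)
    (hs : DLPP.F2 μs) :
    ∃ U : ℝ × ℝ → ℝ, DLPP.IsMonotoneSolution μ σ μs U ∧
      (∀ V : ℝ × ℝ → ℝ, DLPP.IsMonotoneSolution μ σ μs V → EqOn V U DLPP.quadrant) ∧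
      TendstoLocallyUniformlyOn (fun h : ℝ => DLPP.numericalSolution μ σ μs h) U (𝓝[>] 0)
        DLPP.quadrant := by
  exact (G.admissible hσ hμ1 hσ1 hμmax hσmax h3 hzero).exists_unique_solution hs
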